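/- Let $1\le p<\frac43$, let $p'$ be the conjugate exponent, $\frac1p+\frac1{p'}=1$ (with $\frac{2}{p'}=0$ when $p=1$), and let $\delta\in\mathbb R$ satisfy $\delta<\frac12-\frac2{p'}$. For $z\in\mathbb C\setminus[0,\infty)$ let $R_0(z)=(-\Delta-z)^{-1}$ be the free resolvent on $\mathbb R^3$, \[ (R_0(z)f)(x)=\int_{\mathbb R^3}\frac{e^{i\sqrt z\,|x-y|}}{4\pi|x-y|}\,f(y)\,dy,\qquad \operatorname{Im}\sqrt z>0. \] For a Schwartz function $\varphi$ put $\hat\varphi(\xi)=\int_{\mathbb R^3}e^{-ix\cdot\xi}\varphi(x)\,dx$. For $f\in L^p(\mathbb R^3)$ we say that $\hat f=0$ on the unit sphere $S^2$ if the $L^2(S^2)$-trace of $\hat f$, defined by extension by density from Schwartz functions, is zero, that is, if there are Schwartz functions $\varphi_n\to f$ in $L^p(\mathbb R^3)$ with $\hat\varphi_n|_{S^2}\to0$ in $L^2(S^2)$ with respect to surface measure. Then there is a constant $C<\infty$ depending only on $p$ and $\delta$ such that for every complex-valued $f\in L^p(\mathbb R^3)$ with $\hat f=0$ on $S^2$ and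 for both choices of sign, the integral defining $R_0(1\pm i\varepsilon)f(x)$ converges absolutely for almost every $x$ for every $\varepsilon>0$, and \[ \sup_{\varepsilon>0}\Big\|(1+|x|)^{\delta-\frac12}\,R_0(1\pm i\varepsilon)f\Big\|_{L^2(\mathbb R^3)}\le C\,\|f\|_{L^p(\mathbb R^3)}. \] -/

import Mathlib

open MeasureTheory Filter Topology
open scoped ENNReal NNReal FourierTransform SchwartzMap

/-- Euclidean three-space `ℝ³`. -/
abbrev E3 : Type := EuclideanSpace ℝ (Fin 3)

/-- The unit sphere `S²` in `ℝ³`. -/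
abbrev S2 : Type := Metric.sphere (0 : E3) 1

/-- The surface measure on `S²`. -/
noncomputable def sphereMeasure : Measure S2 := (volume : Measure E3).toSphere

/-- The Fourier transform of a Schwartz function in the angular-frequency convention,
`φ̂(ξ) = ∫ exp(-i x·ξ) φ(x) dx`. In this convention `-Δ` is multiplication by `|ξ|²`, and Mathlib's
`𝓕` (with the phase `exp(-2πi x·ξ)`) has to be evaluated at `ξ / (2π)`. -/
noncomputable def angularFourier (φ : 𝓢(E3, ℂ)) (ξ : E3) : ℂ :=
  𝓕 (φ : E3 → ℂ) ((2 * Real.pi)⁻¹ • ξ)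

theorem angularFourier_eq_integral (φ : 𝓢(E3, ℂ)) (ξ : E3) :
    angularFourier φ ξ =
      ∫ x : E3, Complex.exp (-(Complex.I * ((inner ℝ x ξ : ℝ) : ℂ))) * φ x := by
  unfold angularFourier
  rw [Real.fourier_eq']
  congr 1
  ext x
  have hpi : (Real.pi : ℂ) ≠ 0 := by exact_mod_cast Real.pi_ne_zero
  rw [smul_eq_mul, inner_smul_right]
  congr 2
  push_cast
  field_simp

/-- `g` is the trace (restriction) of `f̂` to `S²`, where `f ∈ L^p(ℝ³)`: the restriction map
`φ ↦ φ̂|_{S²}`, defined on Schwartz functions, is extended by density as a map from `L^p(ℝ³)` to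
`L²(S²)`. Thus there are Schwartz functions `φₙ → f` in `L^p(ℝ³)` with `φ̂ₙ|_{S²} → g` in
`L²(S²)`. -/
def HasSphereFourierTrace (p : ℝ≥0∞) (f : E3 → ℂ) (g : S2 → ℂ) : Prop :=
  ∃ φ : ℕ → 𝓢(E3, ℂ),
    Tendsto (fun n => eLpNorm (fun x => φ n x - f x) p volume) atTop (𝓝 0) ∧
    Tendsto (fun n => eLpNorm (fun ω : S2 => angularFourier (φ n) (ω : E3) - g ω) 2 sphereMeasure)
      atTop (𝓝 0)

/-- The square root of `z` in the upper half-plane: for `z ∉ [0, ∞)` this is the unique `k` with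
`k ^ 2 = z` and `0 < Im k`. -/
noncomputable def upperSqrt (z : ℂ) : ℂ := Complex.I * (-z) ^ (1 / 2 : ℂ)

theorem upperSqrt_sq (z : ℂ) : upperSqrt z ^ 2 = z := by
  have h : ((-z) ^ (1 / 2 : ℂ)) ^ 2 = -z := by
    rw [one_div]
    exact_mod_cast Complex.cpow_nat_inv_pow (-z) two_ne_zero
  rw [upperSqrt, mul_pow, h, Complex.I_sq]
  ring

/-- The integral kernel of `(-Δ - z)⁻¹` on `ℝ³`, as a function of the difference `x - y`:
`exp(i √z |x|) / (4 π |x|)` with `Im √z > 0`. -/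
noncomputable def freeResolventKernel (z : ℂ) (x : E3) : ℂ :=
  Complex.exp (Complex.I * upperSqrt z * (‖x‖ : ℂ)) / (4 * (Real.pi : ℂ) * (‖x‖ : ℂ))

/-- The free resolvent `R₀(z) = (-Δ - z)⁻¹`, `z ∉ [0, ∞)`, as an integral operator. -/
noncomputable def freeResolvent (z : ℂ) (f : E3 → ℂ) (x : E3) : ℂ :=
  ∫ y : E3, freeResolventKernel z (x - y) * f y

/-! Write z = 1 ± iε, θ = 2 - 2/p = 2/p', η = 1/2 - δ, and let K be the kernel of R₀(z). The
argument first measures how fast the unweighted L² norm of R₀(z)f blows up as ε → 0, and then lets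
the weight absorb that blow-up.

Energy identity. The imaginary part of the symbol 1/(|ξ|² - z) is Im z times its squared modulus, so
by Plancherel Im z · ‖R₀(z)f‖² is the form ⟨f, (Im K) ∗ f⟩. Up to the sign of Im z, Im K tends to
sin|x|/(4π|x|), whose form is the squared L²(S²) norm of f̂ divided by 16π². Hence ‖R₀(z)f‖² is at
most ε⁻¹ times the sphere term plus the form of a difference quotient of kernels. That quotient is
bounded by min(1, 1/(ε|x|)), while oscillation bounds the Fourier transform of its piece on |x| ~
2^j/ε by a multiple of 2^j/ε². Interpolation between L¹ → L^∞ and L² → L²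
(`norm_kernelForm_self_le`) bounds the form of this piece by a multiple of 2^{j(3 - 4/p)} ε^{-2θ}
‖f‖_p², a convergent geometric series because p < 4/3. So ‖R₀(z)f‖₂ is at most a multiple of
ε^{-θ}‖f‖_p plus ε^{-1/2} times the sphere norm (`integral_sq_resolvent_le`).

Weight. With z' = 1 ± 2iε, the difference D = R₀(z)f - R₀(z')f = (z - z')R₀(z)R₀(z')f satisfies ‖D‖²
≤ ‖R₀(z')f‖² globally and ‖D‖² ≤ 4Rε‖R₀(z')f‖² on the ball of radius R. Together these give the norm
weighted by (1 + |x|)^{-η} a gain ε^{η'} whenever 0 < η' < η and η' ≤ 1/2. Since θ < η and θ < 1/2,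
one can take η' > θ; the gain beats the loss and the telescoping sum over doubled ε is geometric. In
`exists_eLpNorm_weight_freeResolvent_le` the coefficient of ‖f‖_p is uniform in ε, whereas that of
the sphere norm may grow like ε⁻¹.

Density. For fixed ε the sphere term tends to zero along the Schwartz functions witnessing the
vanishing trace. Young's inequality gives convergence of the resolvents in L^p, and Fatou's lemma
transfers the bound to f (`eLpNorm_weight_freeResolvent_le_of_trace`). -/

/-! ### Plancherel and sesquilinear convolution forms -/

/-- On `L¹ ∩ L²` the `L²` Fourier transform is given by the Fourier integral. -/
theorem fourier_toLp_ae_eq {f : E3 → ℂ} (hf1 : Integrable f) (hf2 : MemLp f 2) :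
    (𝓕 (hf2.toLp f) : Lp ℂ 2 (volume : Measure E3)) =ᵐ[volume] 𝓕 f := by
  have hcont : Continuous (𝓕 f) :=
    VectorFourier.fourierIntegral_continuous Real.continuous_fourierChar
      (innerSL ℝ).continuous₂ hf1
  refine ae_eq_of_integral_contDiff_smul_eq
    ((Lp.memLp (𝓕 (hf2.toLp f))).locallyIntegrable (by norm_num)) hcont.locallyIntegrable ?_
  intro g hg hgs
  have hgc : ContDiff ℝ ((⊤ : ℕ∞) : WithTop ℕ∞) (fun x => (g x : ℂ)) := Complex.ofRealCLM.contDiff.comp hg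
  have hgs' : HasCompactSupport (fun x => (g x : ℂ)) := hgs.comp_left (g := fun r : ℝ => (r : ℂ)) rfl
  let ψ : 𝓢(E3, ℂ) := hgs'.toSchwartzMap hgc
  have hψ : ∀ x, ψ x = (g x : ℂ) := fun x => rfl
  -- As tempered distributions, both transforms pair with `ψ` to ∫ 𝓕ψ · f, and such pairings
  -- determine a locally integrable function.
  have h1 := congrArg (fun T => T ψ) (Lp.fourier_toTemperedDistribution_eq (hf2.toLp f))
  simp only [TemperedDistribution.fourier_apply, Lp.toTemperedDistribution_apply] at h1
  have h2 : ∫ x, (𝓕 ψ) x • (hf2.toLp f) x = ∫ x, 𝓕 (ψ : E3 → ℂ) x • f x := by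
    refine integral_congr_ae ?_
    filter_upwards [hf2.coeFn_toLp] with x hx
    rw [hx]; rfl
  have h3 : ∫ x, 𝓕 (ψ : E3 → ℂ) x • f x = ∫ x, (ψ x) • 𝓕 f x :=
    VectorFourier.integral_fourierIntegral_smul_eq_flip (L := innerₗ E3)
      Real.continuous_fourierChar continuous_inner ψ.integrable hf1 |>.trans (by
        simp only [flip_innerₗ]; rfl)
  have h4 := h1.symm.trans (h2.trans h3)
  simp only [hψ] at h4
  simpa only [Complex.real_smul, smul_eq_mul] using h4

theorem memLp_fourier {f : E3 → ℂ} (hf1 : Integrable f) (hf2 : MemLp f 2) :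
    MemLp (𝓕 f) 2 (volume : Measure E3) :=
  (memLp_congr_ae (fourier_toLp_ae_eq hf1 hf2)).1 (Lp.memLp _)

/-- Parseval's identity on `L¹ ∩ L²`. -/
theorem integral_conj_fourier_mul_fourier {f g : E3 → ℂ} (hf1 : Integrable f) (hf2 : MemLp f 2)
    (hg1 : Integrable g) (hg2 : MemLp g 2) :
    ∫ ξ, starRingEnd ℂ (𝓕 f ξ) * 𝓕 g ξ = ∫ x, starRingEnd ℂ (f x) * g x := by
  have h := Lp.inner_fourier_eq (hf2.toLp f) (hg2.toLp g)
  rw [L2.inner_def, L2.inner_def] at h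
  have e1 : ∫ ξ, starRingEnd ℂ (𝓕 f ξ) * 𝓕 g ξ = ∫ ξ, inner ℂ
      ((𝓕 (hf2.toLp f) : Lp ℂ 2 (volume : Measure E3)) ξ)
      ((𝓕 (hg2.toLp g) : Lp ℂ 2 (volume : Measure E3)) ξ) := by
    refine integral_congr_ae ?_
    filter_upwards [fourier_toLp_ae_eq hf1 hf2, fourier_toLp_ae_eq hg1 hg2] with x h1 h2
    rw [h1, h2, RCLike.inner_apply, mul_comm]
  rw [e1, h]
  refine integral_congr_ae ?_
  filter_upwards [hf2.coeFn_toLp, hg2.coeFn_toLp] with x h1 h2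
  rw [h1, h2, RCLike.inner_apply, mul_comm]

theorem integral_norm_sq_fourier {f : E3 → ℂ} (hf1 : Integrable f) (hf2 : MemLp f 2) :
    ∫ ξ, ‖𝓕 f ξ‖ ^ 2 = ∫ x, ‖f x‖ ^ 2 := by
  have h := integral_conj_fourier_mul_fourier hf1 hf2 hf1 hf2
  simp only [Complex.conj_mul'] at h
  exact_mod_cast h

/-- The convolution `K ∗ g`. -/
noncomputable def conv (K g : E3 → ℂ) (x : E3) : ℂ := ∫ y, K (x - y) * g y

/-- The sesquilinear form `⟨f, K ∗ g⟩`, as an integral over the product space. -/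
noncomputable def kernelForm (K f g : E3 → ℂ) : ℂ :=
  ∫ p : E3 × E3, starRingEnd ℂ (f p.1) * g p.2 * K (p.1 - p.2)

theorem conv_eq_convolution (K g : E3 → ℂ) :
    conv K g = convolution g K (ContinuousLinearMap.mul ℂ ℂ) volume := by
  ext x
  simp only [conv, convolution, ContinuousLinearMap.mul_apply', mul_comm]

theorem integrable_conv {K g : E3 → ℂ} (hK : Integrable K) (hg : Integrable g) :
    Integrable (conv K g) := by
  rw [conv_eq_convolution]
  exact hg.integrable_convolution _ hK

theorem fourier_conv {K g : E3 → ℂ} (hK : Integrable K) (hg : Integrable g) (ξ : E3) :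
    𝓕 (conv K g) ξ = 𝓕 K ξ * 𝓕 g ξ := by
  rw [conv_eq_convolution, Real.fourier_mul_convolution_eq hg hK, mul_comm]

theorem integrable_norm_mul_translate {K g : E3 → ℂ} (hK : MemLp K 2) (hg : MemLp g 2) (x : E3) :
    Integrable (fun y => K (x - y) * g y) :=
  MemLp.integrable_mul (p := 2) (q := 2)
    (hK.comp_measurePreserving (Measure.measurePreserving_sub_left volume x)) hg

/-- The crude ab ≤ a² + b² suffices: this bound only serves integrability and never enters an
estimate. -/
theorem integral_norm_translate_mul_le {K g : E3 → ℂ} (hK : MemLp K 2) (hg : MemLp g 2) (x : E3) :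
    ∫ y, ‖K (x - y) * g y‖ ≤ (∫ y, ‖K y‖ ^ 2) + ∫ y, ‖g y‖ ^ 2 := by
  have hK' := hK.comp_measurePreserving (Measure.measurePreserving_sub_left volume x)
  have hi := (memLp_two_iff_integrable_sq_norm hK'.1).1 hK'
  have hj := (memLp_two_iff_integrable_sq_norm hg.1).1 hg
  have h : ∫ y, ‖K (x - y)‖ ^ 2 = ∫ y, ‖K y‖ ^ 2 :=
    integral_sub_left_eq_self (fun y => ‖K y‖ ^ 2) volume x
  rw [← h]
  refine le_of_le_of_eq ?_ (integral_add hi hj)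
  refine integral_mono (integrable_norm_mul_translate hK hg x).norm (hi.add hj) fun y => ?_
  simp only [norm_mul]
  nlinarith [sq_nonneg (‖K (x - y)‖ - ‖g y‖), sq_nonneg ‖K (x - y)‖, sq_nonneg ‖g y‖]

/-- A convolution of L² functions is bounded, and here it is also integrable; bounded and integrable
implies square integrable. -/
theorem memLp_conv {K g : E3 → ℂ} (hK1 : Integrable K) (hK2 : MemLp K 2) (hg1 : Integrable g)
    (hg2 : MemLp g 2) : MemLp (conv K g) 2 := by
  have h := integrable_conv hK1 hg1
  refine (memLp_two_iff_integrable_sq_norm h.1).2 ?_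
  have hb : ∀ x, ‖conv K g x‖ ≤ (∫ y, ‖K y‖ ^ 2) + ∫ y, ‖g y‖ ^ 2 := fun x =>
    (norm_integral_le_integral_norm _).trans (integral_norm_translate_mul_le hK2 hg2 x)
  refine (h.norm.const_mul ((∫ y, ‖K y‖ ^ 2) + ∫ y, ‖g y‖ ^ 2)).mono' (h.1.norm.pow 2)
    (Eventually.of_forall fun x => ?_)
  rw [Real.norm_of_nonneg (by positivity), sq]
  exact mul_le_mul_of_nonneg_right (hb x) (norm_nonneg _)

theorem aestronglyMeasurable_kernelForm {K f g : E3 → ℂ} (hK : AEStronglyMeasurable K volume)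
    (hf : AEStronglyMeasurable f volume) (hg : AEStronglyMeasurable g volume) :
    AEStronglyMeasurable (fun p : E3 × E3 => starRingEnd ℂ (f p.1) * g p.2 * K (p.1 - p.2))
      (volume.prod volume) :=
  ((Complex.continuous_conj.comp_aestronglyMeasurable hf.comp_fst).mul hg.comp_snd).mul
    (hK.comp_quasiMeasurePreserving (quasiMeasurePreserving_sub volume volume))

theorem integrable_kernelForm {K f g : E3 → ℂ} (hK2 : MemLp K 2)
    (hf1 : Integrable f) (hg2 : MemLp g 2) :
    Integrable (fun p : E3 × E3 => starRingEnd ℂ (f p.1) * g p.2 * K (p.1 - p.2))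
      (volume.prod volume) := by
  have hm := aestronglyMeasurable_kernelForm hK2.1 hf1.1 hg2.1
  refine (integrable_prod_iff hm).2 ⟨Eventually.of_forall fun x => ?_, ?_⟩
  · refine ((integrable_norm_mul_translate hK2 hg2 x).const_mul (starRingEnd ℂ (f x))).congr
      (Eventually.of_forall fun y => ?_)
    simp only; ring
  · refine (hf1.norm.mul_const ((∫ y, ‖K y‖ ^ 2) + ∫ y, ‖g y‖ ^ 2)).mono'
      hm.norm.integral_prod_right' (Eventually.of_forall fun x => ?_)
    rw [Real.norm_of_nonneg (by positivity)]
    have : ∀ y, ‖starRingEnd ℂ (f x) * g y * K (x - y)‖ = ‖f x‖ * ‖K (x - y) * g y‖ := fun y => by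
      simp only [norm_mul, RCLike.norm_conj]; ring
    simp only [this, integral_const_mul]
    exact mul_le_mul_of_nonneg_left (integral_norm_translate_mul_le hK2 hg2 x) (norm_nonneg _)

theorem kernelForm_eq_integral_conv {K f g : E3 → ℂ} (hK2 : MemLp K 2)
    (hf1 : Integrable f) (hg2 : MemLp g 2) :
    kernelForm K f g = ∫ x, starRingEnd ℂ (f x) * conv K g x := by
  rw [kernelForm, Measure.volume_eq_prod, integral_prod _ (integrable_kernelForm hK2 hf1 hg2)]
  refine integral_congr_ae (Eventually.of_forall fun x => ?_)
  simp only [conv, ← integral_const_mul]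
  exact integral_congr_ae (Eventually.of_forall fun y => by simp only; ring)

/-- Parseval and the convolution theorem; through this a sup bound on the symbol becomes an L² bound
on the form. -/
theorem kernelForm_eq_integral_fourier {K f g : E3 → ℂ} (hK1 : Integrable K) (hK2 : MemLp K 2)
    (hf1 : Integrable f) (hf2 : MemLp f 2) (hg1 : Integrable g) (hg2 : MemLp g 2) :
    kernelForm K f g = ∫ ξ, starRingEnd ℂ (𝓕 f ξ) * (𝓕 K ξ * 𝓕 g ξ) := by
  rw [kernelForm_eq_integral_conv hK2 hf1 hg2, ← integral_conj_fourier_mul_fourier hf1 hf2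
    (integrable_conv hK1 hg1) (memLp_conv hK1 hK2 hg1 hg2)]
  simp only [fourier_conv hK1 hg1]

/-- Cauchy–Schwarz in weighted arithmetic–geometric form. -/
theorem norm_kernelForm_le {K f g : E3 → ℂ} (hK1 : Integrable K) (hK2 : MemLp K 2)
    (hf1 : Integrable f) (hf2 : MemLp f 2) (hg1 : Integrable g) (hg2 : MemLp g 2) {A : ℝ}
    (hA : ∀ ξ, ‖𝓕 K ξ‖ ≤ A) {c : ℝ} (hc : 0 < c) :
    ‖kernelForm K f g‖ ≤ A / 2 * (c * (∫ x, ‖f x‖ ^ 2) + c⁻¹ * ∫ x, ‖g x‖ ^ 2) := by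
  have hi := (memLp_two_iff_integrable_sq_norm (memLp_fourier hf1 hf2).1).1 (memLp_fourier hf1 hf2)
  have hj := (memLp_two_iff_integrable_sq_norm (memLp_fourier hg1 hg2).1).1 (memLp_fourier hg1 hg2)
  rw [kernelForm_eq_integral_fourier hK1 hK2 hf1 hf2 hg1 hg2, ← integral_norm_sq_fourier hf1 hf2,
    ← integral_norm_sq_fourier hg1 hg2, ← integral_const_mul, ← integral_const_mul,
    ← integral_add (hi.const_mul _) (hj.const_mul _), ← integral_const_mul]
  refine norm_integral_le_of_norm_le (((hi.const_mul _).add (hj.const_mul _)).const_mul _)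
    (Eventually.of_forall fun ξ => ?_)
  have hA0 : 0 ≤ A := (norm_nonneg _).trans (hA ξ)
  have h2 : 2 * (‖𝓕 f ξ‖ * ‖𝓕 g ξ‖) ≤ c * ‖𝓕 f ξ‖ ^ 2 + c⁻¹ * ‖𝓕 g ξ‖ ^ 2 := by
    have : c * ‖𝓕 f ξ‖ ^ 2 + c⁻¹ * ‖𝓕 g ξ‖ ^ 2 - 2 * (‖𝓕 f ξ‖ * ‖𝓕 g ξ‖)
        = c⁻¹ * (c * ‖𝓕 f ξ‖ - ‖𝓕 g ξ‖) ^ 2 := by field_simp; ring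
    have := mul_nonneg (inv_nonneg.2 hc.le) (sq_nonneg (c * ‖𝓕 f ξ‖ - ‖𝓕 g ξ‖))
    linarith
  simp only [norm_mul, RCLike.norm_conj]
  calc ‖𝓕 f ξ‖ * (‖𝓕 K ξ‖ * ‖𝓕 g ξ‖) = ‖𝓕 K ξ‖ * (‖𝓕 f ξ‖ * ‖𝓕 g ξ‖) := by ring
    _ ≤ A * (‖𝓕 f ξ‖ * ‖𝓕 g ξ‖) := by gcongr; exact hA ξ
    _ ≤ _ := by nlinarith [mul_le_mul_of_nonneg_left h2 hA0]

/-! ### Polar coordinates and the Fourier transform of surface measure -/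

instance : IsFiniteMeasure sphereMeasure :=
  inferInstanceAs (IsFiniteMeasure (volume : Measure E3).toSphere)

theorem finrank_E3_sub_one : Module.finrank ℝ E3 - 1 = 2 := by simp

/-- Integration in polar coordinates. -/
theorem integral_polar {F : E3 → ℂ} (hF : Integrable F) :
    ∫ x, F x = ∫ r in Set.Ioi (0 : ℝ), ((r ^ 2 : ℝ) : ℂ) *
      ∫ ω : S2, F (r • (ω : E3)) ∂sphereMeasure := by
  have hmp := (volume : Measure E3).measurePreserving_homeomorphUnitSphereProd
  have hme := (homeomorphUnitSphereProd E3).measurableEmbedding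
  have hcomp : ∀ x : ({(0 : E3)}ᶜ : Set E3),
      F ((homeomorphUnitSphereProd E3 x).2.1 • ((homeomorphUnitSphereProd E3 x).1 : E3)) = F (x : E3) := by
    intro x
    congr 1
    have := congrArg Subtype.val ((homeomorphUnitSphereProd E3).symm_apply_apply x)
    rwa [homeomorphUnitSphereProd_symm_apply_coe] at this
  have h1 : ∫ x, F x = ∫ x : ({(0 : E3)}ᶜ : Set E3), F (x : E3)
      ∂((volume : Measure E3).comap (Subtype.val : ({(0 : E3)}ᶜ : Set E3) → E3)) := by
    rw [integral_subtype_comap (measurableSet_singleton _).compl F, restrict_compl_singleton]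
  have h2 := hmp.integral_comp hme (fun q => F (q.2.1 • (q.1 : E3)))
  simp only [hcomp] at h2
  have hint : Integrable (fun q : S2 × Set.Ioi (0 : ℝ) => F (q.2.1 • (q.1 : E3)))
      ((volume : Measure E3).toSphere.prod
        (Measure.volumeIoiPow (Module.finrank ℝ E3 - 1))) := by
    rw [← hmp.integrable_comp_emb hme]
    have : (fun q : S2 × Set.Ioi (0 : ℝ) => F (q.2.1 • (q.1 : E3))) ∘ homeomorphUnitSphereProd E3
        = F ∘ (↑) := funext hcomp
    rw [this, ← integrableOn_iff_comap_subtypeVal (measurableSet_singleton _).compl]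
    exact hF.integrableOn
  rw [h1, h2, integral_prod_symm _ hint, finrank_E3_sub_one]
  simp only [Measure.volumeIoiPow, ENNReal.ofReal]
  rw [integral_withDensity_eq_integral_smul,
    integral_subtype_comap measurableSet_Ioi
      fun a => Real.toNNReal (a ^ 2) • ∫ ω : S2, F (a • (ω : E3)) ∂(volume : Measure E3).toSphere]
  · refine setIntegral_congr_fun measurableSet_Ioi fun r hr => ?_
    simp only [NNReal.smul_def, Real.coe_toNNReal _ (sq_nonneg r), Complex.real_smul]
    rfl
  · exact (measurable_subtype_coe.pow_const _).real_toNNReal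

/-- Slicing a ball by planes orthogonal to the first axis. -/
theorem setIntegral_ball_apply_zero {F : ℝ → ℂ} (hF : Continuous F) {ρ : ℝ} (hρ : 0 < ρ) :
    ∫ x in Metric.ball (0 : E3) ρ, F (x 0) =
      ∫ t in (-ρ)..ρ, ((Real.pi * (ρ ^ 2 - t ^ 2) : ℝ) : ℂ) * F t := by
  let e : E3 ≃ᵐ ℝ × EuclideanSpace ℝ (Fin 2) :=
    ((MeasurableEquiv.toLp 2 (Fin 3 → ℝ)).symm.trans
      (MeasurableEquiv.piFinSuccAbove (fun _ : Fin 3 => ℝ) 0)).trans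
      ((MeasurableEquiv.refl ℝ).prodCongr (MeasurableEquiv.toLp 2 (Fin 2 → ℝ)))
  have he : MeasurePreserving e := by
    refine ((EuclideanSpace.volume_preserving_symm_measurableEquiv_toLp (Fin 3)).trans
      (volume_preserving_piFinSuccAbove (fun _ : Fin 3 => ℝ) 0)).trans ?_
    exact (MeasurePreserving.id volume).prod (PiLp.volume_preserving_toLp (Fin 2))
  let B : Set (ℝ × EuclideanSpace ℝ (Fin 2)) := {q | q.1 ^ 2 + ‖q.2‖ ^ 2 < ρ ^ 2}
  have hB : MeasurableSet B := measurableSet_lt (by fun_prop) (by fun_prop)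
  have hpre : ∀ x : E3, x ∈ Metric.ball (0 : E3) ρ ↔ e x ∈ B := by
    intro x
    have h0 : (e x).1 = x 0 := rfl
    have h1 : ∀ i : Fin 2, (e x).2 i = x i.succ := fun i => rfl
    simp only [B, Set.mem_ofPred_eq, mem_ball_zero_iff, EuclideanSpace.norm_sq_eq, h0, h1]
    rw [← sq_lt_sq₀ (norm_nonneg _) hρ.le, EuclideanSpace.norm_sq_eq, Fin.sum_univ_succ]
    simp
  have h1 : ∫ x in Metric.ball (0 : E3) ρ, F (x 0) = ∫ q in B, F q.1 := by
    rw [← integral_indicator measurableSet_ball, ← integral_indicator hB,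
      ← he.integral_comp' (g := B.indicator fun q => F q.1)]
    refine integral_congr_ae (Eventually.of_forall fun x => ?_)
    by_cases hx : x ∈ Metric.ball (0 : E3) ρ
    · simp only [Set.indicator_of_mem hx, Set.indicator_of_mem ((hpre x).1 hx)]; rfl
    · simp only [Set.indicator_of_notMem hx, Set.indicator_of_notMem (fun h => hx ((hpre x).2 h))]
  have hint : Integrable (B.indicator fun q => F q.1)
      ((volume : Measure ℝ).prod (volume : Measure (EuclideanSpace ℝ (Fin 2)))) := by
    rw [integrable_indicator_iff hB]
    have hsub : B ⊆ Set.Icc (-ρ) ρ ×ˢ Metric.closedBall (0 : EuclideanSpace ℝ (Fin 2)) ρ := by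
      intro q hq
      simp only [B, Set.mem_ofPred_eq] at hq
      refine ⟨abs_le.1 (abs_le_of_sq_le_sq (by nlinarith [sq_nonneg ‖q.2‖]) hρ.le), ?_⟩
      rw [mem_closedBall_zero_iff]
      exact abs_le_of_sq_le_sq' (by nlinarith [sq_nonneg q.1]) hρ.le |>.2
    refine IntegrableOn.mono_set ?_ hsub
    exact (hF.comp continuous_fst).continuousOn.integrableOn_compact
      (isCompact_Icc.prod (isCompact_closedBall _ _))
  rw [h1, ← integral_indicator hB, Measure.volume_eq_prod, integral_prod _ hint,
    intervalIntegral.integral_of_le (by linarith), ← integral_indicator measurableSet_Ioc]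
  refine integral_congr_ae ?_
  -- At `t = ρ` the slice degenerates to radius zero, so this endpoint is discarded.
  filter_upwards [Measure.ae_ne volume ρ] with t htρ
  by_cases ht : t ∈ Set.Ioc (-ρ) ρ
  · have hpos : 0 < ρ ^ 2 - t ^ 2 := by nlinarith [ht.1, lt_of_le_of_ne ht.2 htρ]
    have hball : ∀ v, (B.indicator fun q => F q.1) (t, v) =
        (Metric.ball (0 : EuclideanSpace ℝ (Fin 2)) (√(ρ ^ 2 - t ^ 2))).indicator
          (fun _ => F t) v := by
      intro v
      simp only [Set.indicator, B, Set.mem_ofPred_eq, mem_ball_zero_iff, Real.lt_sqrt (norm_nonneg v)]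
      congr 1
      rw [lt_sub_iff_add_lt']
    simp only [hball, Set.indicator_of_mem ht]
    rw [integral_indicator measurableSet_ball, setIntegral_const, Measure.real,
      EuclideanSpace.volume_ball_fin_two, ← ENNReal.ofReal_pow (Real.sqrt_nonneg _),
      Real.sq_sqrt hpos.le, ← ENNReal.ofReal_mul hpos.le, ENNReal.toReal_ofReal (by positivity),
      Complex.real_smul, mul_comm Real.pi]
  · have hB0 : ∀ v, (B.indicator fun q => F q.1) (t, v) = 0 := by
      intro v
      refine Set.indicator_of_notMem (fun h => ht ?_) _
      simp only [B, Set.mem_ofPred_eq] at h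
      have := abs_lt_of_sq_lt_sq' (show t ^ 2 < ρ ^ 2 by nlinarith [sq_nonneg ‖v‖]) hρ.le
      exact ⟨this.1, this.2.le⟩
    simp only [hB0, Set.indicator_of_notMem ht, integral_zero]

/-- The oscillating integral over the unit sphere. -/
noncomputable def sphereWave (x : E3) : ℂ :=
  ∫ ω : S2, Complex.exp (Complex.I * ((inner ℝ x (ω : E3) : ℝ) : ℂ)) ∂sphereMeasure

theorem continuous_sphereWave : Continuous sphereWave := by
  refine continuous_of_dominated (bound := fun _ => 1) (fun x => ?_) (fun x => ?_)
    (integrable_const 1) (Eventually.of_forall fun ω => by fun_prop)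
  · exact Continuous.aestronglyMeasurable (by fun_prop)
  · refine Eventually.of_forall fun ω => ?_
    rw [mul_comm, Complex.norm_exp_ofReal_mul_I]

/-- Two vectors of equal norm are exchanged by the reflection in the hyperplane orthogonal to their
difference. -/
theorem exists_linearIsometryEquiv_norm (x : E3) :
    ∃ R : E3 ≃ₗᵢ[ℝ] E3, R x = EuclideanSpace.single 0 ‖x‖ :=
  ⟨_, Submodule.reflection_sub (v := x) (w := EuclideanSpace.single 0 ‖x‖) (by simp)⟩

/-- Rotating `x` onto the first axis leaves the ball invariant and makes the integrand depend on one
coordinate only, so slicing applies. -/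
theorem setIntegral_ball_exp (x : E3) {ρ : ℝ} (hρ : 0 < ρ) :
    ∫ y in Metric.ball (0 : E3) ρ, Complex.exp (Complex.I * ((inner ℝ x y : ℝ) : ℂ)) =
      ∫ t in (-ρ)..ρ, ((Real.pi * (ρ ^ 2 - t ^ 2) : ℝ) : ℂ) * Complex.exp (Complex.I * ‖x‖ * t) := by
  obtain ⟨R, hR⟩ := exists_linearIsometryEquiv_norm x
  rw [← setIntegral_ball_apply_zero (F := fun t => Complex.exp (Complex.I * ‖x‖ * t)) (by fun_prop) hρ,
    ← R.measurePreserving.setIntegral_preimage_emb R.toHomeomorph.measurableEmbedding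
      (fun y : E3 => Complex.exp (Complex.I * ‖x‖ * (y 0 : ℝ)))]
  have : R ⁻¹' Metric.ball (0 : E3) ρ = Metric.ball (0 : E3) ρ := by
    ext y; simp
  rw [this]
  refine setIntegral_congr_fun measurableSet_ball fun y _ => ?_
  have h : inner ℝ x y = ‖x‖ * (R y) 0 := by
    rw [← R.inner_map_map, hR, EuclideanSpace.inner_single_left]
    simp
  simp only [h]
  push_cast
  congr 1; ring

theorem setIntegral_ball_exp_polar (x : E3) {ρ : ℝ} (hρ : 0 < ρ) :
    ∫ y in Metric.ball (0 : E3) ρ, Complex.exp (Complex.I * ((inner ℝ x y : ℝ) : ℂ)) =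
      ∫ r in (0 : ℝ)..ρ, ((r ^ 2 : ℝ) : ℂ) * sphereWave (r • x) := by
  have hc : Continuous fun y : E3 => Complex.exp (Complex.I * ((inner ℝ x y : ℝ) : ℂ)) := by fun_prop
  have hint : IntegrableOn (fun y : E3 => Complex.exp (Complex.I * ((inner ℝ x y : ℝ) : ℂ)))
      (Metric.ball (0 : E3) ρ) :=
    (hc.continuousOn.integrableOn_compact (isCompact_closedBall 0 ρ)).mono_set
      Metric.ball_subset_closedBall
  rw [← integral_indicator measurableSet_ball,
    integral_polar ((integrable_indicator_iff measurableSet_ball).2 hint),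
    intervalIntegral.integral_of_le hρ.le, integral_Ioc_eq_integral_Ioo,
    ← integral_indicator measurableSet_Ioo, ← integral_indicator measurableSet_Ioi]
  congr 1
  ext r
  by_cases hr : 0 < r
  · have hn : ∀ ω : S2, ‖r • (ω : E3)‖ = r := fun ω => by
      rw [norm_smul, norm_eq_of_mem_sphere, mul_one, Real.norm_of_nonneg hr.le]
    rw [Set.indicator_of_mem (Set.mem_Ioi.2 hr)]
    by_cases hr2 : r < ρ
    · rw [Set.indicator_of_mem (Set.mem_Ioo.2 ⟨hr, hr2⟩), sphereWave]
      congr 2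
      ext ω
      rw [Set.indicator_of_mem (by rw [mem_ball_zero_iff, hn]; exact hr2), inner_smul_left,
        inner_smul_right]
      rfl
    · rw [Set.indicator_of_notMem (fun h => hr2 h.2)]
      have : ∀ ω : S2, (Metric.ball (0 : E3) ρ).indicator
          (fun y : E3 => Complex.exp (Complex.I * ((inner ℝ x y : ℝ) : ℂ))) (r • (ω : E3)) = 0 :=
        fun ω => Set.indicator_of_notMem (by rw [mem_ball_zero_iff, hn]; exact hr2) _
      simp only [this, integral_zero, mul_zero]
  · rw [Set.indicator_of_notMem (s := Set.Ioi (0 : ℝ)) hr,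
      Set.indicator_of_notMem (s := Set.Ioo 0 ρ) (fun h => hr h.1)]

/-- The primitive comes from integrating the quadratic factor by parts twice; the parabola vanishes
at both ends, which removes the 1/a term. -/
theorem integral_parabola_mul_exp {a : ℂ} (ha : a ≠ 0) (ρ : ℝ) :
    ∫ t in (-ρ)..ρ, ((Real.pi * (ρ ^ 2 - t ^ 2) : ℝ) : ℂ) * Complex.exp (a * t) =
      2 * Real.pi * ρ / a ^ 2 * (Complex.exp (a * ρ) + Complex.exp (-(a * ρ)))
        - 2 * Real.pi / a ^ 3 * (Complex.exp (a * ρ) - Complex.exp (-(a * ρ))) := by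
  have hd : ∀ t : ℝ, HasDerivAt (fun t : ℝ => Complex.exp (a * t) *
      (Real.pi * ((ρ : ℂ) ^ 2 - (t : ℂ) ^ 2) / a + 2 * Real.pi * t / a ^ 2 - 2 * Real.pi / a ^ 3))
      (((Real.pi * (ρ ^ 2 - t ^ 2) : ℝ) : ℂ) * Complex.exp (a * t)) t := by
    intro t
    have h : HasDerivAt (fun w : ℂ => Complex.exp (a * w) *
      (Real.pi * ((ρ : ℂ) ^ 2 - w ^ 2) / a + 2 * Real.pi * w / a ^ 2 - 2 * Real.pi / a ^ 3))
      (((Real.pi * (ρ ^ 2 - t ^ 2) : ℝ) : ℂ) * Complex.exp (a * t)) (t : ℂ) := by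
      have h1 : HasDerivAt (fun w : ℂ => Complex.exp (a * w)) (Complex.exp (a * t) * (a * 1)) (t : ℂ) :=
        ((hasDerivAt_id (t : ℂ)).const_mul a).cexp
      have h2 : HasDerivAt (fun w : ℂ => Real.pi * ((ρ : ℂ) ^ 2 - w ^ 2) / a + 2 * Real.pi * w / a ^ 2
          - 2 * Real.pi / a ^ 3) (Real.pi * (0 - (2 : ℕ) * (t : ℂ) ^ 1 * 1) / a + 2 * Real.pi * 1 / a ^ 2 - 0)
          (t : ℂ) :=
        ((((((hasDerivAt_const (t : ℂ) ((ρ : ℂ) ^ 2)).sub ((hasDerivAt_id (t : ℂ)).fun_pow 2)).const_mul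
          (Real.pi : ℂ)).div_const a).add (((hasDerivAt_id (t : ℂ)).const_mul
          (2 * Real.pi : ℂ)).div_const (a ^ 2))).sub (hasDerivAt_const (t : ℂ) _))
      refine (h1.mul h2).congr_deriv ?_
      push_cast
      field_simp
      ring
    exact h.comp_ofReal
  rw [intervalIntegral.integral_eq_sub_of_hasDerivAt (fun t _ => hd t)
    (Continuous.intervalIntegrable (by fun_prop) _ _)]
  push_cast
  rw [show a * -(ρ : ℂ) = -(a * ρ) by ring]
  field_simp
  ring

/-- The Fourier transform of the surface measure of `S²`. -/
theorem sphereWave_eq (x : E3) : sphereWave x = ((4 * Real.pi * Real.sinc ‖x‖ : ℝ) : ℂ) := by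
  by_cases hx : x = 0
  · subst hx
    simp only [sphereWave, inner_zero_left, Complex.ofReal_zero, mul_zero, Complex.exp_zero,
      integral_const, norm_zero, Real.sinc_zero, mul_one, Complex.real_smul]
    norm_cast
    rw [sphereMeasure, Measure.toSphere_real_apply_univ, Measure.real,
      EuclideanSpace.volume_ball_fin_three]
    simp
    rw [ENNReal.toReal_ofReal (by positivity)]
    ring
  · have hs : ‖x‖ ≠ 0 := norm_ne_zero_iff.2 hx
    set a : ℂ := Complex.I * ‖x‖ with ha
    have ha0 : a ≠ 0 := mul_ne_zero Complex.I_ne_zero (by exact_mod_cast hs)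
    have hcont : Continuous fun r : ℝ => ((r ^ 2 : ℝ) : ℂ) * sphereWave (r • x) :=
      (by fun_prop : Continuous fun r : ℝ => ((r ^ 2 : ℝ) : ℂ)).mul
        (continuous_sphereWave.comp (by fun_prop))
    -- The ball integral is known both in polar coordinates and by slicing. Differentiating the two
    -- expressions in the radius at `ρ = 1` isolates the sphere integral.
    have hL : HasDerivAt (fun ρ : ℝ => ∫ r in (0 : ℝ)..ρ, ((r ^ 2 : ℝ) : ℂ) * sphereWave (r • x))
        (sphereWave x) 1 := by
      have := intervalIntegral.integral_hasDerivAt_right (hcont.intervalIntegrable 0 1)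
        (hcont.stronglyMeasurableAtFilter _ _) hcont.continuousAt
      simpa using this
    have hR : HasDerivAt (fun ρ : ℝ =>
        2 * Real.pi * ρ / a ^ 2 * (Complex.exp (a * ρ) + Complex.exp (-(a * ρ)))
        - 2 * Real.pi / a ^ 3 * (Complex.exp (a * ρ) - Complex.exp (-(a * ρ))))
        (2 * Real.pi / a * (Complex.exp a - Complex.exp (-a))) 1 := by
      have h1 : HasDerivAt (fun w : ℂ => Complex.exp (a * w)) (Complex.exp (a * 1) * (a * 1)) 1 :=
        ((hasDerivAt_id (1 : ℂ)).const_mul a).cexp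
      have h2 : HasDerivAt (fun w : ℂ => Complex.exp (-(a * w))) (Complex.exp (-(a * 1)) * -(a * 1)) 1 :=
        ((hasDerivAt_id (1 : ℂ)).const_mul a).neg.cexp
      have h3 : HasDerivAt (fun w : ℂ => 2 * Real.pi * w / a ^ 2) (2 * Real.pi * 1 / a ^ 2) (1 : ℂ) :=
        ((hasDerivAt_id (1 : ℂ)).const_mul (2 * Real.pi : ℂ)).div_const (a ^ 2)
      have h4 := ((h3.mul (h1.add h2)).sub ((h1.sub h2).const_mul (2 * Real.pi / a ^ 3 : ℂ)))
      have h5 : HasDerivAt (fun w : ℂ => 2 * Real.pi * w / a ^ 2 *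
        (Complex.exp (a * w) + Complex.exp (-(a * w)))
        - 2 * Real.pi / a ^ 3 * (Complex.exp (a * w) - Complex.exp (-(a * w))))
        (2 * Real.pi / a * (Complex.exp a - Complex.exp (-a))) ((1 : ℝ) : ℂ) := by
        rw [Complex.ofReal_one]
        refine h4.congr_deriv ?_
        simp only [mul_one, Pi.add_apply]
        field_simp
        ring
      exact h5.comp_ofReal
    have heq : (fun ρ : ℝ => ∫ r in (0 : ℝ)..ρ, ((r ^ 2 : ℝ) : ℂ) * sphereWave (r • x)) =ᶠ[𝓝 1]
        fun ρ : ℝ => 2 * Real.pi * ρ / a ^ 2 * (Complex.exp (a * ρ) + Complex.exp (-(a * ρ)))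
        - 2 * Real.pi / a ^ 3 * (Complex.exp (a * ρ) - Complex.exp (-(a * ρ))) := by
      filter_upwards [lt_mem_nhds (zero_lt_one : (0 : ℝ) < 1)] with ρ hρ
      rw [← setIntegral_ball_exp_polar x hρ, setIntegral_ball_exp x hρ,
        ← integral_parabola_mul_exp ha0]
    rw [(hL.congr_of_eventuallyEq heq.symm).unique hR, Real.sinc_of_ne_zero hs]
    push_cast
    rw [Complex.sin, ha]
    have hI := Complex.I_sq
    have hs' : (‖x‖ : ℂ) ≠ 0 := by exact_mod_cast hs
    field_simp
    rw [hI]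
    ring_nf

/-- The Fourier transform of a radial function. -/
theorem fourier_radial {h : ℝ → ℂ} (hint : Integrable (fun x : E3 => h ‖x‖)) (ξ : E3) :
    𝓕 (fun x : E3 => h ‖x‖) ξ = ∫ r in Set.Ioi (0 : ℝ),
      ((4 * Real.pi * r ^ 2 * Real.sinc (2 * Real.pi * ‖ξ‖ * r) : ℝ) : ℂ) * h r := by
  rw [Real.fourier_eq']
  simp only [smul_eq_mul]
  have hi : Integrable fun x : E3 =>
      Complex.exp (((-2 * Real.pi * inner ℝ x ξ : ℝ) : ℂ) * Complex.I) * h ‖x‖ := by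
    refine hint.bdd_mul (c := 1) (Continuous.aestronglyMeasurable (by fun_prop))
      (Eventually.of_forall fun x => ?_)
    rw [Complex.norm_exp_ofReal_mul_I]
  rw [integral_polar hi]
  refine setIntegral_congr_fun measurableSet_Ioi fun r (hr : 0 < r) => ?_
  have hn : ∀ ω : S2, ‖r • (ω : E3)‖ = r := fun ω => by
    rw [norm_smul, norm_eq_of_mem_sphere, mul_one, Real.norm_of_nonneg hr.le]
  simp only [hn, integral_mul_const]
  have hw : ∫ ω : S2, Complex.exp (((-2 * Real.pi * inner ℝ (r • (ω : E3)) ξ : ℝ) : ℂ) * Complex.I)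
      ∂sphereMeasure = sphereWave ((-(2 * Real.pi * r)) • ξ) := by
    refine integral_congr_ae (Eventually.of_forall fun ω => ?_)
    simp only [inner_smul_left, RCLike.conj_to_real]
    rw [real_inner_comm ξ (ω : E3)]
    congr 1
    push_cast
    ring
  rw [hw, sphereWave_eq, norm_smul, norm_neg, Real.norm_of_nonneg (by positivity)]
  push_cast
  rw [show 2 * Real.pi * r * ‖ξ‖ = 2 * Real.pi * ‖ξ‖ * r by ring]
  ring

/-! ### The square root near the spectrum and pointwise kernel bounds -/

/-- Off the real axis the argument of -z lies strictly between -π and π, so its principal root has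
positive real part, and multiplication by i turns this into positive imaginary part. -/
theorem upperSqrt_im_pos {z : ℂ} (hz : z.im ≠ 0) : 0 < (upperSqrt z).im := by
  have hz0 : -z ≠ 0 := fun h => hz (by simpa using congrArg Complex.im h)
  have harg : (-z).arg ≠ Real.pi := fun h => hz (by
    simpa using (Complex.arg_eq_pi_iff.1 h).2)
  rw [upperSqrt, Complex.I_mul_im, Complex.cpow_def_of_ne_zero hz0, Complex.exp_re]
  refine mul_pos (Real.exp_pos _) (Real.cos_pos_of_mem_Ioo ?_)
  have him : (Complex.log (-z) * (1 / 2 : ℂ)).im = (-z).arg / 2 := by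
    rw [show (1 / 2 : ℂ) = ((1 / 2 : ℝ) : ℂ) by push_cast; rfl, Complex.im_mul_ofReal, Complex.log_im]
    ring
  rw [him]
  have h1 := Complex.neg_pi_lt_arg (-z)
  have h2 := lt_of_le_of_ne (Complex.arg_le_pi (-z)) harg
  constructor <;> linarith

theorem one_le_norm_upperSqrt {z : ℂ} (hz : z.re = 1) : 1 ≤ ‖upperSqrt z‖ := by
  have h : ‖upperSqrt z‖ ^ 2 = ‖z‖ := by rw [← norm_pow, upperSqrt_sq]
  have h1 : 1 ≤ ‖z‖ := by simpa [hz] using Complex.abs_re_le_norm z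
  nlinarith [norm_nonneg (upperSqrt z)]

/-- If `z = 1 + iτ`, then `√z` is within `|τ|` of `sign τ`. -/
theorem norm_upperSqrt_sub_le {z : ℂ} (hz : z.re = 1) {σ : ℝ} (hσ : σ = 1 ∨ σ = -1)
    (hσz : 0 < σ * z.im) : ‖upperSqrt z - σ‖ ≤ |z.im| := by
  have him : z.im ≠ 0 := fun h => by simp [h] at hσz
  have hk := upperSqrt_im_pos him
  have hsq := upperSqrt_sq z
  set k := upperSqrt z
  have him2 : z.im = 2 * k.re * k.im := by rw [← hsq, sq, Complex.mul_im]; ring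
  have hre : 0 < σ * k.re := by
    rw [him2] at hσz
    by_contra! h
    nlinarith
  have hσ2 : σ ^ 2 = 1 := by rcases hσ with rfl | rfl <;> norm_num
  -- The product (k - σ)(k + σ) has modulus |Im z|, and the second factor has modulus at least 1
  -- because Re k has the sign of `σ`.
  have hprod : (k - σ) * (k + σ) = z.im * Complex.I := by
    have : (σ : ℂ) ^ 2 = 1 := by exact_mod_cast hσ2
    calc (k - σ) * (k + σ) = k ^ 2 - (σ : ℂ) ^ 2 := by ring
      _ = z - 1 := by rw [hsq, this]
      _ = z.im * Complex.I := by
        conv_lhs => rw [← Complex.re_add_im z, hz]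
        push_cast; ring
  have hn : ‖k - σ‖ * ‖k + σ‖ = |z.im| := by
    rw [← norm_mul, hprod, norm_mul, Complex.norm_I, mul_one, Complex.norm_real, Real.norm_eq_abs]
  have hge : 1 ≤ ‖k + σ‖ := by
    have h1 : |σ * (k.re + σ)| = |k.re + σ| := by
      rw [abs_mul]; rcases hσ with rfl | rfl <;> simp
    have h2 : |(k + σ).re| ≤ ‖k + σ‖ := Complex.abs_re_le_norm _
    have h3 : (k + σ).re = k.re + σ := by simp
    have h4 := le_abs_self (σ * (k.re + σ))
    rw [h3] at h2
    nlinarith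
  rw [← hn]
  exact le_mul_of_one_le_right (norm_nonneg _) hge

/-- Mean value inequality on the convex left half-plane, where the derivative of exp has modulus at
most 1. -/
theorem norm_exp_sub_exp_le {a b : ℂ} (ha : a.re ≤ 0) (hb : b.re ≤ 0) :
    ‖Complex.exp a - Complex.exp b‖ ≤ ‖a - b‖ := by
  have h := (convex_halfSpace_re_le (0 : ℝ)).norm_image_sub_le_of_norm_hasDerivWithin_le
    (f := Complex.exp) (f' := Complex.exp) (C := 1)
    (fun x _ => (Complex.hasDerivAt_exp x).hasDerivWithinAt)
    (fun x hx => by rw [Complex.norm_exp]; exact Real.exp_le_one_iff.2 hx) hb ha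
  simpa using h

/-- The outgoing wave kernel `exp(ik|x|) / (4π|x|)`. -/
noncomputable def waveKernel (k : ℂ) (x : E3) : ℂ :=
  Complex.exp (Complex.I * k * (‖x‖ : ℂ)) / (4 * (Real.pi : ℂ) * (‖x‖ : ℂ))

/-- The imaginary part of the wave kernel, as a complex-valued function. -/
noncomputable def imKernel (k : ℂ) (x : E3) : ℂ := ((waveKernel k x).im : ℂ)

theorem measurable_waveKernel (k : ℂ) : Measurable (waveKernel k) := by
  unfold waveKernel; fun_prop

theorem measurable_imKernel (k : ℂ) : Measurable (imKernel k) :=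
  Complex.measurable_ofReal.comp (Complex.measurable_im.comp (measurable_waveKernel k))

theorem re_I_mul_mul_ofReal (k : ℂ) (r : ℝ) : (Complex.I * k * r).re = -(k.im * r) := by
  simp [Complex.mul_re]

theorem norm_waveKernel (k : ℂ) (x : E3) :
    ‖waveKernel k x‖ = Real.exp (-(k.im * ‖x‖)) / (4 * Real.pi * ‖x‖) := by
  rw [waveKernel, norm_div, Complex.norm_exp, re_I_mul_mul_ofReal]
  congr 1
  simp [abs_of_pos Real.pi_pos]

theorem norm_imKernel_le_div {k : ℂ} (hk : 0 ≤ k.im) (x : E3) :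
    ‖imKernel k x‖ ≤ 1 / (4 * Real.pi * ‖x‖) := by
  rw [imKernel, Complex.norm_real]
  refine (Complex.abs_im_le_norm _).trans ?_
  rw [norm_waveKernel]
  gcongr
  exact Real.exp_le_one_iff.2 (neg_nonpos.2 (by positivity))

/-- Comparison of the imaginary kernels at `k` and at the real point `σ = ±1`. -/
theorem norm_imKernel_sub_le {k : ℂ} (hk : 0 ≤ k.im) {σ : ℝ} (hσ : σ = 1 ∨ σ = -1) (x : E3) :
    ‖σ * imKernel k x - imKernel 1 x‖ ≤ ‖k - σ‖ := by
  rcases eq_or_ne x 0 with rfl | hx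
  · simp [imKernel, waveKernel]
  have hx' : 0 < ‖x‖ := norm_pos_iff.2 hx
  -- The sine is odd, so the imaginary kernel at -1 is minus the one at 1; the comparison becomes
  -- one between `k` and `σ`.
  have h1 : imKernel 1 x = σ * imKernel σ x := by
    rcases hσ with rfl | rfl
    · simp
    · simp only [imKernel, waveKernel]
      rw [← Complex.ofReal_mul]
      congr 1
      rw [show (4 * (Real.pi : ℂ) * (‖x‖ : ℂ)) = ((4 * Real.pi * ‖x‖ : ℝ) : ℂ) by push_cast; ring,
        Complex.div_ofReal_im, Complex.div_ofReal_im, Complex.exp_im, Complex.exp_im,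
        re_I_mul_mul_ofReal, re_I_mul_mul_ofReal]
      simp [neg_div]
  rw [h1, ← mul_sub, norm_mul, Complex.norm_real,
    show ‖σ‖ = 1 by rcases hσ with rfl | rfl <;> simp, one_mul, imKernel, imKernel,
    ← Complex.ofReal_sub, ← Complex.sub_im, Complex.norm_real]
  refine (Complex.abs_im_le_norm _).trans ?_
  rw [waveKernel, waveKernel, ← sub_div, norm_div]
  have h2 : ‖Complex.exp (Complex.I * k * ‖x‖) - Complex.exp (Complex.I * σ * ‖x‖)‖
      ≤ ‖k - σ‖ * ‖x‖ := by
    refine (norm_exp_sub_exp_le ?_ ?_).trans_eq ?_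
    · rw [re_I_mul_mul_ofReal]; exact neg_nonpos.2 (by positivity)
    · rw [re_I_mul_mul_ofReal]; simp
    · rw [show Complex.I * k * ‖x‖ - Complex.I * σ * ‖x‖ = Complex.I * (k - σ) * ‖x‖ by ring,
        norm_mul, norm_mul, Complex.norm_I, one_mul, Complex.norm_real, norm_norm]
  have h3 : ‖(4 * (Real.pi : ℂ) * (‖x‖ : ℂ))‖ = 4 * Real.pi * ‖x‖ := by
    simp [abs_of_pos Real.pi_pos]
  rw [h3, div_le_iff₀ (by positivity)]
  refine h2.trans ?_
  have : 1 ≤ 4 * Real.pi := by nlinarith [Real.pi_gt_three]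
  nlinarith [mul_nonneg (norm_nonneg (k - σ)) hx'.le]

theorem norm_imKernel_le {k : ℂ} (hk : 0 ≤ k.im) (x : E3) : ‖imKernel k x‖ ≤ ‖k - 1‖ + 1 := by
  have h := norm_imKernel_sub_le hk (σ := 1) (Or.inl rfl) x
  have h1 : ‖imKernel 1 x‖ ≤ 1 := by
    rcases eq_or_ne x 0 with rfl | hx
    · simp [imKernel, waveKernel]
    have hx' : 0 < ‖x‖ := norm_pos_iff.2 hx
    rw [imKernel, Complex.norm_real, waveKernel,
      show (4 * (Real.pi : ℂ) * (‖x‖ : ℂ)) = ((4 * Real.pi * ‖x‖ : ℝ) : ℂ) by push_cast; ring,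
      Complex.div_ofReal_im, Complex.exp_im, re_I_mul_mul_ofReal, norm_div]
    have : ‖4 * Real.pi * ‖x‖‖ = 4 * Real.pi * ‖x‖ := Real.norm_of_nonneg (by positivity)
    rw [this, div_le_one (by positivity)]
    have h2 : |Real.sin ‖x‖| ≤ ‖x‖ := by simpa using Real.abs_sin_le_abs (x := ‖x‖)
    simp only [Complex.one_im, zero_mul, neg_zero, Real.exp_zero, one_mul, mul_one,
      Complex.I_mul_im, Complex.ofReal_re, Real.norm_eq_abs]
    nlinarith [Real.pi_gt_three]
  simp only [Complex.ofReal_one, one_mul] at h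
  calc ‖imKernel k x‖ = ‖(imKernel k x - imKernel 1 x) + imKernel 1 x‖ := by simp
    _ ≤ _ := (norm_add_le _ _).trans (add_le_add h h1)

/-! ### Fourier symbols of the wave kernel, its imaginary part and its truncations -/

/-- `r ↦ r sinc(ρ r)`, a primitive of `cos(ρ r)`. -/
theorem hasDerivAt_mul_sinc (ρ r : ℝ) :
    HasDerivAt (fun r => r * Real.sinc (ρ * r)) (Real.cos (ρ * r)) r := by
  rcases eq_or_ne ρ 0 with rfl | hρ
  · simpa using hasDerivAt_id' r
  · have : (fun r => r * Real.sinc (ρ * r)) = fun r => Real.sin (ρ * r) / ρ := by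
      ext r
      rcases eq_or_ne r 0 with rfl | hr
      · simp
      · rw [Real.sinc_of_ne_zero (mul_ne_zero hρ hr)]; field_simp
    rw [this]
    refine (((hasDerivAt_id r).const_mul ρ).sin.div_const ρ).congr_deriv ?_
    simp only [id, mul_one]; field_simp

theorem mul_sq_mul_sinc (ρ r : ℝ) : r * (ρ ^ 2 * Real.sinc (ρ * r)) = ρ * Real.sin (ρ * r) := by
  rcases eq_or_ne ρ 0 with rfl | hρ
  · simp
  rcases eq_or_ne r 0 with rfl | hr
  · simp
  rw [Real.sinc_of_ne_zero (mul_ne_zero hρ hr)]; field_simp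

theorem abs_mul_sinc_le {r : ℝ} (hr : 0 ≤ r) (ρ : ℝ) : |r * Real.sinc (ρ * r)| ≤ r := by
  rw [abs_mul, abs_of_nonneg hr]
  exact mul_le_of_le_one_right hr (Real.abs_sinc_le_one _)

theorem integrableOn_mul_exp {b : ℝ} (hb : 0 < b) :
    IntegrableOn (fun r : ℝ => r * Real.exp (-(b * r))) (Set.Ioi 0) := by
  have := integrableOn_rpow_mul_exp_neg_mul_rpow (p := 1) (s := 1) (b := b) (by norm_num)
    (by norm_num) hb
  refine this.congr_fun (fun r _ => ?_) measurableSet_Ioi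
  simp

theorem integrable_waveKernel {k : ℂ} (hk : 0 < k.im) : Integrable (waveKernel k) := by
  have h := (integrable_fun_norm_addHaar (volume : Measure E3)
    (f := fun r => Real.exp (-(k.im * r)) / (4 * Real.pi * r))).2 ?_
  · refine h.mono' (measurable_waveKernel k).aestronglyMeasurable
      (Eventually.of_forall fun x => (norm_waveKernel k x).le)
  · rw [finrank_E3_sub_one]
    refine IntegrableOn.congr_fun ((integrableOn_mul_exp hk).const_mul (1 / (4 * Real.pi)))
      (fun r (hr : 0 < r) => ?_) measurableSet_Ioi
    simp only [smul_eq_mul]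
    field_simp

/-- In dimension three the volume factor r² exactly cancels the squared singularity 1/r², leaving a
decaying exponential. -/
theorem memLp_waveKernel {k : ℂ} (hk : 0 < k.im) : MemLp (waveKernel k) 2 := by
  refine (memLp_two_iff_integrable_sq_norm (measurable_waveKernel k).aestronglyMeasurable).2 ?_
  simp only [norm_waveKernel]
  refine (integrable_fun_norm_addHaar (volume : Measure E3)
    (f := fun r => (Real.exp (-(k.im * r)) / (4 * Real.pi * r)) ^ 2)).2 ?_
  rw [finrank_E3_sub_one]
  refine IntegrableOn.congr_fun ((integrableOn_exp_mul_Ioi (a := -(2 * k.im)) (by linarith) 0).const_mul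
    (1 / (4 * Real.pi) ^ 2)) (fun r (hr : 0 < r) => ?_) measurableSet_Ioi
  simp only [smul_eq_mul]
  rw [div_pow, ← Real.exp_nat_mul]
  field_simp
  congr 1
  push_cast; ring

theorem integrable_imKernel {k : ℂ} (hk : 0 < k.im) : Integrable (imKernel k) :=
  (integrable_waveKernel hk).im.ofReal

theorem memLp_imKernel {k : ℂ} (hk : 0 < k.im) : MemLp (imKernel k) 2 :=
  (memLp_waveKernel hk).im.ofReal

/-- The resolvent kernel has symbol `1 / (|ξ|² - k²)`. -/
theorem fourier_waveKernel {k : ℂ} (hk : 0 < k.im) (ξ : E3) :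
    𝓕 (waveKernel k) ξ = 1 / (((2 * Real.pi * ‖ξ‖) ^ 2 : ℝ) - k ^ 2) := by
  have h := fourier_radial (h := fun r : ℝ =>
    Complex.exp (Complex.I * k * (r : ℂ)) / (4 * (Real.pi : ℂ) * (r : ℂ)))
    (integrable_waveKernel hk) ξ
  rw [show waveKernel k = fun x : E3 => Complex.exp (Complex.I * k * (‖x‖ : ℂ)) /
    (4 * (Real.pi : ℂ) * (‖x‖ : ℂ)) from rfl, h]
  set ρ := 2 * Real.pi * ‖ξ‖
  -- If `k ^ 2` were real, then Re k = 0 and `k ^ 2` would be negative, hence not a square `ρ ^ 2`.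
  have hne : (((ρ ^ 2 : ℝ) : ℂ) - k ^ 2) ≠ 0 := by
    intro h0
    have h1 := congrArg Complex.im h0
    have h2 := congrArg Complex.re h0
    simp only [Complex.sub_im, Complex.ofReal_im, Complex.zero_im, sq k, Complex.mul_im,
      Complex.sub_re, Complex.ofReal_re, Complex.zero_re, Complex.mul_re] at h1 h2
    have hre : k.re = 0 := by
      have : k.re * k.im = 0 := by linarith
      exact (mul_eq_zero.1 this).resolve_right hk.ne'
    rw [hre] at h2
    nlinarith [sq_nonneg ρ]
  have hnorm : ∀ r : ℝ, ‖Complex.exp (Complex.I * k * r)‖ = Real.exp (-(k.im * r)) := fun r => by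
    rw [Complex.norm_exp, re_I_mul_mul_ofReal]
  have hint : IntegrableOn (fun r : ℝ => ((r * Real.sinc (ρ * r) : ℝ) : ℂ) *
      Complex.exp (Complex.I * k * r)) (Set.Ioi 0) := by
    refine (integrableOn_mul_exp hk).mono' ?_ ?_
    · have := Real.continuous_sinc
      exact (Continuous.aestronglyMeasurable (by fun_prop))
    · filter_upwards [ae_restrict_mem measurableSet_Ioi] with r hr
      rw [norm_mul, hnorm, Complex.norm_real, Real.norm_eq_abs]
      gcongr
      exact abs_mul_sinc_le (le_of_lt hr) ρ
  -- Explicit primitive of the radial integrand, written with `sinc` so that the frequency `ρ = 0`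
  -- needs no separate treatment.
  have hd : ∀ r : ℝ, HasDerivAt (fun r : ℝ => Complex.exp (Complex.I * k * r) *
      (Complex.I * k * ((r * Real.sinc (ρ * r) : ℝ) : ℂ) - ((Real.cos (ρ * r) : ℝ) : ℂ)) /
        (((ρ ^ 2 : ℝ) : ℂ) - k ^ 2))
      (((r * Real.sinc (ρ * r) : ℝ) : ℂ) * Complex.exp (Complex.I * k * r)) r := by
    intro r
    have h1 : HasDerivAt (fun r : ℝ => Complex.exp (Complex.I * k * r))
        (Complex.exp (Complex.I * k * r) * (Complex.I * k * 1)) r :=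
      (((hasDerivAt_id (r : ℂ)).const_mul (Complex.I * k)).cexp).comp_ofReal
    have h2 := (hasDerivAt_mul_sinc ρ r).ofReal_comp
    have h3 : HasDerivAt (fun r : ℝ => ((Real.cos (ρ * r) : ℝ) : ℂ))
        ((-Real.sin (ρ * r) * (ρ * 1) : ℝ) : ℂ) r :=
      (((hasDerivAt_id r).const_mul ρ).cos).ofReal_comp
    refine ((h1.mul ((h2.const_mul (Complex.I * k)).sub h3)).div_const
      (((ρ ^ 2 : ℝ) : ℂ) - k ^ 2)).congr_deriv ?_
    have h4 : (r : ℂ) * ((ρ : ℂ) ^ 2 * (Real.sinc (ρ * r) : ℂ)) = ρ * (Real.sin (ρ * r) : ℂ) := by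
      exact_mod_cast mul_sq_mul_sinc ρ r
    rw [div_eq_iff hne]
    simp only [Pi.sub_apply]
    push_cast at h4 ⊢
    linear_combination (Complex.exp (Complex.I * k * r)) * (-h4 + k ^ 2 * (r : ℂ) * (Real.sinc (ρ * r) : ℂ) * Complex.I_sq)
  have hlim : Tendsto (fun r : ℝ => Complex.exp (Complex.I * k * r) *
      (Complex.I * k * ((r * Real.sinc (ρ * r) : ℝ) : ℂ) - ((Real.cos (ρ * r) : ℝ) : ℂ)) /
        (((ρ ^ 2 : ℝ) : ℂ) - k ^ 2)) atTop (𝓝 0) := by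
    have hb : Tendsto (fun r : ℝ => Real.exp (-(k.im * r)) * (‖k‖ * r + 1) /
        ‖(((ρ ^ 2 : ℝ) : ℂ) - k ^ 2)‖) atTop (𝓝 0) := by
      have e1 := tendsto_rpow_mul_exp_neg_mul_atTop_nhds_zero 1 k.im hk
      have e0 := tendsto_rpow_mul_exp_neg_mul_atTop_nhds_zero 0 k.im hk
      have e := ((e1.const_mul ‖k‖).add e0).div_const ‖(((ρ ^ 2 : ℝ) : ℂ) - k ^ 2)‖
      simp only [mul_zero, add_zero, zero_div] at e
      refine e.congr fun r => ?_
      simp only [Real.rpow_one, Real.rpow_zero, neg_mul]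
      ring
    refine squeeze_zero_norm' ?_ hb
    filter_upwards [eventually_ge_atTop 0] with r hr
    rw [norm_div, norm_mul, hnorm]
    gcongr
    refine (norm_sub_le _ _).trans ?_
    rw [norm_mul, norm_mul, Complex.norm_I, one_mul, Complex.norm_real, Complex.norm_real]
    exact add_le_add (by gcongr; exact abs_mul_sinc_le hr ρ) (Real.abs_cos_le_one _)
  have hval := integral_Ioi_of_hasDerivAt_of_tendsto' (a := 0) (fun r _ => hd r) hint hlim
  have hcongr : ∫ r in Set.Ioi (0 : ℝ), ((4 * Real.pi * r ^ 2 * Real.sinc (ρ * r) : ℝ) : ℂ) *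
      (Complex.exp (Complex.I * k * (r : ℂ)) / (4 * (Real.pi : ℂ) * (r : ℂ))) =
      ∫ r in Set.Ioi (0 : ℝ), ((r * Real.sinc (ρ * r) : ℝ) : ℂ) * Complex.exp (Complex.I * k * r) := by
    refine setIntegral_congr_fun measurableSet_Ioi fun r (hr : 0 < r) => ?_
    have : (r : ℂ) ≠ 0 := by exact_mod_cast hr.ne'
    have : (Real.pi : ℂ) ≠ 0 := by exact_mod_cast Real.pi_ne_zero
    push_cast
    field_simp
  rw [hcongr, hval]
  simp [neg_div]

/-- The transform of a radial function integrates against a real profile, so taking imaginary parts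
commutes with it; then Im(1/(s - k²)) = Im(k²)/|s - k²|² for real s. -/
theorem fourier_imKernel {k : ℂ} (hk : 0 < k.im) (ξ : E3) :
    𝓕 (imKernel k) ξ = (((k ^ 2).im * ‖𝓕 (waveKernel k) ξ‖ ^ 2 : ℝ) : ℂ) := by
  have hK := integrable_waveKernel hk
  have h1 := fourier_radial (h := fun r : ℝ =>
    Complex.exp (Complex.I * k * (r : ℂ)) / (4 * (Real.pi : ℂ) * (r : ℂ))) hK ξ
  have h2 := fourier_radial (h := fun r : ℝ => (((Complex.exp (Complex.I * k * (r : ℂ)) /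
    (4 * (Real.pi : ℂ) * (r : ℂ))).im : ℝ) : ℂ)) (integrable_imKernel hk) ξ
  have h3 : 𝓕 (imKernel k) ξ = (((𝓕 (waveKernel k) ξ).im : ℝ) : ℂ) := by
    change 𝓕 (fun x : E3 => (((Complex.exp (Complex.I * k * (‖x‖ : ℂ)) /
      (4 * (Real.pi : ℂ) * (‖x‖ : ℂ))).im : ℝ) : ℂ)) ξ = (((𝓕 (fun x : E3 =>
      Complex.exp (Complex.I * k * (‖x‖ : ℂ)) / (4 * (Real.pi : ℂ) * (‖x‖ : ℂ))) ξ).im : ℝ) : ℂ)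
    rw [h1, h2]
    have hi : IntegrableOn (fun r : ℝ =>
        ((4 * Real.pi * r ^ 2 * Real.sinc (2 * Real.pi * ‖ξ‖ * r) : ℝ) : ℂ) *
        (Complex.exp (Complex.I * k * (r : ℂ)) / (4 * (Real.pi : ℂ) * (r : ℂ)))) (Set.Ioi 0) := by
      have hr := (integrable_fun_norm_addHaar (volume : Measure E3)
        (f := fun r : ℝ => Complex.exp (Complex.I * k * (r : ℂ)) /
          (4 * (Real.pi : ℂ) * (r : ℂ)))).1 hK
      rw [finrank_E3_sub_one] at hr
      have hs := Real.continuous_sinc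
      refine (Integrable.bdd_mul (c := 4 * Real.pi) hr
        (f := fun r : ℝ => ((4 * Real.pi * Real.sinc (2 * Real.pi * ‖ξ‖ * r) : ℝ) : ℂ))
        (Continuous.aestronglyMeasurable (by fun_prop)) (Eventually.of_forall fun r => ?_)).congr
        (Eventually.of_forall fun r => ?_)
      · rw [Complex.norm_real, norm_mul, Real.norm_of_nonneg (by positivity)]
        exact mul_le_of_le_one_right (by positivity) (Real.abs_sinc_le_one _)
      · simp only [Complex.real_smul]; push_cast; ring
    have := Complex.imCLM.integral_comp_comm hi
    simp only [Complex.imCLM_apply, Complex.im_ofReal_mul] at this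
    rw [← this, ← integral_complex_ofReal]
    refine integral_congr_ae (Eventually.of_forall fun r => ?_)
    push_cast; rfl
  rw [h3, fourier_waveKernel hk]
  congr 1
  rw [one_div, Complex.inv_im, norm_inv, inv_pow, Complex.sq_norm]
  simp only [Complex.sub_im, Complex.ofReal_im, zero_sub, neg_neg]
  rw [div_eq_mul_inv]

/-- The distance from k² to the real symbol |2πξ|² is at least |Im k²|. -/
theorem norm_fourier_waveKernel_le {k : ℂ} (hk : 0 < k.im) (hk2 : (k ^ 2).im ≠ 0) (ξ : E3) :
    ‖𝓕 (waveKernel k) ξ‖ ≤ |(k ^ 2).im|⁻¹ := by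
  rw [fourier_waveKernel hk, one_div, norm_inv]
  refine inv_anti₀ (abs_pos.2 hk2) ?_
  have := Complex.abs_im_le_norm ((((2 * Real.pi * ‖ξ‖) ^ 2 : ℝ) : ℂ) - k ^ 2)
  rwa [Complex.sub_im, Complex.ofReal_im, zero_sub, abs_neg] at this

/-- The imaginary part of the wave kernel, cut off to the shell `S ≤ |x| < T`. -/
noncomputable def shellKernel (k : ℂ) (S T : ℝ) : E3 → ℂ :=
  {x : E3 | S ≤ ‖x‖ ∧ ‖x‖ < T}.indicator (imKernel k)

theorem measurableSet_shell (S T : ℝ) : MeasurableSet {x : E3 | S ≤ ‖x‖ ∧ ‖x‖ < T} :=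
  (measurableSet_le measurable_const measurable_norm).inter
    (measurableSet_lt measurable_norm measurable_const)

theorem measurable_shellKernel (k : ℂ) (S T : ℝ) : Measurable (shellKernel k S T) :=
  (measurable_imKernel k).indicator (measurableSet_shell S T)

theorem memLp_shellKernel {k : ℂ} (hk : 0 ≤ k.im) (S T : ℝ) (p : ℝ≥0∞) :
    MemLp (shellKernel k S T) p := by
  refine (memLp_indicator_iff_restrict (measurableSet_shell S T)).2 ?_
  have : IsFiniteMeasure ((volume : Measure E3).restrict {x : E3 | S ≤ ‖x‖ ∧ ‖x‖ < T}) := by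
    refine ⟨?_⟩
    rw [Measure.restrict_apply_univ]
    refine (measure_mono (t := Metric.ball (0 : E3) T) fun x hx => ?_).trans_lt
      Metric.isBounded_ball.measure_lt_top
    rw [mem_ball_zero_iff]; exact hx.2
  exact MemLp.of_bound (measurable_imKernel k).aestronglyMeasurable (‖k - 1‖ + 1)
    (Eventually.of_forall fun x => norm_imKernel_le hk x)

theorem integrable_shellKernel {k : ℂ} (hk : 0 ≤ k.im) (S T : ℝ) :
    Integrable (shellKernel k S T) :=
  memLp_one_iff_integrable.1 (memLp_shellKernel hk S T 1)

/-- Radially this is the integral of r sinc(ρr) Im e^{ikr}. Putting absolute values inside would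
cost T²; one integration by parts, using the oscillation of e^{ikr}, costs only T. The boundary
terms contribute T + S and the remaining integral T - S, uniformly in the frequency and down to Im k
= 0. -/
theorem norm_fourier_shellKernel_le {k : ℂ} (hk : 0 ≤ k.im) (hk1 : 1 ≤ ‖k‖) {S T : ℝ} (hS : 0 ≤ S)
    (hST : S ≤ T) (ξ : E3) : ‖𝓕 (shellKernel k S T) ξ‖ ≤ 2 * T := by
  have hk0 : k ≠ 0 := fun h => by rw [h, norm_zero] at hk1; linarith
  have hIk : Complex.I * k ≠ 0 := mul_ne_zero Complex.I_ne_zero hk0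
  let g : ℝ → ℂ := fun r => (((Complex.exp (Complex.I * k * (r : ℂ)) /
    (4 * (Real.pi : ℂ) * (r : ℂ))).im : ℝ) : ℂ)
  have hrad : shellKernel k S T = fun x : E3 => (Set.Ico S T).indicator g ‖x‖ := by
    ext x
    simp only [shellKernel, Set.indicator, Set.mem_Ico, g, imKernel, waveKernel, Set.mem_ofPred_eq]
    split_ifs <;> rfl
  rw [hrad, fourier_radial (by rw [← hrad]; exact integrable_shellKernel hk S T)]
  set ρ := 2 * Real.pi * ‖ξ‖
  have h1 : ∫ r in Set.Ioi (0 : ℝ), ((4 * Real.pi * r ^ 2 * Real.sinc (ρ * r) : ℝ) : ℂ) *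
      (Set.Ico S T).indicator g r = ((∫ r in S..T, (r * Real.sinc (ρ * r)) *
        (Complex.exp (Complex.I * k * r)).im : ℝ) : ℂ) := by
    rw [intervalIntegral.integral_of_le hST, ← integral_Ico_eq_integral_Ioc, ← integral_complex_ofReal,
      ← integral_indicator measurableSet_Ioi, ← integral_indicator measurableSet_Ico]
    refine integral_congr_ae ?_
    filter_upwards [Measure.ae_ne volume (0 : ℝ)] with r hr0
    by_cases hr : r ∈ Set.Ico S T
    · have hrpos : 0 < r := lt_of_le_of_ne (hS.trans hr.1) hr0.symm
      rw [Set.indicator_of_mem (Set.mem_Ioi.2 hrpos), Set.indicator_of_mem hr,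
        Set.indicator_of_mem hr]
      simp only [g]
      rw [show (4 * (Real.pi : ℂ) * (r : ℂ)) = ((4 * Real.pi * r : ℝ) : ℂ) by push_cast; ring,
        Complex.div_ofReal_im, ← Complex.ofReal_mul]
      congr 1
      have := Real.pi_pos
      field_simp
    · rw [Set.indicator_of_notMem hr]
      simp only [Set.indicator]
      split_ifs with h <;> simp_all
  rw [h1, Complex.norm_real]
  -- A primitive of Im e^{ikr}; it is bounded by 1 for r ≥ 0 because |k| ≥ 1 and Im k ≥ 0.
  let u : ℝ → ℝ := fun r => (Complex.exp (Complex.I * k * r) / (Complex.I * k)).im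
  have hu : ∀ r : ℝ, HasDerivAt u (Complex.exp (Complex.I * k * r)).im r := by
    intro r
    have h1 : HasDerivAt (fun r : ℝ => Complex.exp (Complex.I * k * r) / (Complex.I * k))
        (Complex.exp (Complex.I * k * r) * (Complex.I * k * 1) / (Complex.I * k)) r :=
      ((((hasDerivAt_id (r : ℂ)).const_mul (Complex.I * k)).cexp).div_const
        (Complex.I * k)).comp_ofReal
    have h2 := Complex.imCLM.hasFDerivAt.comp_hasDerivAt r h1
    refine h2.congr_deriv ?_
    rw [Complex.imCLM_apply, mul_one, mul_div_cancel_right₀ _ hIk]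
  have hub : ∀ r : ℝ, 0 ≤ r → |u r| ≤ 1 := by
    intro r hr
    refine (Complex.abs_im_le_norm _).trans ?_
    rw [norm_div, Complex.norm_exp, re_I_mul_mul_ofReal, norm_mul, Complex.norm_I, one_mul]
    refine div_le_one_of_le₀ (le_trans (Real.exp_le_one_iff.2 ?_) hk1) (norm_nonneg _)
    exact neg_nonpos.2 (by positivity)
  rw [intervalIntegral.integral_mul_deriv_eq_deriv_mul (v := u)
    (fun r _ => hasDerivAt_mul_sinc ρ r) (fun r _ => hu r)
    (Continuous.intervalIntegrable (by fun_prop) _ _)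
    (Continuous.intervalIntegrable (Complex.continuous_im.comp (by fun_prop)) _ _)]
  have hT := hS.trans hST
  have b1 : |T * Real.sinc (ρ * T) * u T| ≤ T := by
    rw [abs_mul]
    exact (mul_le_mul (abs_mul_sinc_le hT ρ) (hub T hT) (abs_nonneg _) hT).trans_eq (mul_one T)
  have b2 : |S * Real.sinc (ρ * S) * u S| ≤ S := by
    rw [abs_mul]
    exact (mul_le_mul (abs_mul_sinc_le hS ρ) (hub S hS) (abs_nonneg _) hS).trans_eq (mul_one S)
  have b3 : ‖∫ r in S..T, Real.cos (ρ * r) * u r‖ ≤ 1 * |T - S| := by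
    refine intervalIntegral.norm_integral_le_of_norm_le_const fun r hr => ?_
    rw [Set.uIoc_of_le hST] at hr
    rw [norm_mul]
    exact mul_le_one₀ (Real.abs_cos_le_one _) (norm_nonneg _) (hub r (hS.trans hr.1.le))
  rw [abs_of_nonneg (sub_nonneg.2 hST), one_mul] at b3
  refine (norm_sub_le _ _).trans ?_
  have b4 := norm_sub_le (T * Real.sinc (ρ * T) * u T) (S * Real.sinc (ρ * S) * u S)
  simp only [Real.norm_eq_abs] at *
  linarith

/-! ### A layer-cake formula for negative powers -/

section LayerCake

variable {α : Type*} [MeasurableSpace α] {μ : Measure α}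

theorem integrableOn_rpow_tail {p : ℝ} (hp : p < 2) {m : ℝ} (hm : 0 < m) :
    IntegrableOn (fun t : ℝ => t ^ (p - 3) * (if m < t then 1 else 0)) (Set.Ioi 0) := by
  have h : (fun t : ℝ => t ^ (p - 3) * (if m < t then 1 else 0)) =
      (Set.Ioi m).indicator (fun t : ℝ => t ^ (p - 3)) := by
    ext t; simp [Set.indicator]
  rw [h]
  exact ((integrable_indicator_iff measurableSet_Ioi).2
    (integrableOn_Ioi_rpow_of_lt (by linarith) hm)).integrableOn

theorem integral_rpow_tail {p : ℝ} (hp : p < 2) {m : ℝ} (hm : 0 < m) :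
    ∫ t in Set.Ioi (0 : ℝ), t ^ (p - 3) * (if m < t then 1 else 0) = m ^ (p - 2) / (2 - p) := by
  have h : (fun t : ℝ => t ^ (p - 3) * (if m < t then 1 else 0)) =
      (Set.Ioi m).indicator (fun t : ℝ => t ^ (p - 3)) := by
    ext t; simp [Set.indicator]
  rw [h, setIntegral_indicator measurableSet_Ioi, Set.inter_eq_right.2 (Set.Ioi_subset_Ioi hm.le),
    integral_Ioi_rpow_of_lt (by linarith) hm, show p - 3 + 1 = p - 2 by ring,
    show p - 2 = -(2 - p) by ring, div_neg, neg_div, neg_neg]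

/-- A negative power is a superposition of indicators: θ^{p-2} = (2 - p) ∫_θ^∞ t^{p-3} dt. It serves
both the interpolation argument and the polynomial weight. -/
theorem integral_rpow_mul_layer {p : ℝ} (hp : p < 2) {θ ψ : ℝ} (h : ψ ≠ 0 → 0 < θ) :
    ∫ t in Set.Ioi (0 : ℝ), t ^ (p - 3) * (if θ < t then ψ else 0) = ψ * θ ^ (p - 2) / (2 - p) := by
  by_cases hψ : ψ = 0
  · simp [hψ]
  · rw [mul_div_assoc, ← integral_rpow_tail hp (h hψ), ← integral_const_mul]
    congr 1; ext t; split_ifs <;> ring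

theorem integrable_layer [SFinite μ] {p : ℝ} (hp : p < 2) {θ ψ : α → ℝ} (hθ : Measurable θ)
    (hψ : Measurable ψ) (hψ0 : ∀ x, 0 ≤ ψ x) (h : ∀ x, ψ x ≠ 0 → 0 < θ x)
    (hi : Integrable (fun x => ψ x * θ x ^ (p - 2)) μ) :
    Integrable (fun q : α × ℝ => q.2 ^ (p - 3) * (if θ q.1 < q.2 then ψ q.1 else 0))
      (μ.prod (volume.restrict (Set.Ioi 0))) := by
  have hm : Measurable (fun q : α × ℝ => q.2 ^ (p - 3) * (if θ q.1 < q.2 then ψ q.1 else 0)) :=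
    (measurable_snd.pow_const _).mul (Measurable.ite
      (measurableSet_lt (hθ.comp measurable_fst) measurable_snd) (hψ.comp measurable_fst)
      measurable_const)
  refine (integrable_prod_iff hm.aestronglyMeasurable).2 ⟨Eventually.of_forall fun x => ?_, ?_⟩
  · by_cases hx : ψ x = 0
    · simp [hx]
    · refine IntegrableOn.congr_fun ((integrableOn_rpow_tail hp (h x hx)).mul_const (ψ x))
        (fun t _ => ?_) measurableSet_Ioi
      simp only; split_ifs <;> ring
  · refine (hi.div_const (2 - p)).congr (Eventually.of_forall fun x => ?_)
    beta_reduce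
    rw [← integral_rpow_mul_layer hp (h x)]
    refine setIntegral_congr_fun measurableSet_Ioi fun t (ht : 0 < t) => ?_
    simp only
    rw [Real.norm_of_nonneg]
    refine mul_nonneg (Real.rpow_nonneg ht.le _) ?_
    split_ifs
    exacts [hψ0 x, le_rfl]

end LayerCake

/-! ### Interpolation of convolution forms between L¹ and L² -/

section Interpolation

variable {K f : E3 → ℂ} {p Λ A₀ A₁ : ℝ}

/-- The upper truncation of `f` at height `t`. -/
noncomputable def truncLow (f : E3 → ℂ) (t : ℝ) (y : E3) : ℂ := if ‖f y‖ < t then f y else 0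

/-- The rescaled part of `f` above height `Λ / t`. -/
noncomputable def truncHigh (f : E3 → ℂ) (p Λ t : ℝ) (x : E3) : ℂ :=
  if Λ / ‖f x‖ < t then ((‖f x‖ ^ (p - 2) : ℝ) : ℂ) * f x else 0

theorem measurable_truncLow (hf : Measurable f) (t : ℝ) : Measurable (truncLow f t) :=
  Measurable.ite (measurableSet_lt hf.norm measurable_const) hf measurable_const

theorem measurable_truncHigh (hf : Measurable f) (p Λ t : ℝ) : Measurable (truncHigh f p Λ t) :=
  Measurable.ite (measurableSet_lt (measurable_const.div hf.norm) measurable_const)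
    ((Complex.measurable_ofReal.comp (hf.norm.pow_const _)).mul hf) measurable_const

theorem norm_truncLow_le (f : E3 → ℂ) (t : ℝ) (y : E3) : ‖truncLow f t y‖ ≤ ‖f y‖ := by
  unfold truncLow; split_ifs <;> simp

theorem norm_truncHigh_le (hp2 : p < 2) (hΛ : 0 < Λ) {t : ℝ} (ht : 0 < t) (x : E3) :
    ‖truncHigh f p Λ t x‖ ≤ (Λ / t) ^ (p - 2) * ‖f x‖ := by
  unfold truncHigh
  split_ifs with h
  · rw [norm_mul, Complex.norm_real, Real.norm_of_nonneg (by positivity)]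
    rcases (norm_nonneg (f x)).eq_or_lt with h0 | h0
    · simp [← h0]
    · gcongr ?_ * _
      refine Real.rpow_le_rpow_of_nonpos (by positivity) ?_ (by linarith)
      rw [div_lt_iff₀ h0] at h
      rw [div_le_iff₀ ht]
      linarith
  · simp only [norm_zero]; positivity

/-- A power of max(ab, Λ) splits into a power of a times one of max(b, Λ/a). The layer-cake
indicator {max(b, Λ/a) < t} then separates the two variables. -/
theorem max_rpow_identity {a b : ℝ} (ha : 0 < a) (hb : 0 ≤ b) :
    a ^ (p - 2) * (max b (Λ / a)) ^ (p - 2) = (max (a * b) Λ) ^ (p - 2) := by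
  rw [← Real.mul_rpow ha.le (le_max_of_le_left hb), mul_max_of_nonneg _ _ ha.le,
    mul_div_cancel₀ _ ha.ne']

/-- Interpolation between an `L¹` and an `L²` bound for a sesquilinear convolution form,
with a free threshold `Λ`. -/
theorem norm_kernelForm_self_le_add (hp1 : 1 ≤ p) (hp2 : p < 2) (hΛ : 0 < Λ) (hKm : Measurable K)
    (hK1 : Integrable K) (hK2 : MemLp K 2) (hf : Measurable f) (hf1 : Integrable f)
    (hf2 : MemLp f 2) (hfp : Integrable fun x => ‖f x‖ ^ p) (hA₀ : ∀ x, ‖K x‖ ≤ A₀)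
    (hA₁ : ∀ ξ, ‖𝓕 K ξ‖ ≤ A₁) :
    ‖kernelForm K f f‖ ≤ A₀ * Λ ^ (1 - p) * (∫ x, ‖f x‖ ^ p) ^ 2 +
      A₁ * Λ ^ (1 - p / 2) * ∫ x, ‖f x‖ ^ p := by
  set F := ∫ x, ‖f x‖ ^ p with hF
  have hA₀0 : 0 ≤ A₀ := (norm_nonneg _).trans (hA₀ 0)
  have hA₁0 : 0 ≤ A₁ := (norm_nonneg _).trans (hA₁ 0)
  let Φ : E3 × E3 → ℂ := fun q => starRingEnd ℂ (f q.1) * f q.2 * K (q.1 - q.2)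
  have hΦm : Measurable Φ :=
    ((Complex.continuous_conj.measurable.comp (hf.comp measurable_fst)).mul
      (hf.comp measurable_snd)).mul (hKm.comp (measurable_fst.sub measurable_snd))
  have hΦ : Integrable Φ (volume.prod volume) := integrable_kernelForm hK2 hf1 hf2
  have hΦn : ∀ q, ‖Φ q‖ ≤ A₀ * (‖f q.1‖ * ‖f q.2‖) := fun q => by
    simp only [Φ, norm_mul, RCLike.norm_conj]
    rw [mul_comm]; gcongr; exact hA₀ _
  -- A soft cutoff to |f(x)||f(y)| ≤ Λ: it equals 1 there and decays beyond. A sharp cutoff would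
  -- not be compatible with the L² bound, whereas this one is an average over t of products of a
  -- function of x and a function of y.
  let m : E3 × E3 → ℝ := fun q => Λ ^ (2 - p) * (max (‖f q.1‖ * ‖f q.2‖) Λ) ^ (p - 2)
  have hmm : Measurable m := by
    have h1 : Measurable fun q : E3 × E3 => ‖f q.1‖ := (hf.comp measurable_fst).norm
    have h2 : Measurable fun q : E3 × E3 => ‖f q.2‖ := (hf.comp measurable_snd).norm
    exact ((h1.mul h2).max measurable_const).pow_const _ |>.const_mul _
  have hm0 : ∀ q, 0 ≤ m q := fun q => by
    have : 0 ≤ max (‖f q.1‖ * ‖f q.2‖) Λ := le_max_of_le_right hΛ.le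
    positivity
  have hΛΛ : Λ ^ (2 - p) * Λ ^ (p - 2) = 1 := by
    rw [← Real.rpow_add hΛ]; simp
  have hm1 : ∀ q, m q ≤ 1 := fun q => by
    rw [← hΛΛ]
    gcongr ?_ * ?_
    exact Real.rpow_le_rpow_of_nonpos hΛ (le_max_right _ _) (by linarith)
  have hΦmi : Integrable (fun q => Φ q * (m q : ℂ)) (volume.prod volume) := by
    refine hΦ.mono (hΦm.mul (Complex.measurable_ofReal.comp hmm)).aestronglyMeasurable
      (Eventually.of_forall fun q => ?_)
    rw [norm_mul, Complex.norm_real, Real.norm_of_nonneg (hm0 q)]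
    exact mul_le_of_le_one_right (norm_nonneg _) (hm1 q)
  have hsplit : kernelForm K f f =
      (∫ q, Φ q * (1 - (m q : ℂ)) ∂(volume.prod volume)) + ∫ q, Φ q * (m q : ℂ) ∂(volume.prod volume) := by
    rw [← integral_add _ hΦmi]
    · exact integral_congr_ae (Eventually.of_forall fun q => by simp only [Φ]; ring)
    · exact (hΦ.sub hΦmi).congr (Eventually.of_forall fun q => by
        simp only [Pi.sub_apply]; ring)
  -- the part with large product
  have hpart1 : ‖∫ q, Φ q * (1 - (m q : ℂ)) ∂(volume.prod volume)‖ ≤ A₀ * Λ ^ (1 - p) * F ^ 2 := by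
    have hFF : ∫ q : E3 × E3, ‖f q.1‖ ^ p * ‖f q.2‖ ^ p ∂(volume.prod volume) = F ^ 2 := by
      rw [integral_prod_mul (fun x => ‖f x‖ ^ p) (fun x => ‖f x‖ ^ p), sq]
    rw [← hFF, ← integral_const_mul]
    refine norm_integral_le_of_norm_le ((hfp.mul_prod hfp).const_mul _)
      (Eventually.of_forall fun q => ?_)
    have h1 : ‖(1 - (m q : ℂ))‖ = 1 - m q := by
      rw [← Complex.ofReal_one, ← Complex.ofReal_sub, Complex.norm_real,
        Real.norm_of_nonneg (sub_nonneg.2 (hm1 q))]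
    rw [norm_mul, h1]
    by_cases hq : ‖f q.1‖ * ‖f q.2‖ ≤ Λ
    · have : m q = 1 := by simp only [m]; rw [max_eq_right hq, hΛΛ]
      rw [this, sub_self, mul_zero]
      positivity
    · push Not at hq
      set s := ‖f q.1‖ * ‖f q.2‖ with hs
      have hs0 : 0 < s := hΛ.trans hq
      -- Above the threshold s/Λ > 1 and p ≥ 1, so the product s is dominated by Λ^{1-p} s^p and the
      -- sup bound on `K` suffices.
      have h2 : s ≤ Λ ^ (1 - p) * s ^ p := by
        have e : Λ ^ (1 - p) * s ^ p = s * (s / Λ) ^ (p - 1) := by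
          rw [Real.div_rpow hs0.le hΛ.le, Real.rpow_sub_one hs0.ne', show 1 - p = -(p - 1) by ring,
            Real.rpow_neg hΛ.le]
          field_simp
        rw [e]
        exact le_mul_of_one_le_right hs0.le
          (Real.one_le_rpow ((one_le_div hΛ).2 hq.le) (by linarith))
      calc ‖Φ q‖ * (1 - m q) ≤ (A₀ * s) * 1 :=
            mul_le_mul (hΦn q) (by linarith [hm0 q]) (by linarith [hm1 q]) (by positivity)
        _ ≤ A₀ * (Λ ^ (1 - p) * s ^ p) := by rw [mul_one]; gcongr
        _ = A₀ * Λ ^ (1 - p) * (‖f q.1‖ ^ p * ‖f q.2‖ ^ p) := by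
            rw [hs, Real.mul_rpow (norm_nonneg _) (norm_nonneg _)]; ring
  -- the part with small product
  let θ : E3 × E3 → ℝ := fun q => max ‖f q.2‖ (Λ / ‖f q.1‖)
  let ψ : E3 × E3 → ℝ := fun q => ‖f q.1‖ ^ (p - 2) * ‖Φ q‖
  have hθm : Measurable θ := ((hf.comp measurable_snd).norm).max
    (measurable_const.div (hf.comp measurable_fst).norm)
  have hψm : Measurable ψ := ((hf.comp measurable_fst).norm.pow_const _).mul hΦm.norm
  have hψθ : ∀ q, ψ q ≠ 0 → 0 < ‖f q.1‖ := fun q h => by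
    refine norm_pos_iff.2 fun h0 => h ?_
    simp [ψ, Φ, h0]
  have hθpos : ∀ q, ψ q ≠ 0 → 0 < θ q := fun q h =>
    lt_max_of_lt_right (div_pos hΛ (hψθ q h))
  have hψθi : ∀ q, ψ q * θ q ^ (p - 2) = Λ ^ (p - 2) * (‖Φ q‖ * m q) := fun q => by
    by_cases h : ψ q = 0
    · have h0 : ‖Φ q‖ = 0 := by
        simp only [ψ, mul_eq_zero] at h
        rcases h with h | h
        · have : ‖f q.1‖ = 0 := by
            by_contra hne
            exact (Real.rpow_pos_of_pos (lt_of_le_of_ne (norm_nonneg _) (Ne.symm hne)) _).ne' h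
          simp [Φ, norm_eq_zero.1 this]
        · exact h
      rw [h, h0]; simp
    · have e := max_rpow_identity (p := p) (Λ := Λ) (hψθ q h) (norm_nonneg (f q.2))
      calc ψ q * θ q ^ (p - 2) = ‖Φ q‖ * (‖f q.1‖ ^ (p - 2) * θ q ^ (p - 2)) := by
            simp only [ψ]; ring
        _ = ‖Φ q‖ * (max (‖f q.1‖ * ‖f q.2‖) Λ) ^ (p - 2) := by rw [e]
        _ = (Λ ^ (2 - p) * Λ ^ (p - 2)) * (‖Φ q‖ * (max (‖f q.1‖ * ‖f q.2‖) Λ) ^ (p - 2)) := by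
            rw [hΛΛ, one_mul]
        _ = _ := by simp only [m]; ring
  have hlay := integrable_layer (μ := (volume : Measure E3).prod volume) hp2 hθm hψm
    (fun q => by positivity) hθpos (by
      simp only [hψθi]
      refine (hΦmi.norm.const_mul (Λ ^ (p - 2))).congr (Eventually.of_forall fun q => ?_)
      simp only [norm_mul, Complex.norm_real, Real.norm_of_nonneg (hm0 q)])
  -- For each t the integrand is a form in the truncations `truncHigh` and `truncLow`; integrating
  -- it over t recovers the form with cutoff `m`, up to a constant.
  let Ψ : (E3 × E3) × ℝ → ℂ := fun w => ((w.2 ^ (p - 3) : ℝ) : ℂ) *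
    (starRingEnd ℂ (truncHigh f p Λ w.2 w.1.1) * truncLow f w.2 w.1.2 * K (w.1.1 - w.1.2))
  have hΨ : ∀ q t, Ψ (q, t) = ((t ^ (p - 3) * (if θ q < t then ‖f q.1‖ ^ (p - 2) else 0) : ℝ) : ℂ)
      * Φ q := by
    intro q t
    simp only [Ψ, truncHigh, truncLow, θ, max_lt_iff, Φ]
    by_cases h1 : ‖f q.2‖ < t <;> by_cases h2 : Λ / ‖f q.1‖ < t <;> simp [h1, h2]
    ring
  have hΨi : Integrable Ψ (((volume : Measure E3).prod volume).prod
      (volume.restrict (Set.Ioi 0))) := by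
    refine hlay.mono ?_ ?_
    · have : Ψ = fun w => ((w.2 ^ (p - 3) * (if θ w.1 < w.2 then ‖f w.1.1‖ ^ (p - 2) else 0) : ℝ) : ℂ)
          * Φ w.1 := by
        ext ⟨q, t⟩; exact hΨ q t
      rw [this]
      refine Measurable.aestronglyMeasurable ((Complex.measurable_ofReal.comp
        ((measurable_snd.pow_const _).mul (Measurable.ite (measurableSet_lt
          (hθm.comp measurable_fst) measurable_snd) ?_ measurable_const))).mul
          (hΦm.comp measurable_fst))
      exact (hf.comp (measurable_fst.comp measurable_fst)).norm.pow_const _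
    · refine Eventually.of_forall fun ⟨q, t⟩ => ?_
      change ‖Ψ (q, t)‖ ≤ ‖t ^ (p - 3) * (if θ q < t then ψ q else 0)‖
      rw [hΨ, norm_mul _ (Φ q), Complex.norm_real, norm_mul, norm_mul (t ^ (p - 3)), mul_assoc]
      refine mul_le_mul_of_nonneg_left (le_of_eq ?_) (norm_nonneg (t ^ (p - 3)))
      simp only [ψ]
      split_ifs
      · rw [Real.norm_of_nonneg (by positivity : 0 ≤ ‖f q.1‖ ^ (p - 2)),
          Real.norm_of_nonneg (by positivity)]
      · simp
  have hinner : ∀ q, ∫ t in Set.Ioi (0 : ℝ), Ψ (q, t) =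
      ((Λ ^ (p - 2) / (2 - p) : ℝ) : ℂ) * (Φ q * (m q : ℂ)) := by
    intro q
    simp only [hΨ]
    rw [integral_mul_const, integral_complex_ofReal]
    by_cases h : ψ q = 0
    · have h0 : Φ q = 0 := by
        have := hψθi q
        rw [h, zero_mul] at this
        have hne : Λ ^ (p - 2) ≠ 0 := (Real.rpow_pos_of_pos hΛ _).ne'
        have hmp : m q ≠ 0 := by
          have : 0 < max (‖f q.1‖ * ‖f q.2‖) Λ := lt_max_of_lt_right hΛ
          simp only [m]; positivity
        simpa [hne, hmp] using this.symm
      simp [h0]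
    · rw [integral_rpow_mul_layer hp2 (fun _ => hθpos q h)]
      have h1 : ‖f q.1‖ ^ (p - 2) * θ q ^ (p - 2) = Λ ^ (p - 2) * m q := by
        have hΦ0 : ‖Φ q‖ ≠ 0 := fun h0 => h (by simp only [ψ]; rw [h0, mul_zero])
        have := hψθi q
        simp only [ψ] at this
        refine mul_left_cancel₀ hΦ0 ?_
        linarith
      rw [h1]
      push_cast; ring
  have hswap : ∫ q, Φ q * (m q : ℂ) ∂(volume.prod volume) = (((2 - p) * Λ ^ (2 - p) : ℝ) : ℂ) *
      ∫ t in Set.Ioi (0 : ℝ), ((t ^ (p - 3) : ℝ) : ℂ) *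
        kernelForm K (truncHigh f p Λ t) (truncLow f t) := by
    have h1 : ∫ t in Set.Ioi (0 : ℝ), ((t ^ (p - 3) : ℝ) : ℂ) *
        kernelForm K (truncHigh f p Λ t) (truncLow f t) =
        ∫ t in Set.Ioi (0 : ℝ), ∫ q, Ψ (q, t) ∂(volume.prod volume) := by
      refine integral_congr_ae (Eventually.of_forall fun t => ?_)
      simp only [Ψ, integral_const_mul]
      rfl
    rw [h1, ← integral_integral_swap (f := fun q t => Ψ (q, t)) hΨi]
    simp only [hinner]
    rw [integral_const_mul, ← mul_assoc, ← Complex.ofReal_mul]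
    have : (2 - p) * Λ ^ (2 - p) * (Λ ^ (p - 2) / (2 - p)) = 1 := by
      have : 2 - p ≠ 0 := by linarith
      rw [mul_div_assoc', mul_assoc, hΛΛ]; field_simp
    rw [this]; simp
  have hF0 : 0 ≤ F := integral_nonneg fun x => by positivity
  have hna : Measurable fun x => ‖f x‖ := hf.norm
  have hG := integrable_layer (μ := (volume : Measure E3)) hp2 (θ := fun x => Λ / ‖f x‖)
    (ψ := fun x => (‖f x‖ ^ (p - 2) * ‖f x‖) ^ 2) (measurable_const.div hna)
    ((show Measurable fun x => ‖f x‖ ^ (p - 2) * ‖f x‖ from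
      (hna.pow_const _).mul hna).pow_const 2) (fun x => by positivity)
    (fun x h => div_pos hΛ (norm_pos_iff.2 fun h0 => h (by simp [h0])))
  have hH := integrable_layer (μ := (volume : Measure E3)) hp2 (θ := fun x => ‖f x‖)
    (ψ := fun x => ‖f x‖ ^ 2) hna (hna.pow_const _) (fun x => by positivity)
    (fun x h => norm_pos_iff.2 fun h0 => h (by simp [h0]))
  have hGe : ∀ x, (‖f x‖ ^ (p - 2) * ‖f x‖) ^ 2 * (Λ / ‖f x‖) ^ (p - 2) =
      Λ ^ (p - 2) * ‖f x‖ ^ p := fun x => by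
    rcases (norm_nonneg (f x)).eq_or_lt with h0 | h0
    · rw [← h0, Real.zero_rpow (by linarith : p ≠ 0)]; simp
    · have hx : ‖f x‖ ^ p = ‖f x‖ ^ (p - 2) * ‖f x‖ ^ 2 := by
        rw [← Real.rpow_natCast, ← Real.rpow_add h0]; congr 1; push_cast; ring
      have : ‖f x‖ ^ (p - 2) ≠ 0 := (Real.rpow_pos_of_pos h0 _).ne'
      rw [Real.div_rpow hΛ.le h0.le, hx]
      field_simp
  have hHe : ∀ x, ‖f x‖ ^ 2 * ‖f x‖ ^ (p - 2) = ‖f x‖ ^ p := fun x => by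
    rcases (norm_nonneg (f x)).eq_or_lt with h0 | h0
    · rw [← h0, Real.zero_rpow (by linarith : p ≠ 0)]; simp
    · rw [← Real.rpow_natCast, ← Real.rpow_add h0]; congr 1; push_cast; ring
  simp only [hGe, hHe] at hG hH
  have hG := hG (hfp.const_mul _)
  have hH := hH hfp
  have hGsq : ∀ t x, ‖truncHigh f p Λ t x‖ ^ 2 =
      if Λ / ‖f x‖ < t then (‖f x‖ ^ (p - 2) * ‖f x‖) ^ 2 else 0 := fun t x => by
    unfold truncHigh
    split_ifs
    · rw [norm_mul, Complex.norm_real, Real.norm_of_nonneg (by positivity)]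
    · simp
  have hHsq : ∀ t x, ‖truncLow f t x‖ ^ 2 = if ‖f x‖ < t then ‖f x‖ ^ 2 else 0 := fun t x => by
    unfold truncLow; split_ifs <;> simp
  have hGint : ∫ t in Set.Ioi (0 : ℝ), t ^ (p - 3) * ∫ x, ‖truncHigh f p Λ t x‖ ^ 2 =
      Λ ^ (p - 2) * F / (2 - p) := by
    simp only [hGsq, ← integral_const_mul]
    rw [← integral_integral_swap (f := fun (x : E3) (t : ℝ) => t ^ (p - 3) * (if Λ / ‖f x‖ < t then
      (‖f x‖ ^ (p - 2) * ‖f x‖) ^ 2 else 0)) hG]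
    have : ∀ x, ∫ t in Set.Ioi (0 : ℝ), t ^ (p - 3) * (if Λ / ‖f x‖ < t then
        (‖f x‖ ^ (p - 2) * ‖f x‖) ^ 2 else 0) = Λ ^ (p - 2) / (2 - p) * ‖f x‖ ^ p := fun x => by
      rw [integral_rpow_mul_layer hp2, hGe]
      · ring
      · exact fun h => div_pos hΛ (norm_pos_iff.2 fun h0 => h (by simp [h0]))
    simp only [this, integral_const_mul]
    rw [hF]; ring
  have hHint : ∫ t in Set.Ioi (0 : ℝ), t ^ (p - 3) * ∫ x, ‖truncLow f t x‖ ^ 2 = F / (2 - p) := by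
    simp only [hHsq, ← integral_const_mul]
    rw [← integral_integral_swap (f := fun (x : E3) (t : ℝ) => t ^ (p - 3) * (if ‖f x‖ < t then
      ‖f x‖ ^ 2 else 0)) hH]
    have : ∀ x, ∫ t in Set.Ioi (0 : ℝ), t ^ (p - 3) * (if ‖f x‖ < t then
        ‖f x‖ ^ 2 else 0) = (2 - p)⁻¹ * ‖f x‖ ^ p := fun x => by
      rw [integral_rpow_mul_layer hp2, hHe]
      · ring
      · exact fun h => norm_pos_iff.2 fun h0 => h (by simp [h0])
    simp only [this, integral_const_mul]
    rw [hF]; ring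
  have hGi : IntegrableOn (fun t : ℝ => t ^ (p - 3) * ∫ x, ‖truncHigh f p Λ t x‖ ^ 2)
      (Set.Ioi 0) := by
    simp only [hGsq, ← integral_const_mul]
    exact hG.integral_prod_right
  have hHi : IntegrableOn (fun t : ℝ => t ^ (p - 3) * ∫ x, ‖truncLow f t x‖ ^ 2)
      (Set.Ioi 0) := by
    simp only [hHsq, ← integral_const_mul]
    exact hH.integral_prod_right
  -- Chosen to balance the two squares in the weighted Cauchy–Schwarz bound: c · Λ^{p-2} = c⁻¹.
  set c := Λ ^ (1 - p / 2) with hc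
  have hc0 : 0 < c := Real.rpow_pos_of_pos hΛ _
  have hcc : c * c = Λ ^ (2 - p) := by rw [hc, ← Real.rpow_add hΛ]; congr 1; ring
  have hform : ‖∫ t in Set.Ioi (0 : ℝ), ((t ^ (p - 3) : ℝ) : ℂ) *
      kernelForm K (truncHigh f p Λ t) (truncLow f t)‖ ≤
      A₁ / 2 * (c * (Λ ^ (p - 2) * F / (2 - p)) + c⁻¹ * (F / (2 - p))) := by
    rw [← hGint, ← hHint, ← integral_const_mul, ← integral_const_mul,
      ← integral_add (hGi.const_mul _) (hHi.const_mul _), ← integral_const_mul]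
    refine norm_integral_le_of_norm_le (((hGi.const_mul _).add (hHi.const_mul _)).const_mul _) ?_
    filter_upwards [ae_restrict_mem measurableSet_Ioi] with t (ht : 0 < t)
    have g1 : Integrable (truncHigh f p Λ t) :=
      (hf1.norm.const_mul _).mono' (measurable_truncHigh hf p Λ t).aestronglyMeasurable
        (Eventually.of_forall fun x => norm_truncHigh_le hp2 hΛ ht x)
    have g2 : MemLp (truncHigh f p Λ t) 2 :=
      (hf2.norm.const_mul ((Λ / t) ^ (p - 2))).mono
        (measurable_truncHigh hf p Λ t).aestronglyMeasurable
        (Eventually.of_forall fun x => (norm_truncHigh_le hp2 hΛ ht x).trans (le_abs_self _))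
    have l1 : Integrable (truncLow f t) :=
      hf1.mono (measurable_truncLow hf t).aestronglyMeasurable
        (Eventually.of_forall fun x => norm_truncLow_le f t x)
    have l2 : MemLp (truncLow f t) 2 :=
      hf2.mono (measurable_truncLow hf t).aestronglyMeasurable
        (Eventually.of_forall fun x => norm_truncLow_le f t x)
    have := norm_kernelForm_le hK1 hK2 g1 g2 l1 l2 hA₁ hc0
    rw [norm_mul, Complex.norm_real, Real.norm_of_nonneg (by positivity)]
    refine (mul_le_mul_of_nonneg_left this (by positivity)).trans_eq ?_
    ring
  rw [hsplit]
  refine (norm_add_le _ _).trans (add_le_add hpart1 ?_)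
  rw [hswap, norm_mul, Complex.norm_real, Real.norm_of_nonneg
    (mul_nonneg (by linarith) (by positivity))]
  refine (mul_le_mul_of_nonneg_left hform (mul_nonneg (by linarith) (by positivity))).trans_eq ?_
  have hp' : 2 - p ≠ 0 := by linarith
  have e1 : Λ ^ (p - 2) = (c * c)⁻¹ := by
    rw [hcc, ← Real.rpow_neg hΛ.le]; congr 1; ring
  rw [e1, ← hcc]
  field_simp
  ring

/-- Interpolation between an `L¹` and an `L²` bound for a sesquilinear convolution form. -/
theorem norm_kernelForm_self_le (hp1 : 1 ≤ p) (hp2 : p < 2) (hKm : Measurable K)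
    (hK1 : Integrable K) (hK2 : MemLp K 2) (hf : Measurable f) (hf1 : Integrable f)
    (hf2 : MemLp f 2) (hfp : Integrable fun x => ‖f x‖ ^ p) (hA₀p : 0 < A₀) (hA₁p : 0 < A₁)
    (hA₀ : ∀ x, ‖K x‖ ≤ A₀) (hA₁ : ∀ ξ, ‖𝓕 K ξ‖ ≤ A₁) :
    ‖kernelForm K f f‖ ≤ 2 * A₀ ^ (2 / p - 1) * A₁ ^ (2 - 2 / p) * (∫ x, ‖f x‖ ^ p) ^ (2 / p) := by
  have hp0 : 0 < p := by linarith
  have hF0 : 0 ≤ ∫ x, ‖f x‖ ^ p := integral_nonneg fun x => by positivity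
  rcases hF0.eq_or_lt with hF | hF
  · have hz : ∀ᵐ x, f x = 0 := by
      have := (integral_eq_zero_iff_of_nonneg (fun x => by positivity) hfp).1 hF.symm
      filter_upwards [this] with x hx
      exact norm_eq_zero.1 ((Real.rpow_eq_zero (norm_nonneg _) hp0.ne').1 hx)
    have h0 : kernelForm K f f = 0 := by
      rw [kernelForm_eq_integral_conv hK2 hf1 hf2]
      refine integral_eq_zero_of_ae ?_
      filter_upwards [hz] with x hx
      simp [hx]
    rw [h0, norm_zero]; positivity
  · set F := ∫ x, ‖f x‖ ^ p
    -- The threshold at which the two terms of the bound coincide: Λ^{p/2} = A₀F/A₁. This explains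
    -- the factor 2.
    set Λ := (A₀ * F / A₁) ^ (2 / p)
    have hΛ : 0 < Λ := by positivity
    refine (norm_kernelForm_self_le_add hp1 hp2 hΛ hKm hK1 hK2 hf hf1 hf2 hfp hA₀ hA₁).trans_eq ?_
    have e1 : Λ ^ (1 - p) = (A₀ * F / A₁) ^ (2 / p - 2) := by
      rw [← Real.rpow_mul (by positivity)]; congr 1; field_simp
    have e2 : Λ ^ (1 - p / 2) = (A₀ * F / A₁) ^ (2 / p - 1) := by
      rw [← Real.rpow_mul (by positivity)]; congr 1; field_simp
    have e3 : (A₀ * F / A₁) ^ (2 / p - 1) = A₀ ^ (2 / p - 1) * F ^ (2 / p - 1) / A₁ ^ (2 / p - 1) := by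
      rw [Real.div_rpow (by positivity) (by positivity), Real.mul_rpow (by positivity) (by positivity)]
    have e4 : (A₀ * F / A₁) ^ (2 / p - 2) = (A₀ * F / A₁) ^ (2 / p - 1) / (A₀ * F / A₁) := by
      rw [← Real.rpow_sub_one (by positivity)]; congr 1; ring
    have e5 : A₁ ^ (2 - 2 / p) = A₁ / A₁ ^ (2 / p - 1) := by
      rw [show 2 - 2 / p = 1 - (2 / p - 1) by ring, Real.rpow_sub hA₁p, Real.rpow_one]
    have e6 : F ^ (2 / p) = F ^ (2 / p - 1) * F := by
      rw [← Real.rpow_add_one hF.ne']; congr 1; ring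
    rw [e1, e2, e4, e3, e5, e6]
    field_simp
    ring

end Interpolation

/-! ### The resolvent norm and the sphere norm as kernel forms -/

/-- Needed for `imKernel 1`, which decays only like 1/|x| and lies in neither L¹ nor L². -/
theorem integrable_kernelForm_of_bounded {K f g : E3 → ℂ} (hK : Measurable K) {B : ℝ}
    (hB : ∀ x, ‖K x‖ ≤ B) (hf : Integrable f) (hg : Integrable g) :
    Integrable (fun p : E3 × E3 => starRingEnd ℂ (f p.1) * g p.2 * K (p.1 - p.2))
      (volume.prod volume) := by
  refine ((hf.norm.mul_prod hg.norm).mul_const B).mono'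
    (aestronglyMeasurable_kernelForm hK.aestronglyMeasurable hf.1 hg.1)
    (Eventually.of_forall fun p => ?_)
  rw [norm_mul, norm_mul, RCLike.norm_conj]
  gcongr
  exact hB _

theorem kernelForm_linear {K L f g : E3 → ℂ} (hK : Measurable K) (hL : Measurable L) {B : ℝ}
    (hBK : ∀ x, ‖K x‖ ≤ B) (hBL : ∀ x, ‖L x‖ ≤ B) (hf : Integrable f) (hg : Integrable g)
    (a b : ℂ) :
    kernelForm (fun x => a * K x + b * L x) f g = a * kernelForm K f g + b * kernelForm L f g := by
  have h1 := integrable_kernelForm_of_bounded hK hBK hf hg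
  have h2 := integrable_kernelForm_of_bounded hL hBL hf hg
  simp only [kernelForm, Measure.volume_eq_prod]
  rw [← integral_const_mul, ← integral_const_mul, ← integral_add (h1.const_mul a) (h2.const_mul b)]
  exact integral_congr_ae (Eventually.of_forall fun p => by simp only; ring)

theorem fourier_linear {f g : E3 → ℂ} (hf : Integrable f) (hg : Integrable g) (a b : ℂ) (ξ : E3) :
    𝓕 (fun x => a * f x + b * g x) ξ = a * 𝓕 f ξ + b * 𝓕 g ξ := by
  have h1 := (Real.fourierIntegral_convergent_iff ξ).2 hf
  have h2 := (Real.fourierIntegral_convergent_iff ξ).2 hg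
  simp only [Real.fourier_eq, Circle.smul_def, smul_eq_mul] at *
  rw [← integral_const_mul, ← integral_const_mul, ← integral_add (h1.const_mul a) (h2.const_mul b)]
  exact integral_congr_ae (Eventually.of_forall fun p => by simp only; ring)

/-- The `L²` size of the resolvent through the imaginary part of its kernel. -/
theorem im_mul_integral_sq_fourier {k : ℂ} (hk : 0 < k.im) {f : E3 → ℂ} (hf1 : Integrable f)
    (hf2 : MemLp f 2) :
    (((k ^ 2).im * ∫ ξ, (‖𝓕 (waveKernel k) ξ‖ * ‖𝓕 f ξ‖) ^ 2 : ℝ) : ℂ) =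
      kernelForm (imKernel k) f f := by
  rw [kernelForm_eq_integral_fourier (integrable_imKernel hk) (memLp_imKernel hk) hf1 hf2 hf1 hf2,
    ← integral_const_mul, ← integral_complex_ofReal]
  refine integral_congr_ae (Eventually.of_forall fun ξ => ?_)
  simp only [fourier_imKernel hk]
  have : starRingEnd ℂ (𝓕 f ξ) * 𝓕 f ξ = ((‖𝓕 f ξ‖ ^ 2 : ℝ) : ℂ) := by
    rw [Complex.conj_mul']; push_cast; rfl
  rw [mul_left_comm, this]
  push_cast; ring

theorem integral_sq_conv_waveKernel {k : ℂ} (hk : 0 < k.im) {f : E3 → ℂ} (hf1 : Integrable f)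
    (hf2 : MemLp f 2) :
    ∫ x, ‖conv (waveKernel k) f x‖ ^ 2 = ∫ ξ, (‖𝓕 (waveKernel k) ξ‖ * ‖𝓕 f ξ‖) ^ 2 := by
  have hK1 := integrable_waveKernel hk
  rw [← integral_norm_sq_fourier (integrable_conv hK1 hf1)
    (memLp_conv hK1 (memLp_waveKernel hk) hf1 hf2)]
  simp only [fourier_conv hK1 hf1, norm_mul]

/-- The origin is excluded because division by zero gives the kernel the value 0 there, while the
sphere integral equals 4π. -/
theorem imKernel_one_eq {x : E3} (hx : x ≠ 0) :
    sphereWave x = ((16 * Real.pi ^ 2 : ℝ) : ℂ) * imKernel 1 x := by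
  have hx' : ‖x‖ ≠ 0 := norm_ne_zero_iff.2 hx
  rw [sphereWave_eq, Real.sinc_of_ne_zero hx', imKernel, waveKernel,
    show (4 * (Real.pi : ℂ) * (‖x‖ : ℂ)) = ((4 * Real.pi * ‖x‖ : ℝ) : ℂ) by push_cast; ring,
    Complex.div_ofReal_im, Complex.exp_im, re_I_mul_mul_ofReal, ← Complex.ofReal_mul]
  congr 1
  simp only [Complex.one_im, zero_mul, neg_zero, Real.exp_zero, one_mul, mul_one,
    Complex.I_mul_im, Complex.ofReal_re]
  have := Real.pi_pos
  field_simp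
  ring

/-- The squared `L²(S²)` norm of the Fourier transform is a convolution form. -/
theorem integral_sphere_norm_sq {f : E3 → ℂ} (hf : Integrable f) :
    ((∫ ω : S2, ‖𝓕 f ((2 * Real.pi)⁻¹ • (ω : E3))‖ ^ 2 ∂sphereMeasure : ℝ) : ℂ) =
      ((16 * Real.pi ^ 2 : ℝ) : ℂ) * kernelForm (imKernel 1) f f := by
  have hF : ∀ ω : S2, ((‖𝓕 f ((2 * Real.pi)⁻¹ • (ω : E3))‖ ^ 2 : ℝ) : ℂ) =
      ∫ p : E3 × E3, starRingEnd ℂ (f p.1) * f p.2 *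
        Complex.exp (Complex.I * ((inner ℝ (p.1 - p.2) (ω : E3) : ℝ) : ℂ)) ∂(volume.prod volume) := by
    intro ω
    have h1 : 𝓕 f ((2 * Real.pi)⁻¹ • (ω : E3)) =
        ∫ x, Complex.exp (-(Complex.I * ((inner ℝ x (ω : E3) : ℝ) : ℂ))) * f x := by
      rw [Real.fourier_eq']
      refine integral_congr_ae (Eventually.of_forall fun x => ?_)
      have hpi : (Real.pi : ℂ) ≠ 0 := by exact_mod_cast Real.pi_ne_zero
      simp only [smul_eq_mul, inner_smul_right]
      congr 2
      push_cast
      field_simp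
    have h2 : starRingEnd ℂ (𝓕 f ((2 * Real.pi)⁻¹ • (ω : E3))) =
        ∫ x, Complex.exp (Complex.I * ((inner ℝ x (ω : E3) : ℝ) : ℂ)) * starRingEnd ℂ (f x) := by
      rw [h1, ← integral_conj]
      refine integral_congr_ae (Eventually.of_forall fun x => ?_)
      simp [← Complex.exp_conj]
    have h3 : ((‖𝓕 f ((2 * Real.pi)⁻¹ • (ω : E3))‖ ^ 2 : ℝ) : ℂ) =
        starRingEnd ℂ (𝓕 f ((2 * Real.pi)⁻¹ • (ω : E3))) * 𝓕 f ((2 * Real.pi)⁻¹ • (ω : E3)) := by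
      rw [Complex.conj_mul']; push_cast; rfl
    rw [h3, h2, h1, ← integral_prod_mul]
    refine integral_congr_ae (Eventually.of_forall fun p => ?_)
    simp only [inner_sub_left]
    rw [show Complex.I * ((inner ℝ p.1 (ω : E3) - inner ℝ p.2 (ω : E3) : ℝ) : ℂ) =
      Complex.I * ((inner ℝ p.1 (ω : E3) : ℝ) : ℂ) + -(Complex.I * ((inner ℝ p.2 (ω : E3) : ℝ) : ℂ)) by
        push_cast; ring, Complex.exp_add]
    ring
  rw [← integral_complex_ofReal]
  simp only [hF]
  have hmeas : AEStronglyMeasurable (fun w : S2 × (E3 × E3) => starRingEnd ℂ (f w.2.1) * f w.2.2 *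
      Complex.exp (Complex.I * ((inner ℝ (w.2.1 - w.2.2) (w.1 : E3) : ℝ) : ℂ)))
      (sphereMeasure.prod ((volume : Measure E3).prod volume)) := by
    have h1 : AEStronglyMeasurable (fun p : E3 × E3 => starRingEnd ℂ (f p.1) * f p.2)
        ((volume : Measure E3).prod volume) :=
      (Complex.continuous_conj.comp_aestronglyMeasurable hf.1.comp_fst).mul hf.1.comp_snd
    exact h1.comp_snd.mul (Continuous.aestronglyMeasurable (by fun_prop))
  have hint : Integrable (fun w : S2 × (E3 × E3) => starRingEnd ℂ (f w.2.1) * f w.2.2 *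
      Complex.exp (Complex.I * ((inner ℝ (w.2.1 - w.2.2) (w.1 : E3) : ℝ) : ℂ)))
      (sphereMeasure.prod ((volume : Measure E3).prod volume)) := by
    refine ((integrable_const (1 : ℝ)).mul_prod (hf.norm.mul_prod hf.norm)).mono' hmeas
      (Eventually.of_forall fun w => ?_)
    rw [norm_mul, norm_mul, RCLike.norm_conj, mul_comm Complex.I, Complex.norm_exp_ofReal_mul_I,
      mul_one, one_mul]
  rw [integral_integral_swap (f := fun (ω : S2) (p : E3 × E3) => starRingEnd ℂ (f p.1) * f p.2 *
    Complex.exp (Complex.I * ((inner ℝ (p.1 - p.2) (ω : E3) : ℝ) : ℂ))) hint, kernelForm,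
    Measure.volume_eq_prod, ← integral_const_mul]
  refine integral_congr_ae ?_
  -- The kernel identity fails on the diagonal, which is a null set.
  have hae : ∀ᵐ p ∂((volume : Measure E3).prod volume), p.1 - p.2 ≠ 0 :=
    (quasiMeasurePreserving_sub (volume : Measure E3) volume).ae (Measure.ae_ne volume (0 : E3))
  filter_upwards [hae] with p hp
  rw [integral_const_mul]
  change _ * sphereWave (p.1 - p.2) = _
  rw [imKernel_one_eq hp]
  ring

/-! ### Dyadic decomposition of the difference kernel -/

/-- The difference quotient of the imaginary kernels, cut off to a shell. -/
noncomputable def diffKernel (k : ℂ) (σ ε S T : ℝ) (x : E3) : ℂ :=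
  (ε⁻¹ * σ : ℝ) * shellKernel k S T x + (-ε⁻¹ : ℝ) * shellKernel 1 S T x

section Diff

variable {k : ℂ} {σ ε S T : ℝ}

theorem measurable_diffKernel : Measurable (diffKernel k σ ε S T) :=
  ((measurable_shellKernel k S T).const_mul _).add ((measurable_shellKernel 1 S T).const_mul _)

theorem memLp_diffKernel (hk : 0 ≤ k.im) (p : ℝ≥0∞) : MemLp (diffKernel k σ ε S T) p :=
  ((memLp_shellKernel hk S T p).const_mul _).add ((memLp_shellKernel (by simp) S T p).const_mul _)

theorem diffKernel_of_mem {x : E3} (hx : S ≤ ‖x‖ ∧ ‖x‖ < T) :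
    diffKernel k σ ε S T x = (ε⁻¹ : ℝ) * (σ * imKernel k x - imKernel 1 x) := by
  have h : x ∈ {x : E3 | S ≤ ‖x‖ ∧ ‖x‖ < T} := hx
  rw [diffKernel, shellKernel, shellKernel, Set.indicator_of_mem h, Set.indicator_of_mem h]
  push_cast; ring

theorem diffKernel_of_notMem {x : E3} (hx : ¬(S ≤ ‖x‖ ∧ ‖x‖ < T)) :
    diffKernel k σ ε S T x = 0 := by
  have h : x ∉ {x : E3 | S ≤ ‖x‖ ∧ ‖x‖ < T} := hx
  rw [diffKernel, shellKernel, shellKernel, Set.indicator_of_notMem h, Set.indicator_of_notMem h]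
  simp

theorem norm_diff_le_one (hk : 0 ≤ k.im) (hσ : σ = 1 ∨ σ = -1) (hε : 0 < ε) (hkσ : ‖k - σ‖ ≤ ε)
    (x : E3) : ‖(ε⁻¹ : ℝ) * (σ * imKernel k x - imKernel 1 x)‖ ≤ 1 := by
  rw [norm_mul, Complex.norm_real, Real.norm_of_nonneg (by positivity), inv_mul_le_iff₀ hε, mul_one]
  exact (norm_imKernel_sub_le hk hσ x).trans hkσ

theorem norm_diffKernel_le_one (hk : 0 ≤ k.im) (hσ : σ = 1 ∨ σ = -1) (hε : 0 < ε)
    (hkσ : ‖k - σ‖ ≤ ε) (x : E3) : ‖diffKernel k σ ε S T x‖ ≤ 1 := by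
  by_cases hx : S ≤ ‖x‖ ∧ ‖x‖ < T
  · rw [diffKernel_of_mem hx]; exact norm_diff_le_one hk hσ hε hkσ x
  · rw [diffKernel_of_notMem hx]; simp

/-- Far out no cancellation is used: each kernel is at most 1/(4π|x|) ≤ 1/(2S). This improves on the
constant bound once S exceeds 1/ε. -/
theorem norm_diffKernel_le_inv (hk : 0 ≤ k.im) (hσ : σ = 1 ∨ σ = -1) (hε : 0 < ε) (hS : 0 < S)
    (x : E3) : ‖diffKernel k σ ε S T x‖ ≤ (ε * S)⁻¹ := by
  by_cases hx : S ≤ ‖x‖ ∧ ‖x‖ < T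
  · rw [diffKernel_of_mem hx, norm_mul, Complex.norm_real, Real.norm_of_nonneg (by positivity),
      mul_inv]
    gcongr
    refine (norm_sub_le _ _).trans ?_
    have h1 := norm_imKernel_le_div hk x
    have h2 := norm_imKernel_le_div (k := 1) (by simp) x
    have h3 : 1 / (4 * Real.pi * ‖x‖) ≤ S⁻¹ / 2 := by
      rw [one_div, show S⁻¹ / 2 = (2 * S)⁻¹ by rw [mul_inv]; ring]
      apply inv_anti₀ (by positivity)
      nlinarith [Real.pi_gt_three, hx.1]
    rw [norm_mul, Complex.norm_real, show ‖σ‖ = 1 by rcases hσ with rfl | rfl <;> simp, one_mul]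
    linarith
  · rw [diffKernel_of_notMem hx, norm_zero]; positivity

/-- Each of the two truncated kernels contributes 2T; the endpoint `k = 1` is admissible because the
shell bound needs no decay. -/
theorem norm_fourier_diffKernel_le (hk : 0 ≤ k.im) (hk1 : 1 ≤ ‖k‖) (hσ : σ = 1 ∨ σ = -1)
    (hε : 0 < ε) (hS : 0 ≤ S) (hST : S ≤ T) (ξ : E3) :
    ‖𝓕 (diffKernel k σ ε S T) ξ‖ ≤ 4 * T / ε := by
  have h := fourier_linear (integrable_shellKernel hk S T)
    (integrable_shellKernel (k := 1) (by simp) S T) (ε⁻¹ * σ : ℝ) (-ε⁻¹ : ℝ) ξ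
  have e : diffKernel k σ ε S T = fun x => ((ε⁻¹ * σ : ℝ) : ℂ) * shellKernel k S T x +
    ((-ε⁻¹ : ℝ) : ℂ) * shellKernel 1 S T x := rfl
  rw [e, h]
  refine (norm_add_le _ _).trans ?_
  have h1 := norm_fourier_shellKernel_le hk hk1 hS hST ξ
  have h2 := norm_fourier_shellKernel_le (k := 1) (by simp) (by simp) hS hST ξ
  have hσ1 : |σ| = 1 := by rcases hσ with rfl | rfl <;> simp
  rw [norm_mul, norm_mul, Complex.norm_real, Complex.norm_real, norm_mul, norm_neg, norm_inv,
    Real.norm_of_nonneg hε.le, Real.norm_eq_abs, hσ1, mul_one, ← mul_add, div_eq_inv_mul]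
  gcongr
  linarith

theorem diffKernel_add_shell (hS : S ≤ T) (x : E3) :
    diffKernel k σ ε 0 T x = 1 * diffKernel k σ ε 0 S x + 1 * diffKernel k σ ε S T x := by
  have h0 := norm_nonneg x
  by_cases h1 : ‖x‖ < S
  · rw [diffKernel_of_mem ⟨h0, h1.trans_le hS⟩, diffKernel_of_mem ⟨h0, h1⟩,
      diffKernel_of_notMem (fun h => absurd h.1 (not_le.2 h1))]
    ring
  · by_cases h2 : ‖x‖ < T
    · rw [diffKernel_of_mem ⟨h0, h2⟩, diffKernel_of_notMem (fun h => h1 h.2),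
        diffKernel_of_mem ⟨not_lt.1 h1, h2⟩]
      ring
    · rw [diffKernel_of_notMem (fun h => h2 h.2), diffKernel_of_notMem (fun h => h1 h.2),
        diffKernel_of_notMem (fun h => h2 h.2)]
      ring

variable {p : ℝ} {f : E3 → ℂ}

/-- The bound of a dyadic piece. -/
theorem norm_kernelForm_diffKernel_dyadic (hk : 0 ≤ k.im) (hk1 : 1 ≤ ‖k‖) (hσ : σ = 1 ∨ σ = -1)
    (hε : 0 < ε) (hp1 : 1 ≤ p) (hp2 : p < 2) (hf : Measurable f)
    (hf1 : Integrable f) (hf2 : MemLp f 2) (hfp : Integrable fun x => ‖f x‖ ^ p)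
    (j : ℕ) (hS : 0 ≤ S) (hST : S ≤ 2 ^ j / ε)
    (hA : ∀ x, ‖diffKernel k σ ε S (2 ^ j / ε) x‖ ≤ 2 / 2 ^ j) :
    ‖kernelForm (diffKernel k σ ε S (2 ^ j / ε)) f f‖ ≤
      32 * (ε ^ (-(2 - 2 / p)) * (∫ x, ‖f x‖ ^ p) ^ (1 / p)) ^ 2 * (2 ^ (3 - 4 / p)) ^ j := by
  have hp0 : 0 < p := by linarith
  have hF0 : 0 ≤ ∫ x, ‖f x‖ ^ p := integral_nonneg fun x => by positivity
  have h := norm_kernelForm_self_le (A₀ := 2 / 2 ^ j) (A₁ := 4 * (2 ^ j / ε) / ε) hp1 hp2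
    measurable_diffKernel (memLp_one_iff_integrable.1 (memLp_diffKernel hk 1))
    (memLp_diffKernel hk 2) hf hf1 hf2 hfp (by positivity) (by positivity) hA
    (norm_fourier_diffKernel_le hk hk1 hσ hε hS hST)
  refine h.trans ?_
  -- The two factors carry 2^{j(1 - 2/p)} from decay and 2^{j(2 - 2/p)} from the symbol, whose
  -- product is the ratio 2^{3 - 4/p}; numerical constants are enlarged freely.
  have e1 : (2 / 2 ^ j : ℝ) ^ (2 / p - 1) ≤ 2 * (2 ^ (1 - 2 / p)) ^ j := by
    rw [Real.div_rpow (by positivity) (by positivity), div_eq_mul_inv]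
    gcongr
    · calc (2 : ℝ) ^ (2 / p - 1) ≤ 2 ^ (1 : ℝ) := by
            refine Real.rpow_le_rpow_of_exponent_le (by norm_num) ?_
            have : 2 / p ≤ 2 := by rw [div_le_iff₀ hp0]; linarith
            linarith
        _ = 2 := Real.rpow_one 2
    · rw [← Real.rpow_neg (by positivity), ← Real.rpow_natCast, ← Real.rpow_natCast,
        ← Real.rpow_mul (by positivity), ← Real.rpow_mul (by positivity)]
      refine le_of_eq ?_
      congr 1; ring
  have e2 : (4 * (2 ^ j / ε) / ε : ℝ) ^ (2 - 2 / p) ≤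
      4 * (2 ^ (2 - 2 / p)) ^ j * (ε ^ (-(2 - 2 / p))) ^ 2 := by
    have : (4 * (2 ^ j / ε) / ε : ℝ) = 4 * 2 ^ j * (ε⁻¹ * ε⁻¹) := by field_simp
    rw [this, Real.mul_rpow (by positivity) (by positivity),
      Real.mul_rpow (by positivity) (by positivity), Real.mul_rpow (by positivity) (by positivity),
      ← sq, Real.inv_rpow hε.le, ← Real.rpow_neg hε.le]
    gcongr ?_ * ?_ * _
    · calc (4 : ℝ) ^ (2 - 2 / p) ≤ 4 ^ (1 : ℝ) := by
            refine Real.rpow_le_rpow_of_exponent_le (by norm_num) ?_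
            have : 1 ≤ 2 / p := by rw [le_div_iff₀ hp0]; linarith
            linarith
        _ = 4 := Real.rpow_one 4
    · rw [← Real.rpow_natCast, ← Real.rpow_natCast, ← Real.rpow_mul (by positivity),
        ← Real.rpow_mul (by positivity), mul_comm]
  have e3 : (∫ x, ‖f x‖ ^ p) ^ (2 / p) = ((∫ x, ‖f x‖ ^ p) ^ (1 / p)) ^ 2 := by
    rw [← Real.rpow_natCast, ← Real.rpow_mul hF0]; congr 1; push_cast; ring
  have e4 : (2 : ℝ) ^ (3 - 4 / p) = 2 ^ (1 - 2 / p) * 2 ^ (2 - 2 / p) := by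
    rw [← Real.rpow_add (by norm_num)]; congr 1; ring
  rw [e3, e4, mul_pow]
  calc 2 * (2 / 2 ^ j : ℝ) ^ (2 / p - 1) * (4 * (2 ^ j / ε) / ε) ^ (2 - 2 / p) *
        ((∫ x, ‖f x‖ ^ p) ^ (1 / p)) ^ 2
      ≤ 2 * (2 * (2 ^ (1 - 2 / p)) ^ j) * (4 * (2 ^ (2 - 2 / p)) ^ j * (ε ^ (-(2 - 2 / p))) ^ 2) *
        ((∫ x, ‖f x‖ ^ p) ^ (1 / p)) ^ 2 := by gcongr
    _ ≤ _ := by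
        have : 0 ≤ (2 ^ (1 - 2 / p) : ℝ) ^ j * (2 ^ (2 - 2 / p)) ^ j * (ε ^ (-(2 - 2 / p))) ^ 2 *
          ((∫ x, ‖f x‖ ^ p) ^ (1 / p)) ^ 2 := by positivity
        rw [mul_pow]
        linarith

/-- The kernel is cut into the ball of radius 1/ε and the shells 2^{j-1}/ε ≤ |x| < 2^j/ε. Their
forms are bounded by a geometric sequence of ratio 2^{3 - 4/p}, which is below 1 because p < 4/3. -/
theorem norm_kernelForm_diff_le (hk : 0 ≤ k.im) (hk1 : 1 ≤ ‖k‖) (hσ : σ = 1 ∨ σ = -1)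
    (hε : 0 < ε) (hkσ : ‖k - σ‖ ≤ ε) (hp1 : 1 ≤ p) (hp2 : p < 4 / 3) (hf : Measurable f)
    (hf1 : Integrable f) (hf2 : MemLp f 2) (hfp : Integrable fun x => ‖f x‖ ^ p) :
    ‖kernelForm (fun x => (ε⁻¹ : ℝ) * (σ * imKernel k x - imKernel 1 x)) f f‖ ≤
      32 / (1 - 2 ^ (3 - 4 / p)) * (ε ^ (-(2 - 2 / p)) * (∫ x, ‖f x‖ ^ p) ^ (1 / p)) ^ 2 := by
  have hp0 : 0 < p := by linarith
  set M := (ε ^ (-(2 - 2 / p)) * (∫ x, ‖f x‖ ^ p) ^ (1 / p)) ^ 2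
  set r : ℝ := 2 ^ (3 - 4 / p) with hr
  have hM : 0 ≤ M := sq_nonneg _
  have hr0 : 0 ≤ r := by positivity
  have hr1 : r < 1 := by
    refine Real.rpow_lt_one_of_one_lt_of_neg (by norm_num) ?_
    have : 3 < 4 / p := by rw [lt_div_iff₀ hp0]; linarith
    linarith
  have hpart : ∀ n : ℕ, ‖kernelForm (diffKernel k σ ε 0 (2 ^ n / ε)) f f‖ ≤
      32 * M * ∑ j ∈ Finset.range (n + 1), r ^ j := by
    intro n
    induction n with
    | zero =>
      have := norm_kernelForm_diffKernel_dyadic hk hk1 hσ hε hp1 (by linarith) hf hf1 hf2 hfp 0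
        le_rfl (by positivity) (fun x => (norm_diffKernel_le_one hk hσ hε hkσ x).trans (by norm_num))
      rw [zero_add, Finset.sum_range_one]
      exact this
    | succ n ih =>
      have hS : (0 : ℝ) < 2 ^ n / ε := by positivity
      have hST : (2 : ℝ) ^ n / ε ≤ 2 ^ (n + 1) / ε := by
        gcongr
        · norm_num
        · omega
      -- With S = 2^n/ε the decay bound (εS)⁻¹ equals 2/2^{n+1}; this is the origin of the numerator
      -- 2.
      have h1 := norm_kernelForm_diffKernel_dyadic hk hk1 hσ hε hp1 (by linarith) hf hf1 hf2 hfp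
        (n + 1) hS.le hST (fun x => (norm_diffKernel_le_inv hk hσ hε hS x).trans_eq (by
          field_simp; ring))
      have h2 : diffKernel k σ ε 0 (2 ^ (n + 1) / ε) = fun x =>
          1 * diffKernel k σ ε 0 (2 ^ n / ε) x + 1 * diffKernel k σ ε (2 ^ n / ε) (2 ^ (n + 1) / ε) x :=
        funext (diffKernel_add_shell hST)
      rw [h2, kernelForm_linear measurable_diffKernel measurable_diffKernel
        (norm_diffKernel_le_one hk hσ hε hkσ) (norm_diffKernel_le_one hk hσ hε hkσ) hf1 hf1,
        one_mul, one_mul, Finset.sum_range_succ, mul_add]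
      exact (norm_add_le _ _).trans (add_le_add ih h1)
  have hbound : ∀ n : ℕ, ‖kernelForm (diffKernel k σ ε 0 (2 ^ n / ε)) f f‖ ≤ 32 / (1 - r) * M := by
    intro n
    refine (hpart n).trans ?_
    have : ∑ j ∈ Finset.range (n + 1), r ^ j ≤ (1 - r)⁻¹ := by
      rw [← tsum_geometric_of_lt_one hr0 hr1]
      exact (summable_geometric_of_lt_one hr0 hr1).sum_le_tsum _ (fun i _ => by positivity)
    calc 32 * M * ∑ j ∈ Finset.range (n + 1), r ^ j ≤ 32 * M * (1 - r)⁻¹ := by gcongr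
      _ = _ := by ring
  suffices hlim : Tendsto (fun n : ℕ => kernelForm (diffKernel k σ ε 0 (2 ^ n / ε)) f f) atTop
      (𝓝 (kernelForm (fun x => (ε⁻¹ : ℝ) * (σ * imKernel k x - imKernel 1 x)) f f)) by
    exact le_of_tendsto hlim.norm (Eventually.of_forall hbound)
  unfold kernelForm
  rw [Measure.volume_eq_prod]
  -- At each fixed pair of points the truncated kernel is eventually the full one.
  refine tendsto_integral_of_dominated_convergence
    (fun q : E3 × E3 => ‖f q.1‖ * ‖f q.2‖) (fun n => aestronglyMeasurable_kernelForm
      measurable_diffKernel.aestronglyMeasurable hf1.1 hf1.1) (hf1.norm.mul_prod hf1.norm)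
    (fun n => Eventually.of_forall fun q => ?_) (Eventually.of_forall fun q => ?_)
  · rw [norm_mul, norm_mul, RCLike.norm_conj]
    exact mul_le_of_le_one_right (by positivity) (norm_diffKernel_le_one hk hσ hε hkσ _)
  · refine tendsto_const_nhds.congr' ?_
    have : Tendsto (fun n : ℕ => (2 : ℝ) ^ n / ε) atTop atTop :=
      (tendsto_pow_atTop_atTop_of_one_lt (by norm_num)).atTop_div_const hε
    filter_upwards [this.eventually_gt_atTop ‖q.1 - q.2‖] with n hn
    rw [diffKernel_of_mem ⟨norm_nonneg _, hn⟩]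

end Diff

/-! ### Blow-up rate of the unweighted L² norm -/

/-- The `L²` bound for the resolvent at distance `ε` from the spectrum. -/
theorem integral_sq_resolvent_le {p : ℝ} (hp1 : 1 ≤ p) (hp2 : p < 4 / 3) {z : ℂ} (hz : z.re = 1)
    (hz0 : z.im ≠ 0) {f : E3 → ℂ} (hf : Measurable f) (hf1 : Integrable f) (hf2 : MemLp f 2)
    (hfp : Integrable fun x => ‖f x‖ ^ p) :
    ∫ x, ‖conv (freeResolventKernel z) f x‖ ^ 2 ≤
      32 / (1 - 2 ^ (3 - 4 / p)) * (|z.im| ^ (-(2 - 2 / p)) * (∫ x, ‖f x‖ ^ p) ^ (1 / p)) ^ 2 +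
      |z.im|⁻¹ * ∫ ω : S2, ‖𝓕 f ((2 * Real.pi)⁻¹ • (ω : E3))‖ ^ 2 ∂sphereMeasure := by
  have hk := upperSqrt_im_pos hz0
  have hk1 := one_le_norm_upperSqrt hz
  have hsq := upperSqrt_sq z
  change ∫ x, ‖conv (waveKernel (upperSqrt z)) f x‖ ^ 2 ≤ _
  obtain ⟨σ, hσ, hσz⟩ : ∃ σ : ℝ, (σ = 1 ∨ σ = -1) ∧ σ * z.im = |z.im| := by
    rcases lt_or_gt_of_ne hz0 with h | h
    · exact ⟨-1, Or.inr rfl, by rw [abs_of_neg h]; ring⟩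
    · exact ⟨1, Or.inl rfl, by rw [abs_of_pos h]; ring⟩
  have hε : 0 < |z.im| := abs_pos.2 hz0
  have hkσ := norm_upperSqrt_sub_le hz hσ (hσz ▸ hε)
  set k := upperSqrt z
  set ε := |z.im|
  set N := ∫ ω : S2, ‖𝓕 f ((2 * Real.pi)⁻¹ • (ω : E3))‖ ^ 2 ∂sphereMeasure
  have hN0 : 0 ≤ N := integral_nonneg fun ω => by positivity
  have hU := im_mul_integral_sq_fourier hk hf1 hf2
  have hN : (N : ℂ) = _ := integral_sphere_norm_sq hf1
  have hdiff := norm_kernelForm_diff_le hk.le hk1 hσ hε hkσ hp1 hp2 hf hf1 hf2 hfp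
  rw [integral_sq_conv_waveKernel hk hf1 hf2]
  set U := ∫ ξ, (‖𝓕 (waveKernel k) ξ‖ * ‖𝓕 f ξ‖) ^ 2
  -- Dividing the energy identity by |Im z| gives ‖R₀(z)f‖² from the first kernel; the kernel at 1
  -- gives ε⁻¹ times the sphere term.
  have hlin : kernelForm (fun x => (ε⁻¹ : ℝ) * (σ * imKernel k x - imKernel 1 x)) f f =
      ((U - ε⁻¹ * (N / (16 * Real.pi ^ 2)) : ℝ) : ℂ) := by
    have h1 : (fun x => ((ε⁻¹ : ℝ) : ℂ) * (σ * imKernel k x - imKernel 1 x)) =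
        fun x => ((ε⁻¹ * σ : ℝ) : ℂ) * imKernel k x + ((-ε⁻¹ : ℝ) : ℂ) * imKernel 1 x := by
      ext x; push_cast; ring
    have hB1 : ∀ x, ‖imKernel 1 x‖ ≤ ‖k - 1‖ + 1 := fun x => by
      have := norm_imKernel_le (k := 1) (by simp) x
      simp only [sub_self, norm_zero, zero_add] at this
      linarith [norm_nonneg (k - 1)]
    rw [h1, kernelForm_linear (measurable_imKernel k) (measurable_imKernel 1)
      (norm_imKernel_le hk.le) hB1 hf1 hf1, ← hU, hsq]
    have h2 : kernelForm (imKernel 1) f f = ((N / (16 * Real.pi ^ 2) : ℝ) : ℂ) := by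
      have hpi : ((16 * Real.pi ^ 2 : ℝ) : ℂ) ≠ 0 := by
        have := Real.pi_pos
        exact_mod_cast (by positivity : (16 * Real.pi ^ 2 : ℝ) ≠ 0)
      rw [Complex.ofReal_div, hN, mul_div_cancel_left₀ _ hpi]
    rw [h2, ← Complex.ofReal_mul, ← Complex.ofReal_mul, ← Complex.ofReal_add]
    congr 1
    have : ε⁻¹ * σ * (z.im * U) = U := by
      calc ε⁻¹ * σ * (z.im * U) = ε⁻¹ * (σ * z.im) * U := by ring
        _ = U := by rw [hσz, inv_mul_cancel₀ hε.ne', one_mul]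
    rw [this]; ring
  rw [hlin, Complex.norm_real] at hdiff
  have h3 := (le_abs_self _).trans hdiff
  have h4 : N / (16 * Real.pi ^ 2) ≤ N := div_le_self hN0 (by nlinarith [Real.pi_gt_three])
  have h5 : ε⁻¹ * (N / (16 * Real.pi ^ 2)) ≤ ε⁻¹ * N := by gcongr
  linarith

/-! ### Local and global bounds for differences of resolvents -/

theorem stronglyMeasurable_conv {K f : E3 → ℂ} (hK : Measurable K) (hf : Measurable f) :
    StronglyMeasurable (conv K f) := by
  have : Measurable fun q : E3 × E3 => K (q.1 - q.2) * f q.2 :=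
    (hK.comp (measurable_fst.sub measurable_snd)).mul (hf.comp measurable_snd)
  exact this.stronglyMeasurable.integral_prod_right (ν := volume)

/-- Localized `L²` bound for the adjoint resolvent. -/
theorem integral_sq_fourier_mul_le_of_support {k : ℂ} (hk : 0 < k.im) (hk1 : 1 ≤ ‖k‖) {g : E3 → ℂ}
    {R : ℝ} (hR : 0 < R) (hg1 : Integrable g) (hg2 : MemLp g 2) (hgR : ∀ x, R ≤ ‖x‖ → g x = 0) :
    |(k ^ 2).im| * ∫ ξ, (‖𝓕 (waveKernel k) ξ‖ * ‖𝓕 g ξ‖) ^ 2 ≤ 4 * R * ∫ x, ‖g x‖ ^ 2 := by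
  have h := congrArg norm (im_mul_integral_sq_fourier hk hg1 hg2)
  have hnn : 0 ≤ ∫ ξ, (‖𝓕 (waveKernel k) ξ‖ * ‖𝓕 g ξ‖) ^ 2 := integral_nonneg fun ξ => by positivity
  rw [Complex.norm_real, norm_mul, Real.norm_of_nonneg hnn, Real.norm_eq_abs] at h
  rw [h]
  -- Two points of the ball of radius R are less than 2R apart, so the kernel may be truncated there
  -- and the bound linear in the radius becomes 4R.
  have hcut : kernelForm (imKernel k) g g = kernelForm (shellKernel k 0 (2 * R)) g g := by
    refine integral_congr_ae (Eventually.of_forall fun q => ?_)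
    simp only
    by_cases h1 : R ≤ ‖q.1‖
    · simp [hgR _ h1]
    by_cases h2 : R ≤ ‖q.2‖
    · simp [hgR _ h2]
    push Not at h1 h2
    rw [shellKernel, Set.indicator_of_mem]
    exact ⟨norm_nonneg _, (norm_sub_le _ _).trans_lt (by linarith)⟩
  rw [hcut]
  have := norm_kernelForm_le (integrable_shellKernel hk.le 0 (2 * R)) (memLp_shellKernel hk.le 0 (2 * R) 2)
    hg1 hg2 hg1 hg2 (norm_fourier_shellKernel_le hk.le hk1 le_rfl (by positivity)) one_pos
  refine this.trans_eq ?_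
  rw [inv_one]; ring

section ResolventDifference

variable {z z' : ℂ} {f : E3 → ℂ}

/-- The difference of two resolvents applied to `f`. -/
noncomputable def resolventDiff (z z' : ℂ) (f : E3 → ℂ) (x : E3) : ℂ :=
  freeResolvent z f x - freeResolvent z' f x

theorem freeResolvent_eq_conv (z : ℂ) (f : E3 → ℂ) :
    freeResolvent z f = conv (waveKernel (upperSqrt z)) f := rfl

theorem stronglyMeasurable_freeResolvent (z : ℂ) (hf : Measurable f) :
    StronglyMeasurable (freeResolvent z f) :=
  stronglyMeasurable_conv (measurable_waveKernel _) hf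

theorem integrable_freeResolvent (hz : z.im ≠ 0) (hf1 : Integrable f) :
    Integrable (freeResolvent z f) :=
  integrable_conv (integrable_waveKernel (upperSqrt_im_pos hz)) hf1

theorem memLp_freeResolvent (hz : z.im ≠ 0) (hf1 : Integrable f) (hf2 : MemLp f 2) :
    MemLp (freeResolvent z f) 2 :=
  memLp_conv (integrable_waveKernel (upperSqrt_im_pos hz)) (memLp_waveKernel (upperSqrt_im_pos hz))
    hf1 hf2

/-- The resolvent identity on the Fourier side. -/
theorem fourier_resolventDiff (hz : z.im ≠ 0) (hz' : z'.im ≠ 0) (hf1 : Integrable f) (ξ : E3) :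
    𝓕 (resolventDiff z z' f) ξ =
      (z - z') * (𝓕 (waveKernel (upperSqrt z)) ξ * 𝓕 (freeResolvent z' f) ξ) := by
  have hk := upperSqrt_im_pos hz
  have hk' := upperSqrt_im_pos hz'
  have h := fourier_linear (integrable_freeResolvent hz hf1) (integrable_freeResolvent hz' hf1) 1 (-1) ξ
  have e : resolventDiff z z' f = fun x => 1 * freeResolvent z f x + (-1) * freeResolvent z' f x := by
    ext x; simp only [resolventDiff]; ring
  rw [e, h, freeResolvent_eq_conv, freeResolvent_eq_conv,
    fourier_conv (integrable_waveKernel hk) hf1, fourier_conv (integrable_waveKernel hk') hf1,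
    fourier_waveKernel hk, fourier_waveKernel hk', upperSqrt_sq, upperSqrt_sq]
  have hne : ∀ w : ℂ, w.im ≠ 0 → ((((2 * Real.pi * ‖ξ‖) ^ 2 : ℝ) : ℂ) - w) ≠ 0 := fun w hw h0 => hw (by
    have := congrArg Complex.im h0
    simpa only [Complex.sub_im, Complex.ofReal_im, zero_sub, Complex.zero_im, neg_eq_zero] using this)
  have h1 := hne z hz
  have h2 := hne z' hz'
  generalize (((2 * Real.pi * ‖ξ‖) ^ 2 : ℝ) : ℂ) = s at h1 h2 ⊢
  field_simp
  ring

theorem integrable_resolventDiff (hz : z.im ≠ 0) (hz' : z'.im ≠ 0) (hf1 : Integrable f) :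
    Integrable (resolventDiff z z' f) :=
  (integrable_freeResolvent hz hf1).sub (integrable_freeResolvent hz' hf1)

theorem memLp_resolventDiff (hz : z.im ≠ 0) (hz' : z'.im ≠ 0) (hf1 : Integrable f)
    (hf2 : MemLp f 2) : MemLp (resolventDiff z z' f) 2 :=
  (memLp_freeResolvent hz hf1 hf2).sub (memLp_freeResolvent hz' hf1 hf2)

/-- The Fourier multiplier (z - z')/(|ξ|² - z) taking R₀(z')f to the difference has modulus at most
1, since |z - z'| ≤ |Im z|. -/
theorem integral_sq_resolventDiff_le (hz : z.im ≠ 0) (hz' : z'.im ≠ 0) (hzz : ‖z - z'‖ ≤ |z.im|)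
    (hf1 : Integrable f) (hf2 : MemLp f 2) :
    ∫ x, ‖resolventDiff z z' f x‖ ^ 2 ≤ ∫ x, ‖freeResolvent z' f x‖ ^ 2 := by
  have hk := upperSqrt_im_pos hz
  have m1 := memLp_fourier (integrable_resolventDiff hz hz' hf1) (memLp_resolventDiff hz hz' hf1 hf2)
  have m2 := memLp_fourier (integrable_freeResolvent hz' hf1) (memLp_freeResolvent hz' hf1 hf2)
  rw [← integral_norm_sq_fourier (integrable_resolventDiff hz hz' hf1)
    (memLp_resolventDiff hz hz' hf1 hf2), ← integral_norm_sq_fourier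
    (integrable_freeResolvent hz' hf1) (memLp_freeResolvent hz' hf1 hf2)]
  refine integral_mono ((memLp_two_iff_integrable_sq_norm m1.1).1 m1)
    ((memLp_two_iff_integrable_sq_norm m2.1).1 m2) fun ξ => ?_
  simp only
  gcongr
  rw [fourier_resolventDiff hz hz' hf1, norm_mul, norm_mul, ← mul_assoc]
  have h := norm_fourier_waveKernel_le hk (by rwa [upperSqrt_sq]) ξ
  rw [upperSqrt_sq] at h
  refine mul_le_of_le_one_left (norm_nonneg _) ?_
  calc ‖z - z'‖ * ‖𝓕 (waveKernel (upperSqrt z)) ξ‖ ≤ |z.im| * |z.im|⁻¹ := by gcongr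
    _ = 1 := mul_inv_cancel₀ (abs_ne_zero.2 hz)

/-- Duality: the difference is tested against its own restriction g to the ball. Moving R₀(z) onto g
brings in the localized bound ‖R₀(z)g‖² ≤ (4R/|Im z|)‖g‖². -/
theorem setIntegral_ball_sq_resolventDiff_le (hre : z.re = 1) (hz : z.im ≠ 0) (hz' : z'.im ≠ 0)
    (hzz : ‖z - z'‖ ≤ |z.im|) (hf1 : Integrable f) (hf2 : MemLp f 2) {R : ℝ} (hR : 0 < R) :
    ∫ x in Metric.ball (0 : E3) R, ‖resolventDiff z z' f x‖ ^ 2 ≤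
      4 * R * |z.im| * ∫ x, ‖freeResolvent z' f x‖ ^ 2 := by
  have hk := upperSqrt_im_pos hz
  have hk1 := one_le_norm_upperSqrt hre
  have hD1 := integrable_resolventDiff hz hz' hf1
  have hD2 := memLp_resolventDiff hz hz' hf1 hf2
  have hu1 := integrable_freeResolvent hz' hf1
  have hu2 := memLp_freeResolvent hz' hf1 hf2
  set D := resolventDiff z z' f
  set g : E3 → ℂ := (Metric.ball (0 : E3) R).indicator D with hg
  have hg1 : Integrable g := hD1.indicator measurableSet_ball
  have hg2 : MemLp g 2 := hD2.indicator measurableSet_ball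
  have hgR : ∀ x, R ≤ ‖x‖ → g x = 0 := fun x hx =>
    Set.indicator_of_notMem (by rw [mem_ball_zero_iff]; exact not_lt.2 hx) _
  have hε : 0 < |z.im| := abs_pos.2 hz
  have hX := integral_sq_fourier_mul_le_of_support hk hk1 hR hg1 hg2 hgR
  rw [upperSqrt_sq] at hX
  have hG : ∫ x in Metric.ball (0 : E3) R, ‖D x‖ ^ 2 = ∫ x, ‖g x‖ ^ 2 := by
    rw [← integral_indicator measurableSet_ball]
    refine integral_congr_ae (Eventually.of_forall fun x => ?_)
    by_cases hx : x ∈ Metric.ball (0 : E3) R <;> simp [hg, hx]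
  rw [hG]
  set G := ∫ x, ‖g x‖ ^ 2
  set U := ∫ x, ‖freeResolvent z' f x‖ ^ 2 with hU
  have hpair : (G : ℂ) = ∫ ξ, starRingEnd ℂ (𝓕 g ξ) * 𝓕 D ξ := by
    rw [integral_conj_fourier_mul_fourier hg1 hg2 hD1 hD2, ← integral_complex_ofReal]
    refine integral_congr_ae (Eventually.of_forall fun x => ?_)
    by_cases hx : x ∈ Metric.ball (0 : E3) R
    · simp only [hg, Set.indicator_of_mem hx, Complex.conj_mul']; push_cast; rfl
    · simp [hg, hx]
  have mg := memLp_fourier hg1 hg2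
  have mu := memLp_fourier hu1 hu2
  have hgi := (memLp_two_iff_integrable_sq_norm mg.1).1 mg
  have hui := (memLp_two_iff_integrable_sq_norm mu.1).1 mu
  have hKg : Integrable (fun ξ => (‖𝓕 (waveKernel (upperSqrt z)) ξ‖ * ‖𝓕 g ξ‖) ^ 2) := by
    have hm : AEStronglyMeasurable (𝓕 (waveKernel (upperSqrt z))) volume :=
      (memLp_fourier (integrable_waveKernel hk) (memLp_waveKernel hk)).1
    refine (hgi.const_mul ((|z.im|⁻¹) ^ 2)).mono' ((hm.norm.mul mg.1.norm).pow 2)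
      (Eventually.of_forall fun ξ => ?_)
    rw [Real.norm_of_nonneg (by positivity), mul_pow]
    have h := norm_fourier_waveKernel_le hk (by rwa [upperSqrt_sq]) ξ
    rw [upperSqrt_sq] at h
    gcongr
  have hR4 : 0 < 4 * R := by positivity
  -- The parameter 4R in ab ≤ ((4R)⁻¹a² + 4Rb²)/2 makes the term with g exactly half of `G`, which
  -- is then absorbed on the left.
  have hGle : G ≤ |z.im| / 2 * ((4 * R)⁻¹ * (∫ ξ, (‖𝓕 (waveKernel (upperSqrt z)) ξ‖ * ‖𝓕 g ξ‖) ^ 2) +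
      4 * R * U) := by
    have hG0 : 0 ≤ G := integral_nonneg fun x => by positivity
    rw [hU, ← integral_norm_sq_fourier hu1 hu2, ← integral_const_mul, ← integral_const_mul,
      ← integral_add (hKg.const_mul _) (hui.const_mul _), ← integral_const_mul]
    rw [← Real.norm_of_nonneg hG0, ← Complex.norm_real, hpair]
    refine norm_integral_le_of_norm_le (((hKg.const_mul _).add (hui.const_mul _)).const_mul _)
      (Eventually.of_forall fun ξ => ?_)
    rw [norm_mul, RCLike.norm_conj, fourier_resolventDiff hz hz' hf1, norm_mul, norm_mul]
    set a := ‖𝓕 (waveKernel (upperSqrt z)) ξ‖ * ‖𝓕 g ξ‖ with ha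
    set b := ‖𝓕 (freeResolvent z' f) ξ‖
    have hab : 2 * (a * b) ≤ (4 * R)⁻¹ * a ^ 2 + 4 * R * b ^ 2 := by
      have e : (4 * R)⁻¹ * a ^ 2 + 4 * R * b ^ 2 - 2 * (a * b) = (4 * R)⁻¹ * (a - 4 * R * b) ^ 2 := by
        field_simp; ring
      have := mul_nonneg (inv_nonneg.2 hR4.le) (sq_nonneg (a - 4 * R * b))
      linarith
    have ha0 : 0 ≤ a := by positivity
    have hb0 : 0 ≤ b := norm_nonneg _
    calc ‖𝓕 g ξ‖ * (‖z - z'‖ * (‖𝓕 (waveKernel (upperSqrt z)) ξ‖ * b)) = ‖z - z'‖ * (a * b) := by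
          rw [ha]; ring
      _ ≤ |z.im| * (a * b) := by gcongr
      _ ≤ _ := by
        have := mul_le_mul_of_nonneg_left hab hε.le
        linarith
  have h2 : |z.im| / 2 * ((4 * R)⁻¹ * (∫ ξ, (‖𝓕 (waveKernel (upperSqrt z)) ξ‖ * ‖𝓕 g ξ‖) ^ 2)) ≤ G / 2 := by
    calc |z.im| / 2 * ((4 * R)⁻¹ * (∫ ξ, (‖𝓕 (waveKernel (upperSqrt z)) ξ‖ * ‖𝓕 g ξ‖) ^ 2))
        = (4 * R)⁻¹ / 2 * (|z.im| * ∫ ξ, (‖𝓕 (waveKernel (upperSqrt z)) ξ‖ * ‖𝓕 g ξ‖) ^ 2) := by ring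
      _ ≤ (4 * R)⁻¹ / 2 * (4 * R * G) := by gcongr
      _ = G / 2 := by field_simp
  rw [mul_add] at hGle
  linarith

/-- The weighted bound for a resolvent difference. -/
theorem integral_weight_sq_resolventDiff_le (hre : z.re = 1) (hz : z.im ≠ 0) (hz' : z'.im ≠ 0)
    (hzz : ‖z - z'‖ ≤ |z.im|) (hf : Measurable f) (hf1 : Integrable f) (hf2 : MemLp f 2) {η η' : ℝ}
    (hη'0 : 0 < η') (hη'2 : η' ≤ 1 / 2) (hη : η' < η) :
    ∫ x, ‖resolventDiff z z' f x‖ ^ 2 * (1 + ‖x‖) ^ (-(2 * η)) ≤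
      4 * (η / (η - η')) * |z.im| ^ (2 * η') * ∫ x, ‖freeResolvent z' f x‖ ^ 2 := by
  have hε : 0 < |z.im| := abs_pos.2 hz
  have hη0 : 0 < η := hη'0.trans hη
  have hD2 := memLp_resolventDiff hz hz' hf1 hf2
  have hDm : Measurable (resolventDiff z z' f) :=
    ((stronglyMeasurable_freeResolvent z hf).sub (stronglyMeasurable_freeResolvent z' hf)).measurable
  have hDi := (memLp_two_iff_integrable_sq_norm hD2.1).1 hD2
  have htot := integral_sq_resolventDiff_le hz hz' hzz hf1 hf2
  have hloc : ∀ R : ℝ, 0 < R → ∫ x in Metric.ball (0 : E3) R, ‖resolventDiff z z' f x‖ ^ 2 ≤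
      4 * R * |z.im| * ∫ x, ‖freeResolvent z' f x‖ ^ 2 := fun R hR =>
    setIntegral_ball_sq_resolventDiff_le hre hz hz' hzz hf1 hf2 (R := R) hR
  set D := resolventDiff z z' f
  set U := ∫ x, ‖freeResolvent z' f x‖ ^ 2
  have hU0 : 0 ≤ U := integral_nonneg fun x => by positivity
  -- The layer-cake exponent is 2 - 2η, so that its power p - 2 is the squared weight -2η.
  have hp : 2 - 2 * η < 2 := by linarith
  have hexp : 2 - 2 * η - 2 = -(2 * η) := by ring
  have hm : Measurable fun x : E3 => 1 + ‖x‖ := measurable_norm.const_add 1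
  have hψ : Measurable fun x : E3 => ‖D x‖ ^ 2 := hDm.norm.pow_const 2
  have hpos : ∀ x : E3, 0 < 1 + ‖x‖ := fun x => by positivity
  have hwi : Integrable fun x => ‖D x‖ ^ 2 * (1 + ‖x‖) ^ (2 - 2 * η - 2) := by
    refine hDi.mono' (hψ.mul (hm.pow_const _)).aestronglyMeasurable (Eventually.of_forall fun x => ?_)
    have := hpos x
    rw [Real.norm_of_nonneg (by positivity)]
    refine mul_le_of_le_one_right (by positivity) ?_
    exact Real.rpow_le_one_of_one_le_of_nonpos (by simp) (by linarith)
  have hlay := integrable_layer (μ := (volume : Measure E3)) hp (θ := fun x => 1 + ‖x‖)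
    (ψ := fun x => ‖D x‖ ^ 2) hm hψ (fun x => by positivity) (fun x _ => hpos x) hwi
  have hswap : ∫ x, ‖D x‖ ^ 2 * (1 + ‖x‖) ^ (-(2 * η)) = 2 * η *
      ∫ t in Set.Ioi (0 : ℝ), t ^ (2 - 2 * η - 3) * ∫ x, if 1 + ‖x‖ < t then ‖D x‖ ^ 2 else 0 := by
    simp only [← integral_const_mul (_ ^ (2 - 2 * η - 3))]
    rw [← integral_integral_swap (f := fun (x : E3) (t : ℝ) => t ^ (2 - 2 * η - 3) *
      (if 1 + ‖x‖ < t then ‖D x‖ ^ 2 else 0)) hlay]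
    simp only [integral_rpow_mul_layer hp (fun _ => hpos _), hexp, integral_div]
    rw [show 2 - (2 - 2 * η) = 2 * η by ring, mul_div_cancel₀ _ (by positivity)]
  rw [hswap]
  -- The global and local bounds combine to min(1, 4t|Im z|), which is at most the power 2η' of its
  -- second argument because 0 ≤ 2η' ≤ 1. Nothing contributes for t ≤ 1.
  have hinner : ∀ t : ℝ, 0 < t → ∫ x, (if 1 + ‖x‖ < t then ‖D x‖ ^ 2 else 0) ≤
      (4 * t * |z.im|) ^ (2 * η') * (if 1 < t then U else 0) := by
    intro t ht
    by_cases h1 : 1 < t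
    · rw [if_pos h1]
      have hy : 0 < 4 * t * |z.im| := by positivity
      have hmin : ∫ x, (if 1 + ‖x‖ < t then ‖D x‖ ^ 2 else 0) ≤ min 1 (4 * t * |z.im|) * U := by
        rw [min_mul_of_nonneg _ _ hU0, one_mul]
        have hi : Integrable (fun x => if 1 + ‖x‖ < t then ‖D x‖ ^ 2 else 0) := by
          refine hDi.mono' (Measurable.ite (measurableSet_lt hm measurable_const) hψ
            measurable_const).aestronglyMeasurable (Eventually.of_forall fun x => ?_)
          split_ifs <;> simp
        refine le_min ((integral_mono hi hDi fun x => ?_).trans htot) ?_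
        · simp only; split_ifs
          · exact le_rfl
          · positivity
        · refine le_trans ?_ (hloc t ht)
          rw [← integral_indicator measurableSet_ball]
          refine integral_mono hi (hDi.indicator measurableSet_ball) fun x => ?_
          simp only
          split_ifs with hx
          · rw [Set.indicator_of_mem]
            rw [mem_ball_zero_iff]; linarith
          · exact Set.indicator_nonneg (fun x _ => by positivity) _
      refine hmin.trans ?_
      gcongr
      rcases le_total 1 (4 * t * |z.im|) with h | h
      · exact (min_le_left _ _).trans (Real.one_le_rpow h (by positivity))
      · refine (min_le_right _ _).trans ?_
        calc 4 * t * |z.im| = (4 * t * |z.im|) ^ (1 : ℝ) := (Real.rpow_one _).symm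
          _ ≤ _ := Real.rpow_le_rpow_of_exponent_ge hy h (by linarith)
    · rw [if_neg h1, mul_zero]
      refine le_of_eq (integral_eq_zero_of_ae (Eventually.of_forall fun x => if_neg ?_))
      have := norm_nonneg x
      intro h; linarith
  -- After inserting t^{2η'} the tail over t > 1 converges because η' < η; its value is 1/(2(η -
  -- η')).
  set r := 2 - 2 * (η - η')
  have hr : r < 2 := by simp only [r]; linarith
  have hLi : IntegrableOn (fun t : ℝ => t ^ (2 - 2 * η - 3) *
      ∫ x, if 1 + ‖x‖ < t then ‖D x‖ ^ 2 else 0) (Set.Ioi 0) := by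
    simp only [← integral_const_mul]
    exact hlay.integral_prod_right
  have htail := (integrableOn_rpow_tail hr one_pos).const_mul ((4 * |z.im|) ^ (2 * η') * U)
  have hle : ∫ t in Set.Ioi (0 : ℝ), t ^ (2 - 2 * η - 3) *
      (∫ x, if 1 + ‖x‖ < t then ‖D x‖ ^ 2 else 0) ≤
      (4 * |z.im|) ^ (2 * η') * U * ((2 * (η - η'))⁻¹) := by
    have : (2 * (η - η'))⁻¹ = ∫ t in Set.Ioi (0 : ℝ), t ^ (r - 3) * (if 1 < t then 1 else 0) := by
      rw [integral_rpow_tail hr one_pos, Real.one_rpow, one_div]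
      simp only [r]; congr 1; ring
    rw [this, ← integral_const_mul]
    refine setIntegral_mono_on hLi htail measurableSet_Ioi fun t (ht : 0 < t) => ?_
    refine (mul_le_mul_of_nonneg_left (hinner t ht) (by positivity)).trans_eq ?_
    have e1 : t ^ (r - 3) = t ^ (2 - 2 * η - 3) * t ^ (2 * η') := by
      rw [← Real.rpow_add ht]; simp only [r]; congr 1; ring
    rw [show 4 * t * |z.im| = t * (4 * |z.im|) by ring,
      Real.mul_rpow ht.le (by positivity), e1]
    split_ifs <;> ring
  have h4 : (4 : ℝ) ^ (2 * η') ≤ 4 := by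
    calc (4 : ℝ) ^ (2 * η') ≤ 4 ^ (1 : ℝ) := Real.rpow_le_rpow_of_exponent_le (by norm_num) (by linarith)
      _ = 4 := Real.rpow_one _
  have hd : 0 < η - η' := sub_pos.2 hη
  calc _ ≤ 2 * η * ((4 * |z.im|) ^ (2 * η') * U * ((2 * (η - η'))⁻¹)) := by gcongr
    _ = 4 ^ (2 * η') * (η / (η - η')) * |z.im| ^ (2 * η') * U := by
      rw [Real.mul_rpow (by norm_num) hε.le]; field_simp
    _ ≤ _ := by gcongr

end ResolventDifference

/-! ### Weighted norms and summation over dyadic distances to the spectrum -/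

theorem eLpNorm_two_le_ofReal {α : Type*} [MeasurableSpace α] {μ : Measure α} {g : α → ℂ}
    (hg : AEStronglyMeasurable g μ) (hgi : Integrable (fun x => ‖g x‖ ^ 2) μ) {B : ℝ} (hB : 0 ≤ B)
    (h : ∫ x, ‖g x‖ ^ 2 ∂μ ≤ B ^ 2) : eLpNorm g 2 μ ≤ ENNReal.ofReal B := by
  have hm : MemLp g 2 μ := (memLp_two_iff_integrable_sq_norm hg).2 hgi
  rw [hm.eLpNorm_eq_integral_rpow_norm (by norm_num) (by norm_num)]
  refine ENNReal.ofReal_le_ofReal ?_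
  simp only [ENNReal.toReal_ofNat, Real.rpow_ofNat]
  rw [← one_div, ← Real.sqrt_eq_rpow]
  exact (Real.sqrt_le_sqrt h).trans_eq (Real.sqrt_sq hB)

/-- The decaying weight `(1 + |x|)^(-η)`. -/
noncomputable def weight (η : ℝ) (x : E3) : ℂ := (((1 + ‖x‖) ^ (-η) : ℝ) : ℂ)

theorem measurable_weight (η : ℝ) : Measurable (weight η) :=
  Complex.measurable_ofReal.comp ((measurable_norm.const_add 1).pow_const _)

theorem norm_weight (η : ℝ) (x : E3) : ‖weight η x‖ = (1 + ‖x‖) ^ (-η) := by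
  rw [weight, Complex.norm_real, Real.norm_of_nonneg (by positivity)]

theorem norm_weight_le_one {η : ℝ} (hη : 0 ≤ η) (x : E3) : ‖weight η x‖ ≤ 1 := by
  rw [norm_weight]
  exact Real.rpow_le_one_of_one_le_of_nonpos (by simp) (by linarith)

theorem eLpNorm_weight_mul_le {η : ℝ} (hη : 0 ≤ η) {g : E3 → ℂ} (hg : MemLp g 2) {B : ℝ}
    (hB : 0 ≤ B) (h : ∫ x, ‖g x‖ ^ 2 * (1 + ‖x‖) ^ (-(2 * η)) ≤ B ^ 2) :
    eLpNorm (fun x => weight η x * g x) 2 ≤ ENNReal.ofReal B := by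
  have hm : AEStronglyMeasurable (fun x => weight η x * g x) volume :=
    (measurable_weight η).aestronglyMeasurable.mul hg.1
  have hml : MemLp (fun x => weight η x * g x) 2 := hg.mono hm (Eventually.of_forall fun x => by
    rw [norm_mul]; exact mul_le_of_le_one_left (norm_nonneg _) (norm_weight_le_one hη x))
  refine eLpNorm_two_le_ofReal hm ((memLp_two_iff_integrable_sq_norm hm).1 hml) hB
    (le_of_eq_of_le (integral_congr_ae (Eventually.of_forall fun x => ?_)) h)
  simp only [norm_mul, norm_weight, mul_pow]
  rw [← Real.rpow_natCast ((1 + ‖x‖) ^ (-η)), ← Real.rpow_mul (by positivity), mul_comm]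
  congr 2; push_cast; ring

section Uniform

variable {p : ℝ} {f : E3 → ℂ}

/-- The `L²` norm over the unit sphere of the Fourier transform of `f`. -/
noncomputable def sphereNorm (f : E3 → ℂ) : ℝ :=
  √(∫ ω : S2, ‖𝓕 f ((2 * Real.pi)⁻¹ • (ω : E3))‖ ^ 2 ∂sphereMeasure)

theorem sphereNorm_nonneg (f : E3 → ℂ) : 0 ≤ sphereNorm f := Real.sqrt_nonneg _

/-- The sum of squares is enlarged to the square of a sum, so that it can enter the triangle
inequality for weighted norms. -/
theorem integral_sq_freeResolvent_le (hp1 : 1 ≤ p) (hp2 : p < 4 / 3) {z : ℂ} (hz : z.re = 1)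
    (hz0 : z.im ≠ 0) (hf : Measurable f) (hf1 : Integrable f) (hf2 : MemLp f 2)
    (hfp : Integrable fun x => ‖f x‖ ^ p) :
    ∫ x, ‖freeResolvent z f x‖ ^ 2 ≤
      (√(32 / (1 - 2 ^ (3 - 4 / p))) * |z.im| ^ (-(2 - 2 / p)) * (∫ x, ‖f x‖ ^ p) ^ (1 / p) +
        |z.im| ^ (-(1 / 2) : ℝ) * sphereNorm f) ^ 2 := by
  have hε : 0 < |z.im| := abs_pos.2 hz0
  refine (integral_sq_resolvent_le hp1 hp2 hz hz0 hf hf1 hf2 hfp).trans ?_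
  have hA : 0 ≤ (∫ x, ‖f x‖ ^ p) ^ (1 / p) :=
    Real.rpow_nonneg (integral_nonneg fun x => by positivity) _
  have hN : 0 ≤ ∫ ω : S2, ‖𝓕 f ((2 * Real.pi)⁻¹ • (ω : E3))‖ ^ 2 ∂sphereMeasure :=
    integral_nonneg fun ω => by positivity
  have hC : 0 ≤ 32 / (1 - (2 : ℝ) ^ (3 - 4 / p)) := by
    have hp0 : 0 < p := by linarith
    have : 3 - 4 / p ≤ 0 := by
      rw [sub_nonpos, le_div_iff₀ hp0]; linarith
    have := Real.rpow_le_one_of_one_le_of_nonpos (x := 2) (by norm_num) this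
    exact div_nonneg (by norm_num) (by linarith)
  have e1 : (|z.im| ^ (-(1 / 2) : ℝ)) ^ 2 = |z.im|⁻¹ := by
    rw [← Real.rpow_natCast, ← Real.rpow_mul hε.le, ← Real.rpow_neg_one]; norm_num
  have hn := sphereNorm_nonneg f
  have e2 : sphereNorm f ^ 2 = _ := Real.sq_sqrt hN
  have e3 := Real.sq_sqrt hC
  rw [← e1, ← e2]
  nth_rewrite 1 [← e3]
  have : 0 ≤ 2 * (√(32 / (1 - (2 : ℝ) ^ (3 - 4 / p))) * |z.im| ^ (-(2 - 2 / p)) *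
    (∫ x, ‖f x‖ ^ p) ^ (1 / p)) * (|z.im| ^ (-(1 / 2) : ℝ) * sphereNorm f) := by positivity
  linarith

/-- The weighted estimate, uniform up to the spectrum apart from the contribution of the sphere. -/
theorem exists_eLpNorm_weight_freeResolvent_le (hp1 : 1 ≤ p) (hp2 : p < 4 / 3) {η : ℝ}
    (hη : 2 - 2 / p < η) : ∃ H L : ℝ, 0 ≤ H ∧ 0 ≤ L ∧ ∀ f : E3 → ℂ, Measurable f → Integrable f →
      MemLp f 2 → (Integrable fun x => ‖f x‖ ^ p) → ∀ z : ℂ, z.re = 1 → z.im ≠ 0 →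
      eLpNorm (fun x => weight η x * freeResolvent z f x) 2 ≤
        ENNReal.ofReal (H * (∫ x, ‖f x‖ ^ p) ^ (1 / p) + (1 + L * |z.im|⁻¹) * sphereNorm f) := by
  have hp0 : 0 < p := by linarith
  set θ := 2 - 2 / p with hθ
  have hθ0 : 0 ≤ θ := by
    rw [hθ, sub_nonneg, div_le_iff₀ hp0]; linarith
  have hθ2 : θ < 1 / 2 := by
    have : 3 / 2 < 2 / p := by rw [lt_div_iff₀ hp0]; linarith
    linarith
  -- An exponent strictly between the loss θ and the admissible gains; θ < 1/2 is where p < 4/3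
  -- enters again.
  obtain ⟨η', h1, h2⟩ := exists_between (lt_min hη hθ2)
  have h2a := (lt_min_iff.1 h2).1
  have h2b := (lt_min_iff.1 h2).2
  have hη'0 : 0 < η' := by linarith
  have hη0 : 0 < η := by linarith
  set s := η' - θ with hs
  have hs0 : 0 < s := by linarith
  set c₁ := √(32 / (1 - (2 : ℝ) ^ (3 - 4 / p)))
  set c₂ := √(4 * (η / (η - η')))
  have hc₁ : 0 ≤ c₁ := Real.sqrt_nonneg _
  have hc₂ : 0 ≤ c₂ := Real.sqrt_nonneg _
  have hc₂sq : c₂ ^ 2 = 4 * (η / (η - η')) :=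
    Real.sq_sqrt (by have := sub_pos.2 h2a; positivity)
  have h2s : 1 < (2 : ℝ) ^ s := Real.one_lt_rpow (by norm_num) hs0
  -- Solves the recursion -Q(2τ)^s + c₁c₂τ^s = -Qτ^s exactly, so the induction bound H - Qτ^s
  -- reproduces itself under halving of τ.
  set Q := c₂ * c₁ / (2 ^ s - 1)
  have hQ0 : 0 ≤ Q := div_nonneg (by positivity) (by linarith)
  have hQ : Q * (2 ^ s - 1) = c₂ * c₁ := div_mul_cancel₀ _ (by linarith)
  -- The extra Q · 2^s keeps H - Qτ^s ≥ c₁ for all τ ≤ 2, which starts the induction; L ≥ 2 covers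
  -- the sphere term there, and L ≥ 2c₂ closes its recursion.
  set H := c₁ + Q * 2 ^ s
  set L := 2 * c₂ + 2
  refine ⟨H, L, by positivity, by positivity, fun f hf hf1 hf2 hfp => ?_⟩
  set A := (∫ x, ‖f x‖ ^ p) ^ (1 / p)
  set n := sphereNorm f
  have hA : 0 ≤ A := Real.rpow_nonneg (integral_nonneg fun x => by positivity) _
  have hn : 0 ≤ n := sphereNorm_nonneg f
  have hsq : ∀ z : ℂ, z.re = 1 → z.im ≠ 0 → _ := fun z hz hz0 =>
    integral_sq_freeResolvent_le hp1 hp2 hz hz0 hf hf1 hf2 hfp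
  have hbase : ∀ z : ℂ, z.re = 1 → 1 ≤ |z.im| →
      eLpNorm (fun x => weight η x * freeResolvent z f x) 2 ≤ ENNReal.ofReal (c₁ * A + n) := by
    intro z hz h1z
    have hz0 : z.im ≠ 0 := abs_pos.1 (by linarith)
    have hm := memLp_freeResolvent hz0 hf1 hf2
    have hi := (memLp_two_iff_integrable_sq_norm hm.1).1 hm
    refine eLpNorm_weight_mul_le hη0.le hm (by positivity) ?_
    refine le_trans (integral_mono_of_nonneg (Eventually.of_forall fun x => by positivity) hi
      (Eventually.of_forall fun x => mul_le_of_le_one_right (by positivity)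
        (Real.rpow_le_one_of_one_le_of_nonpos (by simp) (by linarith)))) ((hsq z hz hz0).trans ?_)
    have e1 := Real.rpow_le_one_of_one_le_of_nonpos h1z (z := -θ) (by linarith)
    have e2 := Real.rpow_le_one_of_one_le_of_nonpos h1z (z := -(1 / 2)) (by norm_num)
    gcongr
    · exact mul_le_of_le_one_right hc₁ e1
    · exact mul_le_of_le_one_left hn e2
  have hstep : ∀ τ : ℝ, τ ≠ 0 → |τ| ≤ 1 →
      eLpNorm (fun x => weight η x * freeResolvent ⟨1, τ⟩ f x) 2 ≤
        eLpNorm (fun x => weight η x * freeResolvent ⟨1, 2 * τ⟩ f x) 2 +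
          ENNReal.ofReal (c₂ * c₁ * |τ| ^ s * A + c₂ * |τ|⁻¹ * n) := by
    intro τ hτ hτ1
    set z : ℂ := ⟨1, τ⟩
    set z' : ℂ := ⟨1, 2 * τ⟩
    have hz : z.im ≠ 0 := hτ
    have hz' : z'.im ≠ 0 := mul_ne_zero two_ne_zero hτ
    have hε : 0 < |τ| := abs_pos.2 hτ
    have hzz : ‖z - z'‖ ≤ |z.im| := by
      have : z - z' = ((-τ : ℝ) : ℂ) * Complex.I := by
        apply Complex.ext <;> simp [z, z']; ring
      rw [this, norm_mul, Complex.norm_I, mul_one, Complex.norm_real, norm_neg, Real.norm_eq_abs]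
    have hD := integral_weight_sq_resolventDiff_le (z := z) (z' := z') rfl hz hz' hzz hf hf1 hf2
      hη'0 h2b.le h2a
    have hU := hsq z' rfl hz'
    have hz'a : |z'.im| = 2 * |τ| := by simp [z', abs_mul]
    rw [hz'a] at hU
    have e1 : (2 * |τ|) ^ (-θ) ≤ |τ| ^ (-θ) :=
      Real.rpow_le_rpow_of_nonpos hε (by linarith) (by linarith)
    -- Deliberately lossy: the coefficient of the sphere norm may diverge as τ → 0, since that norm
    -- is sent to zero for fixed τ.
    have e2 : (2 * |τ|) ^ (-(1 / 2) : ℝ) ≤ |τ|⁻¹ := by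
      rw [← Real.rpow_neg_one]
      exact (Real.rpow_le_rpow_of_nonpos hε (by linarith) (by norm_num)).trans
        (Real.rpow_le_rpow_of_exponent_ge hε hτ1 (by norm_num))
    have e3 : |τ| ^ η' * |τ| ^ (-θ) = |τ| ^ s := by rw [← Real.rpow_add hε]; rfl
    have e4 : |τ| ^ η' ≤ 1 := Real.rpow_le_one hε.le hτ1 hη'0.le
    have hτη : 0 ≤ |τ| ^ η' := by positivity
    have hDm := memLp_resolventDiff hz hz' hf1 hf2
    have hB : eLpNorm (fun x => weight η x * resolventDiff z z' f x) 2 ≤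
        ENNReal.ofReal (c₂ * c₁ * |τ| ^ s * A + c₂ * |τ|⁻¹ * n) := by
      refine eLpNorm_weight_mul_le hη0.le hDm (by positivity) (hD.trans ?_)
      have e5 : |z.im| ^ (2 * η') = (|τ| ^ η') ^ 2 := by
        rw [← Real.rpow_natCast, ← Real.rpow_mul hε.le]; congr 1; push_cast; ring
      rw [e5, ← hc₂sq]
      calc c₂ ^ 2 * (|τ| ^ η') ^ 2 * ∫ x, ‖freeResolvent z' f x‖ ^ 2
          ≤ c₂ ^ 2 * (|τ| ^ η') ^ 2 *
            (c₁ * (2 * |τ|) ^ (-θ) * A + (2 * |τ|) ^ (-(1 / 2) : ℝ) * n) ^ 2 := by gcongr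
        _ ≤ c₂ ^ 2 * (|τ| ^ η') ^ 2 * (c₁ * |τ| ^ (-θ) * A + |τ|⁻¹ * n) ^ 2 := by gcongr
        _ = (c₂ * c₁ * (|τ| ^ η' * |τ| ^ (-θ)) * A + c₂ * (|τ| ^ η' * |τ|⁻¹) * n) ^ 2 := by ring
        _ ≤ _ := by
          rw [e3]
          gcongr
          exact mul_le_of_le_one_left (by positivity) e4
    have hsplit : (fun x => weight η x * freeResolvent z f x) =
        (fun x => weight η x * freeResolvent z' f x) + fun x => weight η x * resolventDiff z z' f x := by
      ext x; simp only [Pi.add_apply, resolventDiff]; ring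
    rw [hsplit]
    have hw := (measurable_weight η).aestronglyMeasurable (μ := (volume : Measure E3))
    refine (eLpNorm_add_le (hw.mul (memLp_freeResolvent hz' hf1 hf2).1) (hw.mul hDm.1)
      (by norm_num)).trans (add_le_add le_rfl hB)
  -- Induction on the number of doublings needed to bring |τ| into [1, 2], with a bound whose
  -- constants do not depend on `m`.
  have hind : ∀ m : ℕ, ∀ τ : ℝ, (1 / 2) ^ m ≤ |τ| → |τ| ≤ 2 →
      eLpNorm (fun x => weight η x * freeResolvent ⟨1, τ⟩ f x) 2 ≤
        ENNReal.ofReal ((H - Q * |τ| ^ s) * A + L * |τ|⁻¹ * n) := by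
    have hone : ∀ τ : ℝ, 1 ≤ |τ| → |τ| ≤ 2 →
        eLpNorm (fun x => weight η x * freeResolvent ⟨1, τ⟩ f x) 2 ≤
          ENNReal.ofReal ((H - Q * |τ| ^ s) * A + L * |τ|⁻¹ * n) := by
      intro τ h1τ h2τ
      refine (hbase ⟨1, τ⟩ rfl h1τ).trans (ENNReal.ofReal_le_ofReal ?_)
      have e1 : |τ| ^ s ≤ 2 ^ s := Real.rpow_le_rpow (by positivity) h2τ hs0.le
      have e2 : c₁ ≤ H - Q * |τ| ^ s := by
        have := mul_le_mul_of_nonneg_left e1 hQ0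
        simp only [H]; linarith
      have e3 : 1 ≤ L * |τ|⁻¹ := by
        rw [← div_eq_mul_inv, le_div_iff₀ (by linarith)]
        simp only [L]; linarith
      have := mul_le_mul_of_nonneg_right e2 hA
      have := mul_le_mul_of_nonneg_right e3 hn
      linarith
    intro m
    induction m with
    | zero => intro τ h1τ h2τ; exact hone τ (by simpa using h1τ) h2τ
    | succ m ih =>
      intro τ h1τ h2τ
      rcases le_total 1 |τ| with h | h
      · exact hone τ h h2τ
      have hε : 0 < |τ| := lt_of_lt_of_le (by positivity) h1τ
      have ha : |2 * τ| = 2 * |τ| := by simp [abs_mul]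
      have h3 := ih (2 * τ) (by rw [ha]; rw [pow_succ] at h1τ; linarith) (by rw [ha]; linarith)
      rw [ha] at h3
      refine (hstep τ (abs_pos.1 hε) h).trans ((add_le_add_left h3 _).trans ?_)
      have e1 : (2 * |τ|) ^ s = 2 ^ s * |τ| ^ s := Real.mul_rpow (by norm_num) hε.le
      have hH : 0 ≤ H - Q * (2 * |τ|) ^ s := by
        have : (2 * |τ|) ^ s ≤ 2 ^ s := Real.rpow_le_rpow (by positivity) (by linarith) hs0.le
        have := mul_le_mul_of_nonneg_left this hQ0
        simp only [H]; linarith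
      rw [← ENNReal.ofReal_add (by positivity) (by positivity)]
      refine ENNReal.ofReal_le_ofReal ?_
      rw [e1, ← hQ, mul_inv]
      have e4 : c₂ * |τ|⁻¹ * n ≤ L / 2 * |τ|⁻¹ * n := by
        gcongr
        simp only [L]; linarith
      have : (H - Q * (2 ^ s * |τ| ^ s)) * A + Q * (2 ^ s - 1) * |τ| ^ s * A =
          (H - Q * |τ| ^ s) * A := by ring
      linarith
  intro z hz hz0
  have hε : 0 < |z.im| := abs_pos.2 hz0
  have hzeq : z = ⟨1, z.im⟩ := Complex.ext hz rfl
  have hinv : 0 ≤ L * |z.im|⁻¹ * n := by positivity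
  rcases le_total 1 |z.im| with h | h
  · refine (hbase z hz h).trans (ENNReal.ofReal_le_ofReal ?_)
    have : c₁ * A ≤ H * A := by
      gcongr
      have : 0 ≤ Q * 2 ^ s := by positivity
      simp only [H]; linarith
    linarith
  · obtain ⟨m, hm⟩ := exists_pow_lt_of_lt_one hε (by norm_num : (1 / 2 : ℝ) < 1)
    have h3 := hind m z.im hm.le (by linarith)
    rw [← hzeq] at h3
    refine h3.trans (ENNReal.ofReal_le_ofReal ?_)
    have : 0 ≤ Q * |z.im| ^ s * A := by positivity
    linarith

end Uniform

/-! ### Young's inequality for the resolvent kernel -/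

section Young

variable {K h : E3 → ℂ}

/-- Young's inequality for `L¹ * L^p`, in terms of lower integrals. -/
theorem lintegral_lintegral_enorm_mul_rpow_le (hK : Measurable K) (hK1 : Integrable K)
    (hh : Measurable h) {p : ℝ} (hp : 1 ≤ p) :
    ∫⁻ x, (∫⁻ y, ‖K (x - y)‖ₑ * ‖h y‖ₑ) ^ p ≤ (∫⁻ x, ‖K x‖ₑ) ^ p * ∫⁻ x, ‖h x‖ₑ ^ p := by
  have hp0 : 0 < p := by linarith
  have hKs : ∀ x, ∫⁻ y, ‖K (x - y)‖ₑ = ∫⁻ y, ‖K y‖ₑ := fun x =>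
    lintegral_sub_left_eq_self (fun y => ‖K y‖ₑ) x
  have hKsub : Measurable fun q : E3 × E3 => ‖K (q.1 - q.2)‖ₑ :=
    (hK.comp (measurable_fst.sub measurable_snd)).enorm
  have hpt : ∀ x, (∫⁻ y, ‖K (x - y)‖ₑ * ‖h y‖ₑ) ^ p ≤
      (∫⁻ y, ‖K y‖ₑ) ^ (p - 1) * ∫⁻ y, ‖K (x - y)‖ₑ * ‖h y‖ₑ ^ p := by
    intro x
    have hm : Measurable fun y => ‖K (x - y)‖ₑ := (hK.comp (measurable_const.sub measurable_id)).enorm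
    have hpi : 0 ≤ 1 - p⁻¹ := sub_nonneg.2 (inv_le_one_of_one_le₀ hp)
    -- Hölder applied to |K||h| = |K|^{1 - 1/p} · (|K||h|^p)^{1/p}.
    have := ENNReal.lintegral_mul_norm_pow_le (μ := (volume : Measure E3)) hm.aemeasurable
      (hm.mul (hh.enorm.pow_const p)).aemeasurable hpi (inv_nonneg.2 hp0.le) (by ring)
    rw [hKs] at this
    have e : ∀ y, ‖K (x - y)‖ₑ ^ (1 - p⁻¹) * (‖K (x - y)‖ₑ * ‖h y‖ₑ ^ p) ^ p⁻¹ =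
        ‖K (x - y)‖ₑ * ‖h y‖ₑ := fun y => by
      rw [ENNReal.mul_rpow_of_nonneg _ _ (inv_nonneg.2 hp0.le), ← mul_assoc,
        ← ENNReal.rpow_add_of_nonneg _ _ hpi (inv_nonneg.2 hp0.le), ← ENNReal.rpow_mul,
        mul_inv_cancel₀ hp0.ne', ENNReal.rpow_one, sub_add_cancel, ENNReal.rpow_one]
    simp only [Pi.mul_apply, e] at this
    refine (ENNReal.rpow_le_rpow this hp0.le).trans_eq ?_
    rw [ENNReal.mul_rpow_of_nonneg _ _ hp0.le, ← ENNReal.rpow_mul, ← ENNReal.rpow_mul,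
      inv_mul_cancel₀ hp0.ne', ENNReal.rpow_one, sub_mul, one_mul, inv_mul_cancel₀ hp0.ne']
  calc ∫⁻ x, (∫⁻ y, ‖K (x - y)‖ₑ * ‖h y‖ₑ) ^ p
      ≤ ∫⁻ x, (∫⁻ y, ‖K y‖ₑ) ^ (p - 1) * ∫⁻ y, ‖K (x - y)‖ₑ * ‖h y‖ₑ ^ p := lintegral_mono hpt
    _ = (∫⁻ y, ‖K y‖ₑ) ^ (p - 1) * ∫⁻ x, ∫⁻ y, ‖K (x - y)‖ₑ * ‖h y‖ₑ ^ p :=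
      lintegral_const_mul' _ _ (ENNReal.rpow_ne_top_of_nonneg (by linarith) hK1.2.ne)
    _ = (∫⁻ y, ‖K y‖ₑ) ^ (p - 1) * ∫⁻ y, ∫⁻ x, ‖K (x - y)‖ₑ * ‖h y‖ₑ ^ p := by
      rw [lintegral_lintegral_swap]
      exact (hKsub.mul ((hh.comp measurable_snd).enorm.pow_const p)).aemeasurable
    _ = (∫⁻ y, ‖K y‖ₑ) ^ (p - 1) * ((∫⁻ y, ‖K y‖ₑ) * ∫⁻ y, ‖h y‖ₑ ^ p) := by
      congr 1
      have : ∀ y, ∫⁻ x, ‖K (x - y)‖ₑ * ‖h y‖ₑ ^ p = (∫⁻ x, ‖K x‖ₑ) * ‖h y‖ₑ ^ p := fun y => by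
        have hm : Measurable fun x => ‖K (x - y)‖ₑ := (hK.comp (measurable_id.sub_const y)).enorm
        rw [lintegral_mul_const _ hm,
          lintegral_sub_right_eq_self (fun x => ‖K x‖ₑ) y]
      simp only [this]
      rw [lintegral_const_mul _ (hh.enorm.pow_const p)]
    _ = _ := by
      rw [← mul_assoc]
      nth_rewrite 2 [← ENNReal.rpow_one (∫⁻ y, ‖K y‖ₑ)]
      rw [← ENNReal.rpow_add_of_nonneg _ _ (by linarith) zero_le_one, sub_add_cancel]

/-- The p-th power of the absolute convolution has finite integral in x, so the inner integral is
finite for almost every x. -/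
theorem ae_integrable_conv (hK : Measurable K) (hK1 : Integrable K) (hh : Measurable h) {p : ℝ≥0∞}
    (hp : 1 ≤ p) (hpt : p ≠ ∞) (hhp : MemLp h p) :
    ∀ᵐ x, Integrable (fun y => K (x - y) * h y) := by
  have hP : 1 ≤ p.toReal := by simpa using ENNReal.toReal_mono hpt hp
  have hfin := (eLpNorm_lt_top_iff_lintegral_rpow_enorm_lt_top (by positivity) hpt).1 hhp.2
  have hlt := (lintegral_lintegral_enorm_mul_rpow_le hK hK1 hh hP).trans_lt
    (ENNReal.mul_lt_top (ENNReal.rpow_lt_top_of_nonneg (by linarith) hK1.2.ne) hfin)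
  have hm : Measurable fun q : E3 × E3 => ‖K (q.1 - q.2)‖ₑ * ‖h q.2‖ₑ :=
    (hK.comp (measurable_fst.sub measurable_snd)).enorm.mul (hh.comp measurable_snd).enorm
  filter_upwards [ae_lt_top (hm.lintegral_prod_right'.pow_const _) hlt.ne] with x hx
  refine ⟨((hK.comp (measurable_const.sub measurable_id)).mul hh).aestronglyMeasurable, ?_⟩
  simp only [hasFiniteIntegral_iff_enorm, enorm_mul]
  exact (ENNReal.rpow_lt_top_iff_of_pos (by linarith)).1 hx

theorem eLpNorm_conv_le (hK : Measurable K) (hK1 : Integrable K) (hh : Measurable h) {p : ℝ≥0∞}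
    (hp : 1 ≤ p) (hpt : p ≠ ∞) :
    eLpNorm (conv K h) p ≤ (∫⁻ x, ‖K x‖ₑ) * eLpNorm h p := by
  have hp0 : p ≠ 0 := (zero_lt_one.trans_le hp).ne'
  have hP : 1 ≤ p.toReal := by simpa using ENNReal.toReal_mono hpt hp
  have hP0 : 0 < p.toReal := by linarith
  rw [eLpNorm_eq_lintegral_rpow_enorm_toReal hp0 hpt, eLpNorm_eq_lintegral_rpow_enorm_toReal hp0 hpt]
  have : ∫⁻ x, ‖conv K h x‖ₑ ^ p.toReal ≤
      (∫⁻ x, ‖K x‖ₑ) ^ p.toReal * ∫⁻ x, ‖h x‖ₑ ^ p.toReal := by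
    refine le_trans (lintegral_mono fun x => ?_) (lintegral_lintegral_enorm_mul_rpow_le hK hK1 hh hP)
    refine ENNReal.rpow_le_rpow ((enorm_integral_le_lintegral_enorm _).trans_eq ?_) hP0.le
    simp only [enorm_mul]
  refine (ENNReal.rpow_le_rpow this (by positivity)).trans_eq ?_
  rw [ENNReal.mul_rpow_of_nonneg _ _ (by positivity), ← ENNReal.rpow_mul, mul_one_div_cancel hP0.ne',
    ENNReal.rpow_one]

end Young

/-! ### Passage to functions with vanishing trace -/

theorem ofReal_sphereNorm (φ : 𝓢(E3, ℂ)) :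
    ENNReal.ofReal (sphereNorm φ) =
      eLpNorm (fun ω : S2 => angularFourier φ (ω : E3)) 2 sphereMeasure := by
  have hc : Continuous fun ω : S2 => angularFourier φ (ω : E3) := by
    have : Continuous (𝓕 (φ : E3 → ℂ)) := by
      rw [← SchwartzMap.fourier_coe]; exact (𝓕 φ).continuous
    have hsmul : Continuous fun ω : S2 => (2 * Real.pi)⁻¹ • (ω : E3) := by fun_prop
    exact this.comp hsmul
  have hm : MemLp (fun ω : S2 => angularFourier φ (ω : E3)) 2 sphereMeasure :=
    hc.memLp_of_hasCompactSupport (HasCompactSupport.of_compactSpace _)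
  rw [hm.eLpNorm_eq_integral_rpow_norm (by norm_num) (by norm_num)]
  simp only [ENNReal.toReal_ofNat, Real.rpow_ofNat]
  rw [← one_div, ← Real.sqrt_eq_rpow]
  rfl

/-- Functions with vanishing trace are approximated by Schwartz functions, for which the sphere term
tends to zero. -/
theorem eLpNorm_weight_freeResolvent_le_of_trace {p : ℝ≥0∞} (hp : 1 ≤ p) (hpt : p ≠ ∞) {η H M : ℝ}
    (hH : 0 ≤ H) (hM : 0 ≤ M) {z : ℂ} (hz : z.im ≠ 0)
    (hbound : ∀ φ : 𝓢(E3, ℂ), eLpNorm (fun x => weight η x * freeResolvent z φ x) 2 ≤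
      ENNReal.ofReal (H * (∫ x, ‖φ x‖ ^ p.toReal) ^ (1 / p.toReal) + M * sphereNorm φ))
    {f : E3 → ℂ} (hf : Measurable f) (hfp : MemLp f p)
    (htr : HasSphereFourierTrace p f (fun _ => 0)) :
    eLpNorm (fun x => weight η x * freeResolvent z f x) 2 ≤ ENNReal.ofReal H * eLpNorm f p := by
  obtain ⟨φ, hφ, hS⟩ := htr
  have hp0 : p ≠ 0 := (zero_lt_one.trans_le hp).ne'
  have hP : 1 ≤ p.toReal := by simpa using ENNReal.toReal_mono hpt hp
  have hk := upperSqrt_im_pos hz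
  set K := waveKernel (upperSqrt z)
  have hK : Measurable K := measurable_waveKernel _
  have hK1 : Integrable K := integrable_waveKernel hk
  have hφm : ∀ n, Measurable (φ n) := fun n => (φ n).continuous.measurable
  have hφp : ∀ n, MemLp (φ n) p := fun n => (φ n).memLp p
  have hconv : Tendsto (fun n => eLpNorm (freeResolvent z (φ n) - freeResolvent z f) p) atTop (𝓝 0) := by
    have hle : ∀ n, eLpNorm (freeResolvent z (φ n) - freeResolvent z f) p ≤
        (∫⁻ x, ‖K x‖ₑ) * eLpNorm (fun x => φ n x - f x) p := fun n => by
      refine le_of_eq_of_le (eLpNorm_congr_ae ?_) (eLpNorm_conv_le hK hK1 ((hφm n).sub hf) hp hpt)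
      filter_upwards [ae_integrable_conv hK hK1 (hφm n) hp hpt (hφp n),
        ae_integrable_conv hK hK1 hf hp hpt hfp] with x h1 h2
      rw [Pi.sub_apply, freeResolvent_eq_conv, freeResolvent_eq_conv]
      simp only [conv]
      rw [← integral_sub h1 h2]
      simp only [Pi.sub_apply, mul_sub]
    have := ENNReal.Tendsto.const_mul hφ (Or.inr hK1.2.ne)
    rw [mul_zero] at this
    exact tendsto_of_tendsto_of_tendsto_of_le_of_le tendsto_const_nhds this (fun _ => zero_le) hle
  have hmeas : ∀ g : E3 → ℂ, Measurable g → AEStronglyMeasurable (freeResolvent z g) volume :=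
    fun g hg => (stronglyMeasurable_freeResolvent z hg).aestronglyMeasurable
  -- Convergence in L^p yields almost everywhere convergence along a subsequence, which is what
  -- Fatou's lemma for the weighted L² norm requires.
  obtain ⟨ns, hns, hae⟩ := (tendstoInMeasure_of_tendsto_eLpNorm hp0 (fun n => hmeas _ (hφm n))
    (hmeas f hf) hconv).exists_seq_tendsto_ae
  have hw := (measurable_weight η).aestronglyMeasurable (μ := (volume : Measure E3))
  refine (Lp.eLpNorm_lim_le_liminf_eLpNorm
    (f := fun i x => weight η x * freeResolvent z (φ (ns i)) x)
    (fun i => hw.mul (hmeas _ (hφm _))) _ (by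
      filter_upwards [hae] with x hx using hx.const_mul _)).trans ?_
  have hA : ∀ n, ENNReal.ofReal ((∫ x, ‖φ n x‖ ^ p.toReal) ^ (1 / p.toReal)) = eLpNorm (φ n) p :=
    fun n => by rw [(hφp n).eLpNorm_eq_integral_rpow_norm hp0 hpt, one_div]
  have hlim : Tendsto (fun n => ENNReal.ofReal H * (eLpNorm f p + eLpNorm (fun x => φ n x - f x) p) +
      ENNReal.ofReal M * eLpNorm (fun ω : S2 => angularFourier (φ n) (ω : E3)) 2 sphereMeasure) atTop
      (𝓝 (ENNReal.ofReal H * eLpNorm f p)) := by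
    simp only [sub_zero] at hS
    have h1 := ENNReal.Tendsto.const_mul (a := ENNReal.ofReal H)
      ((tendsto_const_nhds (x := eLpNorm f p volume)).add hφ) (Or.inr ENNReal.ofReal_ne_top)
    have h2 := ENNReal.Tendsto.const_mul (a := ENNReal.ofReal M) hS (Or.inr ENNReal.ofReal_ne_top)
    simpa using h1.add h2
  refine (liminf_le_liminf (Eventually.of_forall fun i => ?_)).trans
    (hlim.comp hns.tendsto_atTop).liminf_eq.le
  refine (hbound (φ (ns i))).trans ?_
  rw [ENNReal.ofReal_add (mul_nonneg hH (Real.rpow_nonneg (integral_nonneg fun x => by positivity) _))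
    (mul_nonneg hM (sphereNorm_nonneg _)), ENNReal.ofReal_mul hH, ENNReal.ofReal_mul hM, hA,
    ofReal_sphereNorm]
  simp only [Function.comp_apply]
  gcongr
  have e : (φ (ns i) : E3 → ℂ) = f + fun x => φ (ns i) x - f x := by
    ext x; simp
  conv_lhs => rw [e]
  exact eLpNorm_add_le hfp.1 ((hφp _).1.sub hfp.1) hp

theorem mainTheorem3 (p q : ℝ≥0∞) (hpq : ENNReal.HolderConjugate p q)
    (hp1 : 1 ≤ p) (hp2 : p < 4 / 3) (δ : ℝ) (hδ : δ < 1 / 2 - 2 * (q⁻¹).toReal) :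
    ∃ C : ℝ≥0, ∀ f : E3 → ℂ, MemLp f p volume →
      HasSphereFourierTrace p f (fun _ => 0) →
      ∀ ε : ℝ, 0 < ε → ∀ z : ℂ,
        (z = 1 + (ε : ℂ) * Complex.I ∨ z = 1 - (ε : ℂ) * Complex.I) →
        (∀ᵐ x : E3, Integrable (fun y : E3 => freeResolventKernel z (x - y) * f y) volume) ∧
        MemLp (fun x : E3 => (((1 + ‖x‖) ^ (δ - 1 / 2) : ℝ) : ℂ) * freeResolvent z f x) 2 volume ∧
        eLpNorm (fun x : E3 => (((1 + ‖x‖) ^ (δ - 1 / 2) : ℝ) : ℂ) * freeResolvent z f x) 2 volume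
          ≤ (C : ℝ≥0∞) * eLpNorm f p volume := by
  have hpt : p ≠ ∞ := (hp2.trans_le le_top).ne
  have hp0 : p ≠ 0 := (zero_lt_one.trans_le hp1).ne'
  have hP1 : 1 ≤ p.toReal := by simpa using ENNReal.toReal_mono hpt hp1
  have h43 : (4 / 3 : ℝ≥0∞) ≠ ∞ := ENNReal.div_ne_top (by norm_num) (by norm_num)
  have hP2 : p.toReal < 4 / 3 := by
    have := (ENNReal.toReal_lt_toReal hpt h43).2 hp2
    simpa using this
  have hq : (q⁻¹).toReal = 1 - 1 / p.toReal := by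
    have h1 : p⁻¹ + q⁻¹ = 1 := hpq.inv_add_inv_eq_one
    have h2 := congrArg ENNReal.toReal h1
    have hq' : q⁻¹ ≠ ∞ := ne_top_of_le_ne_top ENNReal.one_ne_top (h1 ▸ le_add_self)
    rw [ENNReal.toReal_add (ENNReal.inv_ne_top.2 hp0) hq', ENNReal.toReal_inv, ENNReal.toReal_one] at h2
    rw [one_div]; linarith
  have hη : 2 - 2 / p.toReal < 1 / 2 - δ := by
    rw [hq] at hδ
    have : 2 / p.toReal = 2 * (1 / p.toReal) := by ring
    linarith
  obtain ⟨H, L, hH, hL, hbound⟩ := exists_eLpNorm_weight_freeResolvent_le hP1 hP2 hη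
  -- Only `H` survives: the ε-dependent coefficient of the sphere norm disappears in the limit,
  -- which makes the constant independent of ε and f.
  refine ⟨H.toNNReal, fun f hfp htr ε hε z hz => ?_⟩
  have hre : z.re = 1 := by rcases hz with rfl | rfl <;> simp
  have him : z.im ≠ 0 := by rcases hz with rfl | rfl <;> simp [hε.ne']
  -- A Borel representative; the resolvent integral, the trace condition and the norms are unchanged
  -- by it.
  set g := hfp.1.mk f
  have hfg : f =ᵐ[volume] g := hfp.1.ae_eq_mk
  have hg : Measurable g := hfp.1.stronglyMeasurable_mk.measurable
  have hgp : MemLp g p := hfp.ae_eq hfg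
  have hres : freeResolvent z f = freeResolvent z g := by
    ext x
    refine integral_congr_ae ?_
    filter_upwards [hfg] with y hy
    rw [hy]
  have htr' : HasSphereFourierTrace p g (fun _ => 0) := by
    obtain ⟨φ, h1, h2⟩ := htr
    refine ⟨φ, h1.congr fun n => eLpNorm_congr_ae ?_, h2⟩
    filter_upwards [hfg] with y hy
    rw [hy]
  have hk := upperSqrt_im_pos him
  have hw : ∀ x : E3, (((1 + ‖x‖) ^ (δ - 1 / 2) : ℝ) : ℂ) = weight (1 / 2 - δ) x := fun x => by
    rw [weight, neg_sub]
  have hS : ∀ φ : 𝓢(E3, ℂ), eLpNorm (fun x => weight (1 / 2 - δ) x * freeResolvent z φ x) 2 ≤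
      ENNReal.ofReal (H * (∫ x, ‖φ x‖ ^ p.toReal) ^ (1 / p.toReal) +
        (1 + L * |z.im|⁻¹) * sphereNorm φ) := fun φ =>
    hbound φ φ.continuous.measurable φ.integrable (φ.memLp 2)
      ((φ.memLp p).integrable_norm_rpow hp0 hpt) z hre him
  have hmain := eLpNorm_weight_freeResolvent_le_of_trace hp1 hpt hH (by positivity) him hS hg hgp htr'
  simp only [hw, hres]
  rw [eLpNorm_congr_ae hfg]
  refine ⟨?_, ⟨(measurable_weight _).aestronglyMeasurable.mul
    (stronglyMeasurable_freeResolvent z hg).aestronglyMeasurable, hmain.trans_lt ?_⟩, hmain⟩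
  · filter_upwards [ae_integrable_conv (measurable_waveKernel _) (integrable_waveKernel hk) hg hp1 hpt
      hgp] with x hx
    refine hx.congr ?_
    filter_upwards [hfg] with y hy
    rw [hy]
    rfl
  · exact ENNReal.mul_lt_top ENNReal.ofReal_lt_top hgp.2
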